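/- \textbf{Theorem (Flow towards an attractive force).} Let $L,T,\alpha>0$, $\Omega=(0,L]\times(0,T]$, $\bar\Omega=[0,L]\times[0,T]$, let $a,b\in C^2(\bar\Omega)$ with $a\ge\alpha$ and $b\ge 0$ on $\bar\Omega$, $\phi\in C^2([0,L])$, $\psi\in C^2([0,T])$, and let $C_1\in\mathbb R$ and $C_2>\alpha^{-1}$; none of these depends on $\varepsilon$. Then there is a constant $C$, depending only on these data (in particular not on $\varepsilon$, $N$, $M$), such that the following holds for every $\varepsilon\in(0,1]$ and all positive even integers $N,M$. Let $f=f(\cdot,\cdot;\varepsilon)\in C^2(\bar\Omega)$ satisfy $$\Bigl|\frac{\partial^{i+j}f}{\partial x^i\partial t^j}(x,t)\Bigr|\le \frac{C_1}{\varepsilon^{1+i}}\,e^{(x-L)/\varepsilon}\quad\text{on }\bar\Omega,\ 0\le i+j\le 2,\qquad \frac{\partial^{i+j}f}{\partial x^i\partial t^j}(0,0)=0,\quad 0\le i+j\le 1,$$ and let the data satisfy the compatibility conditions $\phi(0)=\psi(0)$, $\psi'(0)+a\phi'(0)+b\psi(0)=f$ and $$\bigl[f_t-b_t\psi(0)-b\,\psi'(0)-\psi''(0)\bigr]+\phi'(0)\bigl[a(b+a_x)-a_t\bigr]+a^2\phi''(0)=a\bigl[f_x-b_x\psi(0)\bigr],$$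 where $a,b,f$ and their derivatives are evaluated at $(0,0)$. Let $u\in C^1(\Omega)\cap C^0(\bar\Omega)$ be the solution of $$u_t+a u_x+bu=f\ \text{ in }\Omega,\qquad u(0,t)=\psi(t),\ 0\le t\le T,\qquad u(x,0)=\phi(x),\ 0\le x\le L.$$ Put $\sigma=\min\{L/2,\ \varepsilon\ln N\}$, $\tau=\min\{T/2,\ C_2\,\varepsilon\ln M\}$, $H=2(L-\sigma)/N$, $\rho=H/\varepsilon$. Let $0=x_0<\dots<x_N=L$ be the mesh that has $N/2$ equal subintervals in each of $[0,L-\sigma]$ and $[L-\sigma,L]$, and $0=t_0<\dots<t_M=T$ the mesh that has $M/2$ equal subintervals in each of $[0,\tau]$ and $[\tau,T]$. Let $U$ be the mesh function with $U(0,t_j)=\psi(t_j)$ for $0\le j\le M$, $U(x_i,0)=\phi(x_i)$ for $0\le i\le N$, and, for $1\le i\le N$, $1\le j\le M$, $$D_t^-U(x_i,t_j)+\theta_i\,a(x_i,t_j)\,D_x^-U(x_i,t_j)+b(x_i,t_j)\,U(x_i,t_j)=f(x_i,t_j),$$ where $D_t^-U(x_i,t_j)=\frac{U(x_i,t_j)-U(x_i,t_{j-1})}{t_j-t_{j-1}}$,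 $D_x^-U(x_i,t_j)=\frac{U(x_i,t_j)-U(x_{i-1},t_j)}{x_i-x_{i-1}}$, and $\theta_i=1$ if $x_i\ne L-\sigma$, $\theta_i=\frac{\rho}{1-e^{-\rho}}$ if $x_i=L-\sigma$. Let $\bar U$ be the piecewise bilinear interpolant of $U$ on $\bar\Omega$. Then $$\max_{\bar\Omega}|\bar U-u|\le C\bigl(N^{-1}\ln N+M^{-1}\ln M\bigr).$$ -/

import Mathlib

noncomputable section

namespace TransportLayer

/-- The closed space-time domain `[0,L] × [0,T]`. -/
def closedDomain (L T : ℝ) : Set (ℝ × ℝ) := Set.Icc 0 L ×ˢ Set.Icc 0 T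

/-- The domain `Ω = (0,L] × (0,T]`. -/
def domain (L T : ℝ) : Set (ℝ × ℝ) := Set.Ioc 0 L ×ˢ Set.Ioc 0 T

/-- The partial derivative in `x` on `[0,L]` (one-sided at the end points). -/
def partialX (L : ℝ) (g : ℝ → ℝ → ℝ) : ℝ → ℝ → ℝ :=
  fun x t => derivWithin (fun s => g s t) (Set.Icc 0 L) x

/-- The partial derivative in `t` on `[0,T]` (one-sided at the end points). -/
def partialT (T : ℝ) (g : ℝ → ℝ → ℝ) : ℝ → ℝ → ℝ :=
  fun x t => derivWithin (fun s => g x s) (Set.Icc 0 T) t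

/-- The derivative `∂^{i+j} g / ∂x^i ∂t^j`. -/
def mixedPartial (L T : ℝ) (i j : ℕ) (g : ℝ → ℝ → ℝ) : ℝ → ℝ → ℝ :=
  (partialX L)^[i] ((partialT T)^[j] g)

/-- The compatibility conditions of order zero, one and two at the corner `(0,0)` for the problem
`u_t + a u_x + b u = f`, `u(0,t) = ψ(t)`, `u(x,0) = φ(x)`. -/
structure Compatible (L T : ℝ) (a b f : ℝ → ℝ → ℝ) (φ ψ : ℝ → ℝ) : Prop where
  order_zero : φ 0 = ψ 0
  order_one :
    derivWithin ψ (Set.Icc 0 T) 0 + a 0 0 * derivWithin φ (Set.Icc 0 L) 0 + b 0 0 * ψ 0 = f 0 0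
  order_two :
    (partialT T f 0 0 - partialT T b 0 0 * ψ 0 - b 0 0 * derivWithin ψ (Set.Icc 0 T) 0
        - iteratedDerivWithin 2 ψ (Set.Icc 0 T) 0)
      + derivWithin φ (Set.Icc 0 L) 0 *
          (a 0 0 * (b 0 0 + partialX L a 0 0) - partialT T a 0 0)
      + a 0 0 ^ 2 * iteratedDerivWithin 2 φ (Set.Icc 0 L) 0
    = a 0 0 * (partialX L f 0 0 - partialX L b 0 0 * ψ 0)

/-- The forcing term has a layer at the outflow boundary `x = L`, and it vanishes at `(0,0)`
together with its first derivatives. -/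
structure OutflowLayerForcing (L T ε C₁ : ℝ) (f : ℝ → ℝ → ℝ) : Prop where
  layer_bound : ∀ i j : ℕ, i + j ≤ 2 → ∀ x ∈ Set.Icc 0 L, ∀ t ∈ Set.Icc 0 T,
    |mixedPartial L T i j f x t| ≤ C₁ / ε ^ (1 + i) * Real.exp ((x - L) / ε)
  vanish_at_corner : ∀ i j : ℕ, i + j ≤ 1 → mixedPartial L T i j f 0 0 = 0

/-- `u ∈ C^1(Ω) ∩ C^0([0,L] × [0,T])` is a (classical) solution of `u_t + a u_x + b u = f` in `Ω`,
`u(0,t) = ψ(t)`, `u(x,0) = φ(x)`. -/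
structure IsSolution (L T : ℝ) (a b f : ℝ → ℝ → ℝ) (φ ψ : ℝ → ℝ) (u : ℝ → ℝ → ℝ) : Prop where
  continuousOn : ContinuousOn (Function.uncurry u) (closedDomain L T)
  contDiffOn : ContDiffOn ℝ 1 (Function.uncurry u) (domain L T)
  equation : ∀ x ∈ Set.Ioc 0 L, ∀ t ∈ Set.Ioc 0 T,
    partialT T u x t + a x t * partialX L u x t + b x t * u x t = f x t
  inflow : ∀ t ∈ Set.Icc 0 T, u 0 t = ψ t
  initial : ∀ x ∈ Set.Icc 0 L, u x 0 = φ x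

/-- The width `σ` of the fine space mesh; the transition point is `L - σ`. -/
def sigma (L ε : ℝ) (N : ℕ) : ℝ := min (L / 2) (ε * Real.log N)

/-- The transition point `τ` of the time mesh. -/
def tau (T C₂ ε : ℝ) (M : ℕ) : ℝ := min (T / 2) (C₂ * ε * Real.log M)

/-- The coarse space step `H`. -/
def coarseX (L ε : ℝ) (N : ℕ) : ℝ := 2 * (L - sigma L ε N) / N

/-- The fine space step `h`. -/
def fineX (L ε : ℝ) (N : ℕ) : ℝ := 2 * sigma L ε N / N

/-- The coarse time step `K`. -/
def coarseT (T C₂ ε : ℝ) (M : ℕ) : ℝ := 2 * (T - tau T C₂ ε M) / M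

/-- The fine time step `k`. -/
def fineT (T C₂ ε : ℝ) (M : ℕ) : ℝ := 2 * tau T C₂ ε M / M

/-- The space mesh points `x_i`, `0 ≤ i ≤ N` (`N` even): uniform with step `H` on `[0, L - σ]` and
uniform with step `h` on `[L - σ, L]`. -/
def meshX (L ε : ℝ) (N : ℕ) (i : ℕ) : ℝ :=
  if i ≤ N / 2 then i * coarseX L ε N
  else (L - sigma L ε N) + ((i : ℝ) - (N : ℝ) / 2) * fineX L ε N

/-- The time mesh points `t_j`, `0 ≤ j ≤ M` (`M` even): uniform with step `k` on `[0, τ]` and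
uniform with step `K` on `[τ, T]`. -/
def meshT (T C₂ ε : ℝ) (M : ℕ) (j : ℕ) : ℝ :=
  if j ≤ M / 2 then j * fineT T C₂ ε M
  else tau T C₂ ε M + ((j : ℝ) - (M : ℝ) / 2) * coarseT T C₂ ε M

/-- The backward difference quotient in space on the mesh `x` (used for `i ≥ 1`). -/
def backX (x : ℕ → ℝ) (U : ℕ → ℕ → ℝ) (i j : ℕ) : ℝ :=
  (U i j - U (i - 1) j) / (x i - x (i - 1))

/-- The backward difference quotient in time on the mesh `t` (used for `j ≥ 1`). -/
def backT (t : ℕ → ℝ) (U : ℕ → ℕ → ℝ) (i j : ℕ) : ℝ :=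
  (U i j - U i (j - 1)) / (t j - t (j - 1))

/-- The upwind operator `D_t^- + a D_x^- + b` on the mesh `(x_i, t_j)`. -/
def upwind (a b : ℝ → ℝ → ℝ) (x t : ℕ → ℝ) (U : ℕ → ℕ → ℝ) (i j : ℕ) : ℝ :=
  backT t U i j + a (x i) (t j) * backX x U i j + b (x i) (t j) * U i j

/-- The fitted upwind operator on the Shishkin mesh: at the transition point `x_i = L - σ`, that is
for `i = N / 2`, the coefficient of `D_x^-` is multiplied by `ρ / (1 - e^{-ρ})`, `ρ = H / ε`. -/
def fittedUpwind (L T C₂ ε : ℝ) (N M : ℕ) (a b : ℝ → ℝ → ℝ) (U : ℕ → ℕ → ℝ) (i j : ℕ) : ℝ :=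
  let x := meshX L ε N
  let t := meshT T C₂ ε M
  let ρ := coarseX L ε N / ε
  if i = N / 2 then
    upwind a b x t U i j + a (x i) (t j) * (ρ / (1 - Real.exp (-ρ)) - 1) * backX x U i j
  else upwind a b x t U i j

/-- The mesh function `U` (its values `U i j` for `i ≤ N`, `j ≤ M`) solves the discrete problem. -/
structure IsDiscreteSolution (L T C₂ ε : ℝ) (N M : ℕ) (a b f : ℝ → ℝ → ℝ) (φ ψ : ℝ → ℝ)
    (U : ℕ → ℕ → ℝ) : Prop where
  equation : ∀ i j : ℕ, 1 ≤ i → i ≤ N → 1 ≤ j → j ≤ M →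
    fittedUpwind L T C₂ ε N M a b U i j = f (meshX L ε N i) (meshT T C₂ ε M j)
  inflow : ∀ j ≤ M, U 0 j = ψ (meshT T C₂ ε M j)
  initial : ∀ i ≤ N, U i 0 = φ (meshX L ε N i)

/-- The standard hat function centred at the `i`-th point of the mesh `z 0 < ⋯ < z n`. -/
def hat (z : ℕ → ℝ) (n i : ℕ) (s : ℝ) : ℝ :=
  if 1 ≤ i ∧ z (i - 1) ≤ s ∧ s ≤ z i then (s - z (i - 1)) / (z i - z (i - 1))
  else if i < n ∧ z i ≤ s ∧ s ≤ z (i + 1) then (z (i + 1) - s) / (z (i + 1) - z i)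
  else 0

/-- The global approximation: the piecewise bilinear interpolant of the mesh function `U`. -/
def interpolant (L T C₂ ε : ℝ) (N M : ℕ) (U : ℕ → ℕ → ℝ) (x t : ℝ) : ℝ :=
  ∑ i ∈ Finset.range (N + 1), ∑ j ∈ Finset.range (M + 1),
    U i j * hat (meshX L ε N) N i x * hat (meshT T C₂ ε M) M j t

end TransportLayer

end

/-!
The error is split into the error at the mesh points, which is estimated by consistency and a
discrete maximum principle, and the error of bilinear interpolation. Both rest on bounds for the
exact solution with constants that do not depend on `ε`.

**The solution.** Division by `a ≥ α > 0` turns the equation into `u_x + q u_t + c u = F`, where `x` is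
the evolution variable (`TransportProblem`, `ClassicalProblem`, `exists_classicalProblem`). Its
characteristics are the graphs of the solutions of `τ' = q(x, τ)`. Along a characteristic the
damping `c ≥ 0` can be dropped, and the source, of size `ε⁻¹ e^{(x-L)/ε}`, has a bounded integral. As `u`
is only once differentiable, second derivatives are replaced by differences of `u` along two or three
characteristics through points with the same `x`, followed back to the inflow boundary. There the data
take over: the inflow data on `x = 0`, and on `t = 0` the Taylor polynomial `φ + t g`, where `g` is the
value of `u_t` that the equation prescribes, which compatibility matches with the inflow data. Going
back, the layer at the foot point becomes `e^{(x-αt-L)/ε}`, since `q ≤ 1/α`. This yields the bound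
`TransportProblem.abs_second_difference_le`, and from it, telescoping and using the equation, Taylor
remainders of `u` in `t` and `x` that are bounded by increments of `e^{(x-αt-L)/ε}` and `e^{(x-L)/ε}`
(`ClassicalProblem.exists_layerBounds`).

**Consistency.** On the piecewise uniform meshes such increments are small over one step: where the
step is fine because it is `O(ε N⁻¹ ln N)` or `O(ε M⁻¹ ln M)`, and where it is coarse because the layer
has decayed. Hence the consistency error in time is of order `M⁻¹ ln M` times `1 + ε⁻¹ e^{(x-L)/ε}`, and
so is the one in space, with `N⁻¹ ln N`, except on the coarse cells, where `ε⁻¹ e^{(x-L)/ε}` may be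
large although `e^{(x-L)/ε}` is at most `N⁻¹`.

**Stability.** The upwind scheme satisfies a comparison principle (`abs_le_of_residual_le`), so that a
mesh function of `x` alone whose fitted upwind derivative dominates the consistency error bounds the
error at the mesh points. The functions `x + e^{(x-L)/(2ε)}` and `N⁻¹ e^{(x-L+σ)/(2ε)}`, the latter with a
jump of height `H` at the transition point, serve this purpose (`SpaceMesh.layerBarrier_residual`,
`SpaceMesh.transitionBarrier_residual`): the doubled length scale makes the barrier robust on cells
that are wide compared to `ε`, and at the transition point it is the fitting factor that makes the
estimate possible.

**Interpolation.** The bilinear interpolant is a convex combination of the values at the corners of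
a cell, and over one cell `u` varies by `O(N⁻¹ ln N + M⁻¹ ln M)`.
-/

namespace TransportLayer

open Set Filter Topology

/-! ### Calculus on an interval -/

lemma le_of_damped {y G : ℝ → ℝ} {p x : ℝ} (hpx : p ≤ x)
    (hy : ContinuousOn y (Icc p x)) (hG : ContinuousOn G (Icc p x))
    (hd : ∀ r ∈ Ioo p x, ∃ y' G' c, HasDerivAt y y' r ∧ HasDerivAt G G' r ∧ 0 ≤ c ∧
      |y' + c * y r| ≤ G') :
    y x ≤ |y p| + (G x - G p) := by
  rcases hpx.eq_or_lt with rfl | hpx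
  · simpa using le_abs_self (y p)
  choose! y' G' c h1 h2 h3 h4 using hd
  -- start at `s > p`, because the derivatives exist only in the open interval; the slope `s - p > 0` in
  -- the upper bound makes the comparison strict and vanishes as `s → p`
  have key : ∀ s ∈ Ioo p x, y x ≤ |y s| + (G x - G s) + (s - p) * (x - s) := by
    intro s hs
    have hsub : Icc s x ⊆ Icc p x := Icc_subset_Icc_left hs.1.le
    have hsubo : Ico s x ⊆ Ioo p x := fun r hr => ⟨hs.1.trans_le hr.1, hr.2⟩
    have hmono : MonotoneOn G (Icc s x) := by
      apply monotoneOn_of_hasDerivWithinAt_nonneg (f' := G') (convex_Icc s x) (hG.mono hsub)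
      · intro r hr
        rw [interior_Icc] at hr
        exact (h2 r (hsubo ⟨hr.1.le, hr.2⟩)).hasDerivWithinAt
      · intro r hr
        rw [interior_Icc] at hr
        exact (abs_nonneg _).trans (h4 r (hsubo ⟨hr.1.le, hr.2⟩))
    have := image_le_of_deriv_right_lt_deriv_boundary' (f := y) (f' := y') (a := s) (b := x)
      (hy.mono hsub) (fun r hr => (h1 r (hsubo hr)).hasDerivWithinAt)
      (B := fun r => |y s| + (G r - G s) + (s - p) * (r - s)) (B' := fun r => G' r + (s - p))
      (by simpa using le_abs_self (y s))
      (((continuousOn_const.add ((hG.mono hsub).sub continuousOn_const))).add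
        (by fun_prop))
      (fun r hr => by
        have h5 := ((((h2 r (hsubo hr)).sub_const (G s)).const_add |y s|).add
          (((hasDerivAt_id r).sub_const s).const_mul (s - p)))
        rw [mul_one] at h5
        exact h5.hasDerivWithinAt)
      (fun r hr hB => by
        have h5 := h4 r (hsubo hr)
        have h6 : 0 ≤ y r := by
          rw [hB]
          have := hmono ⟨le_rfl, hs.2.le⟩ ⟨hr.1, hr.2.le⟩ hr.1
          have h7 : 0 ≤ (s - p) * (r - s) := mul_nonneg (by linarith [hs.1]) (by linarith [hr.1])
          have := abs_nonneg (y s)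
          linarith
        have h7 := mul_nonneg (h3 r (hsubo hr)) h6
        have h8 := le_abs_self (y' r + c r * y r)
        linarith [hs.1])
    exact this ⟨hs.2.le, le_rfl⟩
  have hlim : Tendsto (fun s => |y s| + (G x - G s) + (s - p) * (x - s)) (𝓝[>] p)
      (𝓝 (|y p| + (G x - G p) + (p - p) * (x - p))) := by
    have e : 𝓝[Ioo p x] p = 𝓝[>] p := nhdsWithin_Ioo_eq_nhdsGT hpx
    rw [← e]
    have hc : ContinuousOn (fun s => |y s| + (G x - G s) + (s - p) * (x - s)) (Icc p x) :=
      ((hy.abs).add (continuousOn_const.sub hG)).add (by fun_prop)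
    exact (hc p ⟨le_rfl, hpx.le⟩).mono_left (nhdsWithin_mono _ Ioo_subset_Icc_self)
  have := ge_of_tendsto hlim (by
    filter_upwards [Ioo_mem_nhdsGT hpx] with s hs using key s hs)
  simpa using this

/-- A comparison principle for `y' + c y = g` with `c ≥ 0`: the damping is harmless, so that `|y|`
grows at most by the increment of a primitive `G` of a bound for `|g|`. The equation is only needed
in the open interval. -/
lemma abs_le_of_damped {y G : ℝ → ℝ} {p x : ℝ} (hpx : p ≤ x)
    (hy : ContinuousOn y (Icc p x)) (hG : ContinuousOn G (Icc p x))
    (hd : ∀ r ∈ Ioo p x, ∃ y' G' c, HasDerivAt y y' r ∧ HasDerivAt G G' r ∧ 0 ≤ c ∧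
      |y' + c * y r| ≤ G') :
    |y x| ≤ |y p| + (G x - G p) := by
  rw [abs_le']
  refine ⟨le_of_damped hpx hy hG hd, ?_⟩
  have := le_of_damped (y := fun r => - y r) hpx hy.neg hG (fun r hr => by
    obtain ⟨y', G', c, h1, h2, h3, h4⟩ := hd r hr
    refine ⟨-y', G', c, h1.neg, h2, h3, ?_⟩
    rw [← abs_neg]
    convert h4 using 2
    ring)
  simpa using this

/-- Grönwall's inequality, backwards from the right end point. -/
lemma abs_le_of_gronwall_left {y y' : ℝ → ℝ} {p x K κ : ℝ} (hK : 0 < K) (hκ : 0 ≤ κ)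
    (hy : ∀ r ∈ Icc p x, HasDerivWithinAt y (y' r) (Icc p x) r)
    (hb : ∀ r ∈ Icc p x, |y' r| ≤ K * |y r| + κ) :
    ∀ r ∈ Icc p x, |y r| ≤ (|y x| + κ * (x - r)) * Real.exp (K * (x - r)) := by
  have hcont : ContinuousOn y (Icc p x) := fun r hr => (hy r hr).continuousWithinAt
  have hmaps : MapsTo (fun s => x - s) (Icc 0 (x - p)) (Icc p x) := fun s hs =>
    ⟨by linarith [hs.2], by linarith [hs.1]⟩
  have H := norm_le_gronwallBound_of_norm_deriv_right_le (f := fun s => y (x - s))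
    (f' := fun s => - y' (x - s)) (δ := |y x|) (K := K) (ε := κ) (a := 0) (b := x - p)
    (hcont.comp (by fun_prop) hmaps)
    (fun s hs => by
      have h1 := hy (x - s) (hmaps ⟨hs.1, hs.2.le⟩)
      have h2 : HasDerivWithinAt (fun s => x - s) (-1) (Icc 0 (x - p)) s :=
        ((hasDerivAt_id s).const_sub x).hasDerivWithinAt
      have h3 := HasDerivWithinAt.scomp (h := fun s => x - s) (g₁ := y) s h1 h2 hmaps
      have h4 : HasDerivWithinAt (fun s => y (x - s)) (- y' (x - s)) (Icc 0 (x - p)) s := by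
        simpa [Function.comp_def] using h3
      exact h4.mono_of_mem_nhdsWithin (Icc_mem_nhdsGE_of_mem hs))
    (by simp)
    (fun s hs => by
      simpa using hb (x - s) (hmaps ⟨hs.1, hs.2.le⟩))
  intro r hr
  have h1 := H (x - r) ⟨by linarith [hr.2], by linarith [hr.1]⟩
  rw [gronwallBound_of_K_ne_0 hK.ne'] at h1
  simp only [sub_sub_cancel, sub_zero, Real.norm_eq_abs] at h1
  refine h1.trans ?_
  have h2 : Real.exp (K * (x - r)) - 1 ≤ K * (x - r) * Real.exp (K * (x - r)) := by
    have h3 := Real.add_one_le_exp (-(K * (x - r)))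
    have h4 : Real.exp (-(K * (x - r))) * Real.exp (K * (x - r)) = 1 := by
      rw [← Real.exp_add]; simp
    nlinarith [Real.exp_pos (K * (x - r))]
  have h5 : κ / K * (Real.exp (K * (x - r)) - 1) ≤ κ / K * (K * (x - r) * Real.exp (K * (x - r))) :=
    mul_le_mul_of_nonneg_left h2 (by positivity)
  have h6 : κ / K * (K * (x - r) * Real.exp (K * (x - r))) =
      κ * (x - r) * Real.exp (K * (x - r)) := by
    field_simp
  linarith

/-- A bound for equidistant second differences by increments of `Γ` bounds the difference of the
derivatives at the end points by the increment of `Γ`: the second differences of step `(t-s)/n`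
telescope to the difference of the two outermost difference quotients. -/
lemma abs_deriv_sub_le_of_second_difference {v Γ : ℝ → ℝ} {s t ds dt : ℝ} (hst : s < t)
    (hΓ : Continuous Γ)
    (hs : HasDerivWithinAt v ds (Icc s t) s) (ht : HasDerivWithinAt v dt (Icc s t) t)
    (hv : ∀ h > 0, ∀ r, s ≤ r → r + 2 * h ≤ t →
      |v (r + 2 * h) - 2 * v (r + h) + v r| ≤ h * (Γ r - Γ (r - h))) :
    |dt - ds| ≤ Γ t - Γ s := by
  -- second differences telescope, and so do the increments of `Γ`, up to a shift by one step
  have tele : ∀ (h : ℝ) (hh : 0 < h) (m : ℕ), s + (m + 1) * h ≤ t →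
      |(v (s + (m + 1) * h) - v (s + m * h)) - (v (s + h) - v s)| ≤
        h * (Γ (s + (m - 1) * h) - Γ (s - h)) := by
    intro h hh m
    induction m with
    | zero =>
      intro _
      have e : s + ((0 : ℕ) - 1 : ℝ) * h = s - h := by push_cast; ring
      rw [e]; simp
    | succ m ih =>
      intro hm
      push_cast at hm
      have h0 : s + ((m : ℝ) + 1) * h ≤ t := by nlinarith
      have h1 := ih h0
      have hm0 : (0 : ℝ) ≤ m := m.cast_nonneg
      have h2 := hv h hh (s + m * h) (by nlinarith) (by nlinarith)
      have e1 : s + m * h + 2 * h = s + (((m + 1 : ℕ) : ℝ) + 1) * h := by push_cast; ring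
      have e2 : s + m * h + h = s + ((m : ℝ) + 1) * h := by ring
      have e3 : s + m * h - h = s + ((m : ℝ) - 1) * h := by ring
      have e4 : s + (((m + 1 : ℕ) : ℝ) - 1) * h = s + m * h := by push_cast; ring
      rw [e1, e2, e3] at h2
      rw [e4]
      push_cast at h2 ⊢
      rw [abs_le] at h1 h2 ⊢
      constructor <;> linarith [h1.1, h1.2, h2.1, h2.2]
  -- steps that divide `[s,t]` evenly, so that the last point reached is `t` itself
  set d : ℕ → ℝ := fun m => (t - s) / (m + 1) with hd
  have hdpos : ∀ m, 0 < d m := fun m => div_pos (by linarith) (by positivity)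
  have hdle : ∀ m, d m ≤ t - s := fun m =>
    div_le_self (by linarith) (by linarith [(m.cast_nonneg : (0 : ℝ) ≤ m)])
  have hd0 : Tendsto d atTop (𝓝 0) := by
    have := (tendsto_one_div_add_atTop_nhds_zero_nat (𝕜 := ℝ)).const_mul (t - s)
    simpa [hd, div_eq_mul_inv] using this
  have hright : Tendsto (fun m => (v (s + d m) - v s) / d m) atTop (𝓝 ds) := by
    have h1 := hasDerivWithinAt_iff_tendsto_slope.1 hs
    have h2 : Tendsto (fun m => s + d m) atTop (𝓝[Icc s t \ {s}] s) := by
      apply tendsto_nhdsWithin_of_tendsto_nhds_of_eventually_within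
      · simpa using hd0.const_add s
      · filter_upwards with m
        exact ⟨⟨by linarith [hdpos m], by linarith [hdle m]⟩, by simpa using (hdpos m).ne'⟩
    have h3 := h1.comp h2
    refine h3.congr fun m => ?_
    simp [slope_def_field]
  have hleft : Tendsto (fun m => (v t - v (t - d m)) / d m) atTop (𝓝 dt) := by
    have h1 := hasDerivWithinAt_iff_tendsto_slope.1 ht
    have h2 : Tendsto (fun m => t - d m) atTop (𝓝[Icc s t \ {t}] t) := by
      apply tendsto_nhdsWithin_of_tendsto_nhds_of_eventually_within
      · simpa using hd0.const_sub t
      · filter_upwards with m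
        exact ⟨⟨by linarith [hdle m], by linarith [hdpos m]⟩, by
          simpa using (hdpos m).ne'⟩
    have h3 := h1.comp h2
    refine h3.congr fun m => ?_
    simp only [Function.comp, slope_def_field]
    rw [show t - d m - t = - d m by ring, div_neg, ← neg_div]; congr 1; ring
  have hG : Tendsto (fun m => Γ (t - 2 * d m) - Γ (s - d m)) atTop (𝓝 (Γ t - Γ s)) := by
    have h1 : Tendsto (fun m => t - 2 * d m) atTop (𝓝 t) := by
      simpa using (hd0.const_mul 2).const_sub t
    have h2 : Tendsto (fun m => s - d m) atTop (𝓝 s) := by simpa using hd0.const_sub s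
    exact ((hΓ.tendsto t).comp h1).sub ((hΓ.tendsto s).comp h2)
  refine le_of_tendsto_of_tendsto (hleft.sub hright).abs hG ?_
  filter_upwards with m
  have hm : s + ((m : ℝ) + 1) * d m = t := by
    simp only [hd]; field_simp; ring
  have h1 := tele (d m) (hdpos m) m hm.le
  have e1 : s + (m : ℝ) * d m = t - d m := by linarith
  have e2 : s + ((m : ℝ) - 1) * d m = t - 2 * d m := by linarith
  rw [hm, e1, e2] at h1
  rw [← sub_div, abs_div, abs_of_pos (hdpos m), div_le_iff₀ (hdpos m)]
  linarith

/-- `p` is Lipschitz with constant `K` on `[0,T]`, and its second differences over three not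
necessarily equidistant points are controlled by the defect `t₁ - 2 t₂ + t₃` to first order and by
the distance to second order. This is what `C^{1,1}` means for difference quotients, and, unlike
a bound on derivatives, it is preserved along a family of characteristics. -/
structure SecondOrderLip (T K : ℝ) (p : ℝ → ℝ) : Prop where
  lip : ∀ s ∈ Icc 0 T, ∀ t ∈ Icc 0 T, |p t - p s| ≤ K * |t - s|
  second : ∀ t₁ ∈ Icc 0 T, ∀ t₂ ∈ Icc 0 T, ∀ t₃ ∈ Icc 0 T, t₃ ≤ t₂ → t₂ ≤ t₁ →
    |p t₁ - 2 * p t₂ + p t₃| ≤ K * (|t₁ - 2 * t₂ + t₃| + (t₁ - t₃) ^ 2)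

/-- Taylor's formula of first order for a function with Lipschitz derivative. -/
lemma abs_sub_sub_le_of_lipschitz_deriv {p p' : ℝ → ℝ} {l r K : ℝ}
    (hp : ∀ t ∈ Icc l r, HasDerivWithinAt p (p' t) (Icc l r) t)
    (hb : ∀ s ∈ Icc l r, ∀ t ∈ Icc l r, |p' t - p' s| ≤ K * |t - s|)
    {s t : ℝ} (hs : s ∈ Icc l r) (ht : t ∈ Icc l r) (hK : 0 ≤ K) :
    |p t - p s - p' s * (t - s)| ≤ K * (t - s) ^ 2 := by
  have hsub : uIcc s t ⊆ Icc l r := by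
    rw [← segment_eq_uIcc]; exact (convex_Icc l r).segment_subset hs ht
  have := Convex.norm_image_sub_le_of_norm_hasDerivWithin_le (s := uIcc s t)
    (f := fun r => p r - p' s * (r - s)) (f' := fun r => p' r - p' s) (C := K * |t - s|)
    (x := s) (y := t)
    (fun r hr => by
      have h1 := ((hp r (hsub hr)).mono hsub).sub
        ((((hasDerivAt_id r).sub_const s).const_mul (p' s)).hasDerivWithinAt (s := uIcc s t))
      rw [mul_one] at h1
      exact h1)
    (fun r hr => by
      refine (hb s hs r (hsub hr)).trans (mul_le_mul_of_nonneg_left ?_ hK)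
      exact abs_sub_left_of_mem_uIcc hr) (convex_uIcc s t) left_mem_uIcc right_mem_uIcc
  simp only [Real.norm_eq_abs] at this
  rw [show K * (t - s) ^ 2 = K * |t - s| * |t - s| by rw [mul_assoc, ← sq, sq_abs]]
  convert this using 2
  ring

lemma SecondOrderLip.of_deriv {T K : ℝ} {p p' : ℝ → ℝ} (hK : 0 ≤ K)
    (hp : ∀ t ∈ Icc 0 T, HasDerivWithinAt p (p' t) (Icc 0 T) t)
    (hb : ∀ t ∈ Icc 0 T, |p' t| ≤ K)
    (hb' : ∀ s ∈ Icc 0 T, ∀ t ∈ Icc 0 T, |p' t - p' s| ≤ K * |t - s|) :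
    SecondOrderLip T K p where
  lip s hs t ht := by
    simpa using Convex.norm_image_sub_le_of_norm_hasDerivWithin_le (f := p) (f' := p') hp hb
      (convex_Icc 0 T) hs ht
  second t₁ h1 t₂ h2 t₃ h3 h32 h21 := by
    have e1 := abs_sub_sub_le_of_lipschitz_deriv hp hb' h2 h1 hK
    have e3 := abs_sub_sub_le_of_lipschitz_deriv hp hb' h2 h3 hK
    have e2 : |p' t₂ * (t₁ - 2 * t₂ + t₃)| ≤ K * |t₁ - 2 * t₂ + t₃| := by
      rw [abs_mul]; exact mul_le_mul_of_nonneg_right (hb t₂ h2) (abs_nonneg _)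
    have e4 : K * ((t₁ - t₂) ^ 2 + (t₃ - t₂) ^ 2) ≤ K * (t₁ - t₃) ^ 2 := by
      refine mul_le_mul_of_nonneg_left ?_ hK
      nlinarith [mul_nonneg (sub_nonneg.2 h32) (sub_nonneg.2 h21)]
    rw [abs_le] at *
    constructor <;> nlinarith [e1.1, e1.2, e2.1, e2.2, e3.1, e3.2]

lemma SecondOrderLip.mono {T K K' : ℝ} {p : ℝ → ℝ} (h : SecondOrderLip T K p) (hK : K ≤ K') :
    SecondOrderLip T K' p where
  lip s hs t ht := (h.lip s hs t ht).trans (mul_le_mul_of_nonneg_right hK (abs_nonneg _))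
  second t₁ h1 t₂ h2 t₃ h3 h32 h21 := (h.second t₁ h1 t₂ h2 t₃ h3 h32 h21).trans
    (mul_le_mul_of_nonneg_right hK (by positivity))

/-- The product rule for second differences, with the second difference of `v` kept exact. -/
lemma abs_second_difference_mul_le {c₁ c₂ c₃ v₁ v₂ v₃ A B D R : ℝ} (hD : 0 ≤ D) (hA : 0 ≤ A)
    (h12 : |c₁ - c₂| ≤ A * D) (h23 : |c₃ - c₂| ≤ A * D)
    (hc : |c₁ - 2 * c₂ + c₃| ≤ A * (R + D ^ 2))
    (g12 : |v₁ - v₂| ≤ B * D) (g23 : |v₃ - v₂| ≤ B * D) :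
    |(c₁ * v₁ - 2 * (c₂ * v₂) + c₃ * v₃) - c₂ * (v₁ - 2 * v₂ + v₃)| ≤
      A * (R + D ^ 2) * |v₂| + 2 * (A * B) * D ^ 2 := by
  have e : (c₁ * v₁ - 2 * (c₂ * v₂) + c₃ * v₃) - c₂ * (v₁ - 2 * v₂ + v₃) =
      (c₁ - 2 * c₂ + c₃) * v₂ + (c₁ - c₂) * (v₁ - v₂) + (c₃ - c₂) * (v₃ - v₂) := by ring
  rw [e]
  refine (abs_add_three _ _ _).trans ?_
  simp only [abs_mul]
  have i1 := mul_le_mul_of_nonneg_right hc (abs_nonneg v₂)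
  have i2 := mul_le_mul h12 g12 (abs_nonneg _) (by positivity)
  have i3 := mul_le_mul h23 g23 (abs_nonneg _) (by positivity)
  nlinarith

/-- The source `F = f / a` of the normal form is a product of this kind. -/
lemma SecondOrderLip.mul {T K K' Mq Mf : ℝ} {p f : ℝ → ℝ} (hp : SecondOrderLip T K p)
    (hf : SecondOrderLip T K' f) (hK : 0 ≤ K) (hK' : 0 ≤ K') (hMq : ∀ t ∈ Icc 0 T, |p t| ≤ Mq)
    (hMf : ∀ t ∈ Icc 0 T, |f t| ≤ Mf) :
    SecondOrderLip T (Mq * K' + Mf * K + 2 * (K * K')) (fun t => p t * f t) where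
  lip s hs t ht := by
    have e : p t * f t - p s * f s = p t * (f t - f s) + (p t - p s) * f s := by ring
    have hM := (abs_nonneg _).trans (hMq t ht)
    have i1 := mul_le_mul (hMq t ht) (hf.lip s hs t ht) (abs_nonneg _) hM
    have i2 := mul_le_mul (hp.lip s hs t ht) (hMf s hs) (abs_nonneg _) (by positivity)
    rw [e]
    refine (abs_add_le _ _).trans ?_
    simp only [abs_mul]
    have : 0 ≤ K * K' * |t - s| := by positivity
    nlinarith
  second t₁ h1 t₂ h2 t₃ h3 h32 h21 := by
    have hD : 0 ≤ t₁ - t₃ := by linarith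
    have a12 : |t₁ - t₂| ≤ t₁ - t₃ := by rw [abs_of_nonneg] <;> linarith
    have a32 : |t₃ - t₂| ≤ t₁ - t₃ := by rw [abs_of_nonpos] <;> linarith
    have M1 := (abs_nonneg _).trans (hMq t₂ h2)
    have M2 := (abs_nonneg _).trans (hMf t₂ h2)
    have i1 := abs_second_difference_mul_le hD hK
      ((hp.lip t₂ h2 t₁ h1).trans (mul_le_mul_of_nonneg_left a12 hK))
      ((hp.lip t₂ h2 t₃ h3).trans (mul_le_mul_of_nonneg_left a32 hK))
      (hp.second t₁ h1 t₂ h2 t₃ h3 h32 h21)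
      ((hf.lip t₂ h2 t₁ h1).trans (mul_le_mul_of_nonneg_left a12 hK'))
      ((hf.lip t₂ h2 t₃ h3).trans (mul_le_mul_of_nonneg_left a32 hK'))
    have i2 : |p t₂ * (f t₁ - 2 * f t₂ + f t₃)| ≤
        Mq * (K' * (|t₁ - 2 * t₂ + t₃| + (t₁ - t₃) ^ 2)) := by
      rw [abs_mul]
      exact mul_le_mul (hMq t₂ h2) (hf.second t₁ h1 t₂ h2 t₃ h3 h32 h21) (abs_nonneg _) M1
    have i3 : K * (|t₁ - 2 * t₂ + t₃| + (t₁ - t₃) ^ 2) * |f t₂| ≤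
        K * (|t₁ - 2 * t₂ + t₃| + (t₁ - t₃) ^ 2) * Mf :=
      mul_le_mul_of_nonneg_left (hMf t₂ h2) (by positivity)
    have i4 : 0 ≤ K * K' * |t₁ - 2 * t₂ + t₃| := by positivity
    rw [abs_le] at i1 i2 ⊢
    constructor <;> nlinarith [i1.1, i1.2, i2.1, i2.2]

/-- Convexity of the exponential, scaled to the layer width `ε`: the derivative at the left end point,
times the length, is at most the increment. -/
lemma sub_mul_exp_le {z w ε : ℝ} (hε : 0 < ε) :
    (w - z) * Real.exp (z / ε) ≤ ε * (Real.exp (w / ε) - Real.exp (z / ε)) := by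
  have h := Real.add_one_le_exp ((w - z) / ε)
  have e : Real.exp (w / ε) = Real.exp (z / ε) * Real.exp ((w - z) / ε) := by
    rw [← Real.exp_add]; congr 1; ring
  rw [e]
  have h2 := mul_le_mul_of_nonneg_left h (Real.exp_pos (z / ε)).le
  have h3 : ε * (Real.exp (z / ε) * ((w - z) / ε + 1)) =
      (w - z) * Real.exp (z / ε) + ε * Real.exp (z / ε) := by
    field_simp
  nlinarith

/-! ### The transport problem in normal form and its characteristics -/

/-- The boundary layer function `e^{(x-L)/ε}`. -/
noncomputable def layer (L ε x : ℝ) : ℝ := Real.exp ((x - L) / ε)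

lemma layer_pos (L ε x : ℝ) : 0 < layer L ε x := Real.exp_pos _

lemma layer_mono {L ε : ℝ} (hε : 0 < ε) : Monotone (layer L ε) := fun x y h => by
  unfold layer; gcongr

lemma layer_le_one {L ε x : ℝ} (hε : 0 < ε) (hx : x ≤ L) : layer L ε x ≤ 1 :=
  Real.exp_le_one_iff.2 (div_nonpos_of_nonpos_of_nonneg (by linarith) hε.le)

lemma hasDerivAt_layer (L ε x : ℝ) : HasDerivAt (layer L ε) (ε⁻¹ * layer L ε x) x := by
  have h := (((hasDerivAt_id x).sub_const L).div_const ε).exp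
  unfold layer
  rw [one_div, mul_comm] at h
  exact h

/-- The problem `u_x + q u_t + c u = F` with `u(0,t) = ψ(t)`, `u(x,0) = φ(x)`, obtained from
`u_t + a u_x + b u = f` by dividing by `a`, so that `x` becomes the evolution variable. All bounds
on the data are collected in the single constant `Λ`; the source `F` carries the layer at `x = L`.
The function `g` is the value of `u_t` at `t = 0` prescribed by the equation, and `corner` is
what the compatibility conditions of order zero and one give. -/
structure TransportProblem (L T α Λ ε : ℝ) (q c F : ℝ → ℝ → ℝ) (φ φ' g g' ψ : ℝ → ℝ)
    (u : ℝ → ℝ → ℝ) : Prop where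
  L_pos : 0 < L
  T_pos : 0 < T
  α_pos : 0 < α
  Λ_ge : 1 ≤ Λ
  ε_pos : 0 < ε
  ε_le : ε ≤ 1
  q_lower : ∀ x ∈ Icc 0 L, ∀ t ∈ Icc 0 T, Λ⁻¹ ≤ q x t
  q_upper : ∀ x ∈ Icc 0 L, ∀ t ∈ Icc 0 T, q x t ≤ α⁻¹
  q_cont : ContinuousOn (Function.uncurry q) (closedDomain L T)
  q_second : ∀ x ∈ Icc 0 L, SecondOrderLip T Λ (q x)
  c_nonneg : ∀ x ∈ Icc 0 L, ∀ t ∈ Icc 0 T, 0 ≤ c x t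
  c_second : ∀ x ∈ Icc 0 L, SecondOrderLip T Λ (c x)
  c_le : ∀ x ∈ Icc 0 L, ∀ t ∈ Icc 0 T, c x t ≤ Λ
  F_bound : ∀ x ∈ Icc 0 L, ∀ t ∈ Icc 0 T, |F x t| ≤ Λ * (ε⁻¹ * layer L ε x)
  F_second : ∀ x ∈ Icc 0 L, SecondOrderLip T (Λ * (ε⁻¹ * layer L ε x)) (F x)
  φ_cont : ContinuousOn φ (Icc 0 L)
  φ_deriv : ∀ x ∈ Ioo 0 L, HasDerivAt φ (φ' x) x
  φ_bound : ∀ x ∈ Icc 0 L, |φ x| ≤ Λ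
  φ'_bound : ∀ x ∈ Icc 0 L, |φ' x| ≤ Λ
  g_cont : ContinuousOn g (Icc 0 L)
  g_deriv : ∀ x ∈ Ioo 0 L, HasDerivAt g (g' x) x
  g_bound : ∀ x ∈ Icc 0 L, |g x| ≤ Λ * (1 + ε⁻¹ * layer L ε x)
  g'_bound : ∀ x ∈ Icc 0 L, |g' x| ≤ Λ * (1 + ε⁻¹ ^ 2 * layer L ε x)
  g_eq : ∀ x ∈ Ioo 0 L, q x 0 * g x = F x 0 - φ' x - c x 0 * φ x
  ψ_bound : ∀ t ∈ Icc 0 T, |ψ t| ≤ Λ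
  ψ_second : SecondOrderLip T Λ ψ
  corner : ∀ t ∈ Icc 0 T, |ψ t - φ 0 - t * g 0| ≤ Λ * t ^ 2
  u_cont : ContinuousOn (Function.uncurry u) (closedDomain L T)
  u_eq : ∀ x ∈ Ioo 0 L, ∀ t ∈ Ioo 0 T, ∃ D : ℝ × ℝ →L[ℝ] ℝ,
    HasFDerivAt (Function.uncurry u) D (x, t) ∧ D (1, q x t) = F x t - c x t * u x t
  inflow : ∀ t ∈ Icc 0 T, u 0 t = ψ t
  initial : ∀ x ∈ Icc 0 L, u x 0 = φ x

/-- `τ` is a solution on `[0,x]` of the characteristic equation `τ' = q(·,τ)`, where `q` is continued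
constantly in `t` beyond `[0,T]`. -/
def IsClampedCharacteristic (T : ℝ) (q : ℝ → ℝ → ℝ) (τ : ℝ → ℝ) (x : ℝ) : Prop :=
  ∀ r ∈ Icc 0 x, HasDerivWithinAt τ (q r (max 0 (min T (τ r)))) (Icc 0 x) r

/-- `τ` is a characteristic `τ' = q(·,τ)` over `[p,x]`, with values in `[0,T]`, and in the open
interval `(0,T)` over `(p,x)`. -/
structure IsCharacteristic (T α Λ : ℝ) (q : ℝ → ℝ → ℝ) (τ : ℝ → ℝ) (p x : ℝ) : Prop where
  deriv : ∀ r ∈ Icc p x, HasDerivWithinAt τ (q r (τ r)) (Icc p x) r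
  mem : ∀ r ∈ Icc p x, τ r ∈ Icc 0 T
  mem_Ioo : ∀ r ∈ Ioo p x, τ r ∈ Ioo 0 T
  growth_le : ∀ r ∈ Icc p x, ∀ s ∈ Icc p x, r ≤ s → α * (τ s - τ r) ≤ s - r
  le_growth : ∀ r ∈ Icc p x, ∀ s ∈ Icc p x, r ≤ s → s - r ≤ Λ * (τ s - τ r)

lemma clamp_mem {T : ℝ} (hT : 0 ≤ T) (s : ℝ) : max 0 (min T s) ∈ Icc 0 T :=
  ⟨le_max_left _ _, max_le hT (min_le_left _ _)⟩

lemma abs_clamp_sub_le (T s t : ℝ) : |max 0 (min T t) - max 0 (min T s)| ≤ |t - s| := by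
  have h1 := abs_max_sub_max_le_abs (min T t) (min T s) 0
  have h2 := abs_min_sub_min_le_max T t T s
  rw [max_comm 0, max_comm 0]
  refine h1.trans (h2.trans ?_)
  simp

lemma IsClampedCharacteristic.continuousOn {T x : ℝ} {q : ℝ → ℝ → ℝ} {τ : ℝ → ℝ}
    (h : IsClampedCharacteristic T q τ x) : ContinuousOn τ (Icc 0 x) :=
  fun r hr => (h r hr).continuousWithinAt

section
variable {L T α Λ ε : ℝ} {q c F : ℝ → ℝ → ℝ} {φ φ' g g' ψ : ℝ → ℝ} {u : ℝ → ℝ → ℝ}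
namespace TransportProblem

lemma exists_clampedCharacteristic (P : TransportProblem L T α Λ ε q c F φ φ' g g' ψ u)
    {x t : ℝ} (hx : x ∈ Icc 0 L) : ∃ τ, τ x = t ∧ IsClampedCharacteristic T q τ x := by
  have hT := P.T_pos.le
  have hα := P.α_pos
  have hΛ : 0 < Λ := by linarith [P.Λ_ge]
  have hsub : ∀ r ∈ Icc 0 x, r ∈ Icc 0 L := fun r hr => ⟨hr.1, hr.2.trans hx.2⟩
  have hPL : IsPicardLindelof (fun r s => q r (max 0 (min T s))) (tmin := 0) (tmax := x)
      ⟨x, ⟨hx.1, le_rfl⟩⟩ t ⟨α⁻¹ * x, by have := hx.1; positivity⟩ 0 ⟨α⁻¹, by positivity⟩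
      ⟨Λ, hΛ.le⟩ := by
    refine ⟨fun r hr => ?_, fun s _ => ?_, fun r hr s _ => ?_, ?_⟩
    · apply LipschitzWith.lipschitzOnWith
      apply LipschitzWith.of_dist_le_mul
      intro s s'
      rw [Real.dist_eq, Real.dist_eq]
      refine ((P.q_second r (hsub r hr)).lip _ (clamp_mem hT s') _ (clamp_mem hT s)).trans ?_
      exact mul_le_mul_of_nonneg_left (abs_clamp_sub_le T s' s) hΛ.le
    · exact P.q_cont.comp (f := fun r => (r, max 0 (min T s))) (by fun_prop)
        (fun r hr => ⟨hsub r hr, clamp_mem hT s⟩)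
    · have h0 : 0 < Λ⁻¹ := by positivity
      have h1 := P.q_lower r (hsub r hr) _ (clamp_mem hT s)
      have h2 := P.q_upper r (hsub r hr) _ (clamp_mem hT s)
      rw [Real.norm_eq_abs, abs_of_pos (h0.trans_le h1)]
      exact h2
    · simp only [sub_self, sub_zero, NNReal.coe_zero, max_eq_right hx.1]
      exact le_rfl
  obtain ⟨τ, h1, h2⟩ := hPL.exists_eq_forall_mem_Icc_hasDerivWithinAt₀
  exact ⟨τ, h1, h2⟩

/-- Clamped characteristics are unique, hence do not cross. -/
lemma clampedCharacteristic_le (P : TransportProblem L T α Λ ε q c F φ φ' g g' ψ u)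
    {x : ℝ} (hx : x ∈ Icc 0 L) {σ τ : ℝ → ℝ} (hσ : IsClampedCharacteristic T q σ x)
    (hτ : IsClampedCharacteristic T q τ x) (h : σ x ≤ τ x) : ∀ r ∈ Icc 0 x, σ r ≤ τ r := by
  intro r hr
  by_contra! hlt
  have hcont : ContinuousOn (fun s => τ s - σ s) (Icc r x) :=
    (hτ.continuousOn.sub hσ.continuousOn).mono (Icc_subset_Icc_left hr.1)
  -- two characteristics that change order meet at some `s`, and then agree to the left of `s`
  obtain ⟨s, hs, hs0⟩ := intermediate_value_Icc hr.2 hcont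
    (show (0 : ℝ) ∈ Icc _ _ from ⟨by linarith, by linarith⟩)
  have hsub : Icc r s ⊆ Icc 0 x := Icc_subset_Icc hr.1 hs.2
  have := abs_le_of_gronwall_left (y := fun s => τ s - σ s) (p := r) (x := s) (K := Λ) (κ := 0)
    (by linarith [P.Λ_ge]) le_rfl
    (fun z hz => ((hτ z (hsub hz)).sub (hσ z (hsub hz))).mono hsub)
    (fun z hz => by
      rw [add_zero]
      refine ((P.q_second z ⟨(hsub hz).1, (hsub hz).2.trans hx.2⟩).lip _
        (clamp_mem P.T_pos.le _) _ (clamp_mem P.T_pos.le _)).trans ?_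
      exact mul_le_mul_of_nonneg_left (abs_clamp_sub_le T _ _) (by linarith [P.Λ_ge]))
    r ⟨le_rfl, hs.1⟩
  simp only [hs0, abs_zero, zero_mul, add_zero] at this
  have := abs_nonpos_iff.1 this
  linarith

lemma clampedCharacteristic_growth (P : TransportProblem L T α Λ ε q c F φ φ' g g' ψ u)
    {x : ℝ} (hx : x ∈ Icc 0 L) {τ : ℝ → ℝ} (hτ : IsClampedCharacteristic T q τ x)
    {r s : ℝ} (hr : r ∈ Icc 0 x) (hs : s ∈ Icc 0 x) (hrs : r ≤ s) :
    α * (τ s - τ r) ≤ s - r ∧ s - r ≤ Λ * (τ s - τ r) := by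
  have hα := P.α_pos
  have hΛ : 0 < Λ := by linarith [P.Λ_ge]
  have hcl := clamp_mem P.T_pos.le
  have hd : ∀ z ∈ interior (Icc 0 x), HasDerivWithinAt τ (q z (max 0 (min T (τ z))))
      (interior (Icc 0 x)) z := fun z hz => (hτ z (interior_subset hz)).mono interior_subset
  have hz' : ∀ z ∈ interior (Icc 0 x), z ∈ Icc 0 L := fun z hz =>
    ⟨(interior_subset hz).1, (interior_subset hz).2.trans hx.2⟩
  constructor
  · have hmono : MonotoneOn (fun z => z - α * τ z) (Icc 0 x) := by
      apply monotoneOn_of_hasDerivWithinAt_nonneg (convex_Icc 0 x)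
        (f' := fun z => 1 - α * q z (max 0 (min T (τ z))))
      · exact continuousOn_id.sub (continuousOn_const.mul hτ.continuousOn)
      · exact fun z hz => (hasDerivWithinAt_id z _).sub ((hd z hz).const_mul α)
      · intro z hz
        have h1 := mul_le_mul_of_nonneg_left (P.q_upper z (hz' z hz) _ (hcl (τ z))) hα.le
        rw [mul_inv_cancel₀ hα.ne'] at h1
        linarith
    have := hmono hr hs hrs
    simp only at this
    linarith
  · have hmono : MonotoneOn (fun z => Λ * τ z - z) (Icc 0 x) := by
      apply monotoneOn_of_hasDerivWithinAt_nonneg (convex_Icc 0 x)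
        (f' := fun z => Λ * q z (max 0 (min T (τ z))) - 1)
      · exact (continuousOn_const.mul hτ.continuousOn).sub continuousOn_id
      · exact fun z hz => ((hd z hz).const_mul Λ).sub (hasDerivWithinAt_id z _)
      · intro z hz
        have h1 := mul_le_mul_of_nonneg_left (P.q_lower z (hz' z hz) _ (hcl (τ z))) hΛ.le
        rw [mul_inv_cancel₀ hΛ.ne'] at h1
        linarith
    have := hmono hr hs hrs
    simp only at this
    linarith

lemma isCharacteristic_of_clamped (P : TransportProblem L T α Λ ε q c F φ φ' g g' ψ u)
    {x p : ℝ} (hx : x ∈ Icc 0 L) {τ : ℝ → ℝ} (hτ : IsClampedCharacteristic T q τ x)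
    (hp : 0 ≤ p) (hτp : 0 ≤ τ p) (hτx : τ x ≤ T) : IsCharacteristic T α Λ q τ p x := by
  have hΛ : 0 < Λ := by linarith [P.Λ_ge]
  have hsub : Icc p x ⊆ Icc 0 x := Icc_subset_Icc_left hp
  have hpm : p ≤ x → p ∈ Icc 0 x := fun h => ⟨hp, h⟩
  have hxm : x ∈ Icc 0 x := ⟨hx.1, le_rfl⟩
  have gr := fun r (hr : r ∈ Icc p x) s (hs : s ∈ Icc p x) (hrs : r ≤ s) =>
    P.clampedCharacteristic_growth hx hτ (hsub hr) (hsub hs) hrs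
  have hmem : ∀ r ∈ Icc p x, τ r ∈ Icc 0 T := fun r hr => by
    have h1 := (gr p ⟨le_rfl, hr.1.trans hr.2⟩ r hr hr.1).2
    have h2 := (gr r hr x ⟨hr.1.trans hr.2, le_rfl⟩ hr.2).2
    have h3 : 0 ≤ τ r - τ p := by
      by_contra! h; nlinarith [hr.1]
    have h4 : 0 ≤ τ x - τ r := by
      by_contra! h; nlinarith [hr.2]
    exact ⟨by linarith, by linarith⟩
  refine ⟨fun r hr => ?_, hmem, fun r hr => ?_, fun r hr s hs h => (gr r hr s hs h).1,
    fun r hr s hs h => (gr r hr s hs h).2⟩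
  · have h1 := (hτ r (hsub hr)).mono hsub
    rwa [min_eq_right (hmem r hr).2, max_eq_right (hmem r hr).1] at h1
  · have hr' := Ioo_subset_Icc_self hr
    have h1 := (gr p ⟨le_rfl, hr'.1.trans hr'.2⟩ r hr' hr'.1).2
    have h2 := (gr r hr' x ⟨hr'.1.trans hr'.2, le_rfl⟩ hr'.2).2
    have h3 : 0 < τ r - τ p := by
      by_contra! h; nlinarith [hr.1]
    have h4 : 0 < τ x - τ r := by
      by_contra! h; nlinarith [hr.2]
    exact ⟨by linarith, by linarith⟩

/-- Three characteristics through points with the same abscissa `x` can be followed backwards,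
without crossing, until the lowest one reaches the inflow boundary `{x = 0} ∪ {t = 0}`, and their
distance stays comparable to that at `x`. -/
lemma exists_characteristics (P : TransportProblem L T α Λ ε q c F φ φ' g g' ψ u)
    {x t₁ t₂ t₃ : ℝ} (hx : x ∈ Icc 0 L) (h3 : 0 ≤ t₃) (h32 : t₃ ≤ t₂) (h21 : t₂ ≤ t₁)
    (h1 : t₁ ≤ T) :
    ∃ p τ₁ τ₂ τ₃, 0 ≤ p ∧ p ≤ x ∧ IsCharacteristic T α Λ q τ₁ p x ∧
      IsCharacteristic T α Λ q τ₂ p x ∧ IsCharacteristic T α Λ q τ₃ p x ∧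
      τ₁ x = t₁ ∧ τ₂ x = t₂ ∧ τ₃ x = t₃ ∧ (p = 0 ∨ τ₃ p = 0) ∧
      ∀ r ∈ Icc p x, τ₃ r ≤ τ₂ r ∧ τ₂ r ≤ τ₁ r ∧
        τ₁ r - τ₃ r ≤ Real.exp (Λ * L) * (t₁ - t₃) := by
  have hΛ : 0 < Λ := by linarith [P.Λ_ge]
  obtain ⟨τ₁, e1, c1⟩ := P.exists_clampedCharacteristic (t := t₁) hx
  obtain ⟨τ₂, e2, c2⟩ := P.exists_clampedCharacteristic (t := t₂) hx
  obtain ⟨τ₃, e3, c3⟩ := P.exists_clampedCharacteristic (t := t₃) hx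
  have o32 := P.clampedCharacteristic_le hx c3 c2 (by rw [e3, e2]; exact h32)
  have o21 := P.clampedCharacteristic_le hx c2 c1 (by rw [e2, e1]; exact h21)
  -- the abscissa where the lowest characteristic enters the domain
  obtain ⟨p, hp, hp3, hor⟩ : ∃ p ∈ Icc 0 x, 0 ≤ τ₃ p ∧ (p = 0 ∨ τ₃ p = 0) := by
    rcases le_or_gt 0 (τ₃ 0) with h | h
    · exact ⟨0, ⟨le_rfl, hx.1⟩, h, Or.inl rfl⟩
    · obtain ⟨p, hp, hp0⟩ := intermediate_value_Icc hx.1 c3.continuousOn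
        (show (0 : ℝ) ∈ Icc _ _ from ⟨h.le, by rw [e3]; exact h3⟩)
      exact ⟨p, hp, hp0.ge, Or.inr hp0⟩
  have k3 := P.isCharacteristic_of_clamped hx c3 hp.1 hp3 (by linarith)
  have k2 := P.isCharacteristic_of_clamped hx c2 hp.1 (hp3.trans (o32 p hp)) (by linarith)
  have k1 := P.isCharacteristic_of_clamped hx c1 hp.1
    (hp3.trans ((o32 p hp).trans (o21 p hp))) (by linarith)
  refine ⟨p, τ₁, τ₂, τ₃, hp.1, hp.2, k1, k2, k3, e1, e2, e3, hor, fun r hr => ?_⟩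
  have hr0 : r ∈ Icc 0 x := ⟨hp.1.trans hr.1, hr.2⟩
  refine ⟨o32 r hr0, o21 r hr0, ?_⟩
  have := abs_le_of_gronwall_left (y := fun s => τ₁ s - τ₃ s) (p := p) (x := x) (K := Λ) (κ := 0)
    hΛ le_rfl (fun z hz => (k1.deriv z hz).sub (k3.deriv z hz))
    (fun z hz => by
      rw [add_zero]
      exact (P.q_second z ⟨hp.1.trans hz.1, hz.2.trans hx.2⟩).lip _ (k3.mem z hz) _ (k1.mem z hz))
    r hr
  rw [zero_mul, add_zero, e1, e3, abs_of_nonneg (show 0 ≤ t₁ - t₃ by linarith)] at this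
  refine (le_abs_self _).trans (this.trans ?_)
  rw [mul_comm]
  refine mul_le_mul_of_nonneg_right (Real.exp_le_exp.2 ?_) (by linarith)
  exact mul_le_mul_of_nonneg_left (by linarith [hr0.1, hx.2]) hΛ.le

lemma continuousOn_along (P : TransportProblem L T α Λ ε q c F φ φ' g g' ψ u)
    {x p : ℝ} (hx : x ∈ Icc 0 L) (hp : 0 ≤ p) {τ : ℝ → ℝ} (hτ : IsCharacteristic T α Λ q τ p x) :
    ContinuousOn (fun r => u r (τ r)) (Icc p x) := by
  have hc : ContinuousOn τ (Icc p x) := fun r hr => (hτ.deriv r hr).continuousWithinAt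
  exact P.u_cont.comp (f := fun r => (r, τ r)) (continuousOn_id.prodMk hc)
    (fun r hr => ⟨⟨hp.trans hr.1, hr.2.trans hx.2⟩, hτ.mem r hr⟩)

lemma hasDerivAt_along (P : TransportProblem L T α Λ ε q c F φ φ' g g' ψ u)
    {x p : ℝ} (hx : x ∈ Icc 0 L) (hp : 0 ≤ p) {τ : ℝ → ℝ} (hτ : IsCharacteristic T α Λ q τ p x)
    {r : ℝ} (hr : r ∈ Ioo p x) :
    HasDerivAt τ (q r (τ r)) r ∧
    HasDerivAt (fun r => u r (τ r)) (F r (τ r) - c r (τ r) * u r (τ r)) r := by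
  have h1 : HasDerivAt τ (q r (τ r)) r :=
    (hτ.deriv r (Ioo_subset_Icc_self hr)).hasDerivAt (Icc_mem_nhds hr.1 hr.2)
  obtain ⟨D, hD, hD'⟩ := P.u_eq r ⟨hp.trans_lt hr.1, hr.2.trans_le hx.2⟩ (τ r) (hτ.mem_Ioo r hr)
  refine ⟨h1, ?_⟩
  rw [← hD']
  exact HasFDerivAt.comp_hasDerivAt (f := fun r => (r, τ r)) (l := Function.uncurry u) r hD
    ((hasDerivAt_id r).prodMk h1)

/-! ### Estimates along characteristics -/

/-- The maximum principle. The source is of size `ε⁻¹`, but along a characteristic its integral is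
bounded by an increment of the layer function. -/
lemma abs_solution_le (P : TransportProblem L T α Λ ε q c F φ φ' g g' ψ u) {x t : ℝ}
    (hx : x ∈ Icc 0 L) (ht : t ∈ Icc 0 T) : |u x t| ≤ 2 * Λ := by
  obtain ⟨p, -, -, τ₃, hp, hpx, -, -, k, -, -, e, hor, -⟩ :=
    P.exists_characteristics hx ht.1 le_rfl le_rfl ht.2
  have hΛ : 0 < Λ := by linarith [P.Λ_ge]
  have hpm : p ∈ Icc 0 L := ⟨hp, hpx.trans hx.2⟩
  have hE : Continuous (layer L ε) := by unfold layer; fun_prop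
  have := abs_le_of_damped (y := fun r => u r (τ₃ r)) (G := fun r => Λ * layer L ε r) hpx
    (P.continuousOn_along hx hp k) (by fun_prop) (fun r hr => by
      have hr' := Ioo_subset_Icc_self hr
      have hrL : r ∈ Icc 0 L := ⟨hp.trans hr'.1, hr'.2.trans hx.2⟩
      refine ⟨_, _, c r (τ₃ r), (P.hasDerivAt_along hx hp k hr).2,
        (hasDerivAt_layer L ε r).const_mul Λ, P.c_nonneg r hrL _ (k.mem r hr'), ?_⟩
      rw [sub_add_cancel]
      exact P.F_bound r hrL _ (k.mem r hr'))
  simp only [e] at this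
  have h1 : |u p (τ₃ p)| ≤ Λ := by
    rcases hor with rfl | h
    · rw [P.inflow _ (k.mem _ ⟨le_rfl, hpx⟩)]; exact P.ψ_bound _ (k.mem _ ⟨le_rfl, hpx⟩)
    · rw [h, P.initial p hpm]; exact P.φ_bound p hpm
  have h2 : Λ * layer L ε x ≤ Λ * 1 := mul_le_mul_of_nonneg_left (layer_le_one P.ε_pos hx.2) hΛ.le
  have h3 : 0 < Λ * layer L ε p := mul_pos hΛ (layer_pos _ _ _)
  linarith

lemma ψ_zero (P : TransportProblem L T α Λ ε q c F φ φ' g g' ψ u) : ψ 0 = φ 0 := by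
  have := P.corner 0 ⟨le_rfl, P.T_pos.le⟩
  simp only [zero_mul, sub_zero, ne_eq, OfNat.ofNat_ne_zero, not_false_eq_true, zero_pow, mul_zero,
    abs_nonpos_iff] at this
  linarith

/-- The rate at which the solution leaves its initial values, obtained by following `u - φ` along a
characteristic: over the time `t` the characteristic covers an `x`-distance of at most `Λ t`. -/
lemma abs_sub_initial_le (P : TransportProblem L T α Λ ε q c F φ φ' g g' ψ u) {x t : ℝ}
    (hx : x ∈ Icc 0 L) (ht : t ∈ Icc 0 T) :
    |u x t - φ x| ≤ 4 * Λ ^ 3 * t * (1 + ε⁻¹ * layer L ε x) := by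
  obtain ⟨p, -, -, τ, hp, hpx, -, -, k, -, -, e, hor, -⟩ :=
    P.exists_characteristics hx ht.1 le_rfl le_rfl ht.2
  have hΛ1 := P.Λ_ge
  have hΛ : 0 < Λ := by linarith
  have hε := P.ε_pos
  have hpm : p ∈ Icc 0 L := ⟨hp, hpx.trans hx.2⟩
  have hpp : p ∈ Icc p x := ⟨le_rfl, hpx⟩
  have hsub : Icc p x ⊆ Icc 0 L := Icc_subset_Icc hp hx.2
  set C := Λ * (ε⁻¹ * layer L ε x) + Λ * Λ + Λ with hC
  have hw : 0 < ε⁻¹ * layer L ε x := mul_pos (by positivity) (layer_pos _ _ _)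
  have := abs_le_of_damped (y := fun r => u r (τ r) - φ r) (G := fun r => C * r) hpx
    ((P.continuousOn_along hx hp k).sub (P.φ_cont.mono hsub)) (by fun_prop) (fun r hr => by
      have hr' := Ioo_subset_Icc_self hr
      have hrL : r ∈ Icc 0 L := hsub hr'
      have hrI : r ∈ Ioo 0 L := ⟨hp.trans_lt hr.1, hr.2.trans_le hx.2⟩
      refine ⟨_, C * 1, c r (τ r), ((P.hasDerivAt_along hx hp k hr).2.sub (P.φ_deriv r hrI)),
        (hasDerivAt_id r).const_mul C, P.c_nonneg r hrL _ (k.mem r hr'), ?_⟩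
      have e1 : F r (τ r) - c r (τ r) * u r (τ r) - φ' r + c r (τ r) * (u r (τ r) - φ r) =
        F r (τ r) + (- (c r (τ r) * φ r)) + (- φ' r) := by ring
      rw [e1]
      refine (abs_add_three _ _ _).trans ?_
      rw [abs_neg, abs_neg, abs_mul, abs_of_nonneg (P.c_nonneg r hrL _ (k.mem r hr'))]
      have i1 := P.F_bound r hrL _ (k.mem r hr')
      have i2 := mul_le_mul (P.c_le r hrL _ (k.mem r hr')) (P.φ_bound r hrL) (abs_nonneg _) hΛ.le
      have i3 := P.φ'_bound r hrL
      have i4 : Λ * (ε⁻¹ * layer L ε r) ≤ Λ * (ε⁻¹ * layer L ε x) := by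
        have := layer_mono hε (L := L) hr'.2
        gcongr
      linarith)
  simp only [e] at this
  have h0 := k.le_growth p hpp x ⟨hpx, le_rfl⟩ hpx
  have hτp := (k.mem p hpp).1
  rw [e] at h0
  have h1 : |u p (τ p) - φ p| ≤ Λ * τ p := by
    rcases hor with rfl | h
    · rw [P.inflow _ (k.mem _ hpp), ← P.ψ_zero]
      have := P.ψ_second.lip 0 ⟨le_rfl, P.T_pos.le⟩ _ (k.mem _ hpp)
      rwa [sub_zero, abs_of_nonneg hτp] at this
    · rw [h, P.initial p hpm]; simp
  have hC0 : 0 ≤ C := by positivity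
  have h2 : C * (x - p) ≤ C * (Λ * (t - τ p)) := mul_le_mul_of_nonneg_left h0 hC0
  have h3 : Λ * τ p ≤ C * (Λ * τ p) := by
    have : 1 ≤ C := by nlinarith
    exact le_mul_of_one_le_left (by positivity) this
  have h4 : C ≤ 4 * Λ ^ 2 * (1 + ε⁻¹ * layer L ε x) := by
    rw [hC]; nlinarith [mul_nonneg (sub_nonneg.2 hΛ1) hw.le, mul_nonneg hΛ.le hw.le,
      mul_nonneg (mul_nonneg hΛ.le (sub_nonneg.2 hΛ1)) hw.le]
  have h5 : C * (Λ * t) ≤ 4 * Λ ^ 2 * (1 + ε⁻¹ * layer L ε x) * (Λ * t) :=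
    mul_le_mul_of_nonneg_right h4 (mul_nonneg hΛ.le ht.1)
  have h6 : 4 * Λ ^ 2 * (1 + ε⁻¹ * layer L ε x) * (Λ * t) =
    4 * Λ ^ 3 * t * (1 + ε⁻¹ * layer L ε x) := by ring
  nlinarith

/-- The first Taylor polynomial of `u` in `t` at the initial line. Along a characteristic the terms of
order zero of its residual cancel by the definition of `g`; at the inflow boundary `x = 0` the
compatibility conditions give the same order. -/
lemma abs_sub_taylor_le (P : TransportProblem L T α Λ ε q c F φ φ' g g' ψ u) {x t : ℝ}
    (hx : x ∈ Icc 0 L) (ht : t ∈ Icc 0 T) :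
    |u x t - φ x - t * g x| ≤ 5 * Λ ^ 3 * t ^ 2 * (1 + ε⁻¹ ^ 2 * layer L ε x) := by
  obtain ⟨p, -, -, τ, hp, hpx, -, -, k, -, -, e, hor, -⟩ :=
    P.exists_characteristics hx ht.1 le_rfl le_rfl ht.2
  have hΛ1 := P.Λ_ge
  have hΛ : 0 < Λ := by linarith
  have hε := P.ε_pos
  have hε1 : 1 ≤ ε⁻¹ := (one_le_inv₀ hε).2 P.ε_le
  have hpm : p ∈ Icc 0 L := ⟨hp, hpx.trans hx.2⟩
  have hpp : p ∈ Icc p x := ⟨le_rfl, hpx⟩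
  have hxx : x ∈ Icc p x := ⟨hpx, le_rfl⟩
  have h0T : (0 : ℝ) ∈ Icc 0 T := ⟨le_rfl, P.T_pos.le⟩
  have hsub : Icc p x ⊆ Icc 0 L := Icc_subset_Icc hp hx.2
  have hτc : ContinuousOn τ (Icc p x) := fun r hr => (k.deriv r hr).continuousWithinAt
  set W := 1 + ε⁻¹ ^ 2 * layer L ε x with hW
  have hW0 : 0 < W := by have := layer_pos L ε x; positivity
  set C := 4 * Λ ^ 2 * W * t with hC
  have := abs_le_of_damped (y := fun r => u r (τ r) - φ r - τ r * g r) (G := fun r => C * r) hpx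
    (((P.continuousOn_along hx hp k).sub (P.φ_cont.mono hsub)).sub
      (hτc.mul (P.g_cont.mono hsub))) (by fun_prop) (fun r hr => by
      have hr' := Ioo_subset_Icc_self hr
      have hrL : r ∈ Icc 0 L := hsub hr'
      have hrI : r ∈ Ioo 0 L := ⟨hp.trans_lt hr.1, hr.2.trans_le hx.2⟩
      have hτm := k.mem r hr'
      have hd := P.hasDerivAt_along hx hp k hr
      refine ⟨_, C * 1, c r (τ r), ((hd.2.sub (P.φ_deriv r hrI)).sub
        (hd.1.mul (P.g_deriv r hrI))),
        (hasDerivAt_id r).const_mul C, P.c_nonneg r hrL _ hτm, ?_⟩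
      have e1 : F r (τ r) - c r (τ r) * u r (τ r) - φ' r - (q r (τ r) * g r + τ r * g' r) +
          c r (τ r) * (u r (τ r) - φ r - τ r * g r) =
          ((F r (τ r) - F r 0) + (-((c r (τ r) - c r 0) * φ r)) + (-((q r (τ r) - q r 0) * g r))) +
            (-(τ r * g' r)) + (-(c r (τ r) * (τ r * g r))) := by
        have := P.g_eq r hrI
        linear_combination -this
      have hl : layer L ε r ≤ layer L ε x := layer_mono hε hr'.2
      have hlp := layer_pos L ε r
      set w := 1 + ε⁻¹ ^ 2 * layer L ε r with hw
      have hwW : w ≤ W := by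
        rw [hw, hW]; gcongr
      have hw0 : 0 < w := by positivity
      have hee : ε⁻¹ * layer L ε r ≤ ε⁻¹ ^ 2 * layer L ε r := by
        rw [sq, mul_assoc]; exact le_mul_of_one_le_left (by positivity) hε1
      have hτt : τ r ≤ t := by
        have h1 := k.le_growth r hr' x hxx hr'.2
        rw [e] at h1
        by_contra! h
        nlinarith [hr'.2]
      have hτa : |τ r - 0| = τ r := by rw [sub_zero, abs_of_nonneg hτm.1]
      have i1 := (P.F_second r hrL).lip 0 h0T _ hτm
      have i2 := mul_le_mul ((P.c_second r hrL).lip 0 h0T _ hτm) (P.φ_bound r hrL) (abs_nonneg _)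
        (by positivity)
      have hg : |g r| ≤ Λ * w := (P.g_bound r hrL).trans (by rw [hw]; gcongr)
      have i3 := mul_le_mul ((P.q_second r hrL).lip 0 h0T _ hτm) hg (abs_nonneg _)
        (by positivity)
      have i4 := mul_le_mul_of_nonneg_left (P.g'_bound r hrL) hτm.1
      have i5 := mul_le_mul (P.c_le r hrL _ hτm) (mul_le_mul_of_nonneg_left hg hτm.1)
        (mul_nonneg hτm.1 (abs_nonneg _)) hΛ.le
      rw [hτa] at i1 i2 i3
      rw [e1]
      refine (abs_add_three _ _ _).trans ((add_le_add (add_le_add (abs_add_three _ _ _) le_rfl)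
        le_rfl).trans ?_)
      simp only [abs_neg, abs_mul]
      rw [abs_of_nonneg (P.c_nonneg r hrL _ hτm), abs_of_nonneg hτm.1]
      rw [← hw] at i4
      have j : Λ * (ε⁻¹ * layer L ε r) * τ r + Λ * τ r * Λ + τ r * (Λ * w) ≤
          2 * Λ ^ 2 * w * τ r := by
        have j1 : Λ * (ε⁻¹ * layer L ε r) + Λ * Λ + Λ * w ≤ 2 * Λ ^ 2 * w := by
          rw [hw]
          have m1 : 0 ≤ (Λ - 1) * Λ := mul_nonneg (by linarith) hΛ.le
          have m2 : 0 ≤ (Λ - 1) * Λ * (ε⁻¹ ^ 2 * layer L ε r) := by positivity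
          have m3 : Λ * (ε⁻¹ * layer L ε r) ≤ Λ * (ε⁻¹ ^ 2 * layer L ε r) := by gcongr
          nlinarith
        have := mul_le_mul_of_nonneg_right j1 hτm.1
        linarith
      have j2 : 4 * Λ ^ 2 * w * τ r ≤ C * 1 := by
        rw [hC, mul_one]; gcongr; exact hτm.1
      linarith)
  simp only [e] at this
  have h0 := k.le_growth p hpp x hxx hpx
  have hτp := (k.mem p hpp).1
  rw [e] at h0
  have hτt : τ p ≤ t := by
    by_contra! h
    nlinarith
  have h1 : |u p (τ p) - φ p - τ p * g p| ≤ Λ * t ^ 2 := by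
    rcases hor with rfl | h
    · rw [P.inflow _ (k.mem _ hpp)]
      refine (P.corner _ (k.mem _ hpp)).trans ?_
      gcongr
    · rw [h, P.initial p hpm]; simp; have := ht.1; positivity
  have hC0 : 0 ≤ C := by have := ht.1; positivity
  have h2 : C * (x - p) ≤ C * (Λ * t) :=
    mul_le_mul_of_nonneg_left (h0.trans (mul_le_mul_of_nonneg_left (by linarith) hΛ.le)) hC0
  have h3 : Λ * t ^ 2 ≤ Λ ^ 3 * t ^ 2 * W := by
    have hW1 : 1 ≤ W := by rw [hW]; have := layer_pos L ε x; linarith [show 0 ≤ ε⁻¹ ^ 2 * layer L ε x by positivity]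
    have m : Λ ≤ Λ ^ 3 := by nlinarith [mul_nonneg hΛ.le (sub_nonneg.2 hΛ1)]
    calc Λ * t ^ 2 ≤ Λ ^ 3 * t ^ 2 := by gcongr
      _ ≤ Λ ^ 3 * t ^ 2 * W := le_mul_of_one_le_right (by positivity) hW1
  have h4 : C * (Λ * t) = 4 * Λ ^ 3 * t ^ 2 * W := by rw [hC]; ring
  linarith

end TransportProblem
end

section
variable {L T α Λ ε : ℝ} {q c F : ℝ → ℝ → ℝ} {φ φ' g g' ψ : ℝ → ℝ} {u : ℝ → ℝ → ℝ}

/-! ### Differences in time -/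

/-- The boundary layer function times the initial layer function `e^{-αt/ε}`. -/
noncomputable def cornerLayer (L α ε x t : ℝ) : ℝ := Real.exp ((x - α * t - L) / ε)

lemma cornerLayer_pos (L α ε x t : ℝ) : 0 < cornerLayer L α ε x t := Real.exp_pos _

lemma cornerLayer_eq (L α ε x t : ℝ) :
    cornerLayer L α ε x t = layer L ε x * Real.exp (-(α * t) / ε) := by
  rw [cornerLayer, layer, ← Real.exp_add]; congr 1; ring

lemma cornerLayer_le (L : ℝ) {α ε x t y s : ℝ} (hε : 0 < ε) (h : x - α * t ≤ y - α * s) :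
    cornerLayer L α ε x t ≤ cornerLayer L α ε y s := by
  unfold cornerLayer; gcongr

lemma cornerLayer_zero (L α ε x : ℝ) : cornerLayer L α ε x 0 = layer L ε x := by
  simp [cornerLayer, layer]

/-- Along a characteristic the corner layer function increases with `x`, since `q ≤ 1/α`. -/
lemma IsCharacteristic.cornerLayer_le {p x : ℝ} {τ : ℝ → ℝ} (k : IsCharacteristic T α Λ q τ p x)
    (L : ℝ) (hε : 0 < ε) {r s : ℝ} (hr : r ∈ Icc p x) (hs : s ∈ Icc p x) (hrs : r ≤ s) :
    cornerLayer L α ε r (τ r) ≤ cornerLayer L α ε s (τ s) :=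
  TransportLayer.cornerLayer_le L hε (by have := k.growth_le r hr s hs hrs; linarith)

namespace TransportProblem

/-- The Lipschitz bound in time. The difference of `u` along the characteristics through `(x,t₁)` and
`(x,t₂)` is estimated from the foot point of the lower one, where either the inflow data or
the bound near the initial line applies; in the second case the layer at the foot point is carried
to `(x,t₂)` as the corner layer. -/
lemma abs_sub_time_le : ∀ L T α Λ : ℝ, ∃ K, 0 ≤ K ∧ ∀ {ε : ℝ} {q c F : ℝ → ℝ → ℝ}
    {φ φ' g g' ψ : ℝ → ℝ} {u : ℝ → ℝ → ℝ},
    TransportProblem L T α Λ ε q c F φ φ' g g' ψ u → ∀ x ∈ Icc 0 L, ∀ t₁ t₂, 0 ≤ t₂ → t₂ ≤ t₁ →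
      t₁ ≤ T → |u x t₁ - u x t₂| ≤ K * (t₁ - t₂) * (1 + ε⁻¹ * cornerLayer L α ε x t₂) := by
  intro L T α Λ
  set κ := Real.exp (Λ * L) with hκ
  refine ⟨κ * (|Λ| + 2 * Λ ^ 2 * |L| + |Λ| + 4 * |Λ| ^ 3), by positivity, ?_⟩
  intro ε q c F φ φ' g g' ψ u P x hx t₁ t₂ h2 h21 h1
  obtain ⟨p, τ₁, _, τ₂, hp, hpx, k₁, -, k₂, e₁, -, e₂, hor, ho⟩ :=
    P.exists_characteristics hx h2 le_rfl h21 h1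
  have hΛ1 := P.Λ_ge
  have hΛ : 0 < Λ := by linarith
  have hε := P.ε_pos
  have hL := P.L_pos
  rw [abs_of_pos hΛ, abs_of_pos hL]
  have hε1 : 1 ≤ ε⁻¹ := (one_le_inv₀ hε).2 P.ε_le
  have hpm : p ∈ Icc 0 L := ⟨hp, hpx.trans hx.2⟩
  have hpp : p ∈ Icc p x := ⟨le_rfl, hpx⟩
  have hxx : x ∈ Icc p x := ⟨hpx, le_rfl⟩
  have hsub : Icc p x ⊆ Icc 0 L := Icc_subset_Icc hp hx.2
  have hE : Continuous (layer L ε) := by unfold layer; fun_prop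
  have hκ0 : 0 < κ := Real.exp_pos _
  set d := t₁ - t₂ with hd
  have hd0 : 0 ≤ d := by linarith
  have := abs_le_of_damped (y := fun r => u r (τ₁ r) - u r (τ₂ r))
    (G := fun r => κ * d * (Λ * layer L ε r + 2 * Λ ^ 2 * r)) hpx
    ((P.continuousOn_along hx hp k₁).sub (P.continuousOn_along hx hp k₂)) (by fun_prop)
    (fun r hr => by
      have hr' := Ioo_subset_Icc_self hr
      have hrL : r ∈ Icc 0 L := hsub hr'
      have m₁ := k₁.mem r hr'
      have m₂ := k₂.mem r hr'
      obtain ⟨-, -, hD⟩ := ho r hr'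
      have hDn : 0 ≤ τ₁ r - τ₂ r := by linarith [(ho r hr').1, (ho r hr').2.1]
      refine ⟨_, _, c r (τ₁ r),
        (P.hasDerivAt_along hx hp k₁ hr).2.sub (P.hasDerivAt_along hx hp k₂ hr).2,
        (((hasDerivAt_layer L ε r).const_mul Λ).add
          ((hasDerivAt_id r).const_mul (2 * Λ ^ 2))).const_mul (κ * d),
        P.c_nonneg r hrL _ m₁, ?_⟩
      have e : F r (τ₁ r) - c r (τ₁ r) * u r (τ₁ r) - (F r (τ₂ r) - c r (τ₂ r) * u r (τ₂ r)) +
          c r (τ₁ r) * (u r (τ₁ r) - u r (τ₂ r)) =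
          (F r (τ₁ r) - F r (τ₂ r)) + (-((c r (τ₁ r) - c r (τ₂ r)) * u r (τ₂ r))) := by ring
      rw [e]
      refine (abs_add_le _ _).trans ?_
      rw [abs_neg, abs_mul]
      have i1 := (P.F_second r hrL).lip _ m₂ _ m₁
      have i2 := mul_le_mul ((P.c_second r hrL).lip _ m₂ _ m₁) (P.abs_solution_le hrL m₂) (abs_nonneg _)
        (by positivity)
      rw [abs_of_nonneg hDn] at i1 i2
      have hw : 0 < ε⁻¹ * layer L ε r := mul_pos (by positivity) (layer_pos _ _ _)
      have i3 := mul_le_mul_of_nonneg_right hD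
        (show 0 ≤ Λ * (ε⁻¹ * layer L ε r) + 2 * Λ ^ 2 by positivity)
      rw [mul_one]
      linarith)
  simp only [e₁, e₂] at this
  have hW := cornerLayer_pos L α ε x t₂
  have hW1 : 0 ≤ ε⁻¹ * cornerLayer L α ε x t₂ := by positivity
  have hfoot : |u p (τ₁ p) - u p (τ₂ p)| ≤
      κ * d * (Λ + 4 * Λ ^ 3) * (1 + ε⁻¹ * cornerLayer L α ε x t₂) := by
    have m₁ := k₁.mem p hpp
    have m₂ := k₂.mem p hpp
    obtain ⟨o1, o2, hD⟩ := ho p hpp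
    have hDn : 0 ≤ τ₁ p - τ₂ p := by linarith
    have hn : 0 ≤ κ * d := by positivity
    rcases hor with rfl | h
    · rw [P.inflow _ m₁, P.inflow _ m₂]
      have i1 := P.ψ_second.lip _ m₂ _ m₁
      rw [abs_of_nonneg hDn] at i1
      calc _ ≤ Λ * (τ₁ 0 - τ₂ 0) := i1
        _ ≤ Λ * (κ * d) := by gcongr
        _ ≤ (κ * d * (Λ + 4 * Λ ^ 3)) * 1 := by
          have : 0 ≤ κ * d * (4 * Λ ^ 3) := by positivity
          linarith
        _ ≤ _ := by gcongr; linarith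
    · rw [h] at hD ⊢
      rw [P.initial p hpm]
      have hl : layer L ε p ≤ cornerLayer L α ε x t₂ := by
        have := k₂.cornerLayer_le L hε hpp hxx hpx
        rwa [h, e₂, cornerLayer_zero] at this
      rw [sub_zero] at hD
      calc _ ≤ 4 * Λ ^ 3 * τ₁ p * (1 + ε⁻¹ * layer L ε p) := P.abs_sub_initial_le hpm m₁
        _ ≤ 4 * Λ ^ 3 * (κ * d) * (1 + ε⁻¹ * cornerLayer L α ε x t₂) := by
          have := layer_pos L ε p
          gcongr
        _ ≤ _ := by
          refine mul_le_mul_of_nonneg_right ?_ (by linarith)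
          linarith [mul_nonneg hn hΛ.le]
  have h3 : κ * d * (Λ * layer L ε x + 2 * Λ ^ 2 * x) -
      κ * d * (Λ * layer L ε p + 2 * Λ ^ 2 * p) ≤ κ * d * (Λ + 2 * Λ ^ 2 * L) := by
    rw [← mul_sub]
    refine mul_le_mul_of_nonneg_left ?_ (by positivity)
    have i1 : Λ * layer L ε x ≤ Λ * 1 := mul_le_mul_of_nonneg_left (layer_le_one hε hx.2) hΛ.le
    have i2 : 0 < Λ * layer L ε p := mul_pos hΛ (layer_pos _ _ _)
    have i3 : 2 * Λ ^ 2 * (x - p) ≤ 2 * Λ ^ 2 * L := by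
      gcongr; linarith [hx.2]
    linarith
  have h4 : κ * d * (Λ + 2 * Λ ^ 2 * L) ≤
      κ * d * (Λ + 2 * Λ ^ 2 * L) * (1 + ε⁻¹ * cornerLayer L α ε x t₂) :=
    le_mul_of_one_le_right (by positivity) (by linarith)
  calc _ ≤ _ := this
    _ ≤ κ * d * (Λ + 4 * Λ ^ 3) * (1 + ε⁻¹ * cornerLayer L α ε x t₂) +
      κ * d * (Λ + 2 * Λ ^ 2 * L) * (1 + ε⁻¹ * cornerLayer L α ε x t₂) := by linarith
    _ = _ := by ring

/-- Second differences of `u` in time. The layer term is evaluated at the earliest of the three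
times: it is generated near the initial line and carried along the characteristics. Comparing three
characteristics through equidistant points avoids differentiating the equation, for which `u` is not
regular enough. -/
lemma abs_second_difference_le : ∀ L T α Λ : ℝ, ∃ K, 0 ≤ K ∧ ∀ {ε : ℝ} {q c F : ℝ → ℝ → ℝ}
    {φ φ' g g' ψ : ℝ → ℝ} {u : ℝ → ℝ → ℝ},
    TransportProblem L T α Λ ε q c F φ φ' g g' ψ u → ∀ x ∈ Icc 0 L, ∀ s h, 0 ≤ s → 0 ≤ h →
      s + 2 * h ≤ T → |u x (s + 2 * h) - 2 * u x (s + h) + u x s| ≤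
        K * h ^ 2 * (1 + ε⁻¹ ^ 2 * cornerLayer L α ε x s) := by
  intro L T α Λ
  obtain ⟨K₃, hK₃, H₃⟩ := abs_sub_time_le L T α Λ
  set κ := Real.exp (Λ * L) with hκ
  set κ₂ := κ ^ 2 * (Λ * L * κ + 1) with hκ₂
  set C₁ := 2 * Λ ^ 2 * κ₂ + 2 * Λ * K₃ * κ ^ 2 with hC₁
  refine ⟨4 * |15 * Λ ^ 3 * κ ^ 2 + Λ * (Λ * L * κ ^ 3) + Λ * κ₂ + (Λ * κ₂ + L * C₁)|,
    by positivity, ?_⟩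
  intro ε q c F φ φ' g g' ψ u P x hx s h hs hh hsT
  obtain ⟨p, τ₁, τ₂, τ₃, hp, hpx, k₁, k₂, k₃, e₁, e₂, e₃, hor, ho⟩ :=
    P.exists_characteristics hx hs (show s ≤ s + h by linarith)
      (show s + h ≤ s + 2 * h by linarith) hsT
  have hΛ1 := P.Λ_ge
  have hΛ : 0 < Λ := by linarith
  have hε := P.ε_pos
  have hL := P.L_pos
  have hε1 : 1 ≤ ε⁻¹ := (one_le_inv₀ hε).2 P.ε_le
  have hpm : p ∈ Icc 0 L := ⟨hp, hpx.trans hx.2⟩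
  have hpp : p ∈ Icc p x := ⟨le_rfl, hpx⟩
  have hxx : x ∈ Icc p x := ⟨hpx, le_rfl⟩
  have hsub : Icc p x ⊆ Icc 0 L := Icc_subset_Icc hp hx.2
  have hE : Continuous (layer L ε) := by unfold layer; fun_prop
  have hκ0 : 0 < κ := Real.exp_pos _
  have hκ₂0 : 0 < κ₂ := by positivity
  have hC₁0 : 0 ≤ C₁ := by positivity
  rw [abs_of_nonneg (show 0 ≤ 15 * Λ ^ 3 * κ ^ 2 + Λ * (Λ * L * κ ^ 3) + Λ * κ₂ +
    (Λ * κ₂ + L * C₁) by positivity)]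
  set d := 2 * h with hd
  have hd0 : 0 ≤ d := by linarith
  set W := cornerLayer L α ε x s with hW
  have hW0 : 0 < W := cornerLayer_pos _ _ _ _ _
  have hD0 : ∀ r ∈ Icc p x, 0 ≤ τ₁ r - τ₃ r := fun r hr => by
    linarith [(ho r hr).1, (ho r hr).2.1]
  have hD : ∀ r ∈ Icc p x, τ₁ r - τ₃ r ≤ κ * d := fun r hr => by
    have := (ho r hr).2.2
    rwa [show s + 2 * h - s = d by ring] at this
  have hD2 : ∀ r ∈ Icc p x, (τ₁ r - τ₃ r) ^ 2 ≤ κ ^ 2 * d ^ 2 := fun r hr => by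
    rw [← mul_pow]; exact pow_le_pow_left₀ (hD0 r hr) (hD r hr) 2
  -- The characteristics stay equidistant up to second order.
  have hR : ∀ r ∈ Icc p x, |τ₁ r - 2 * τ₂ r + τ₃ r| ≤ Λ * L * κ ^ 3 * d ^ 2 := fun r hr => by
    have := abs_le_of_gronwall_left (y := fun r => τ₁ r - 2 * τ₂ r + τ₃ r) (K := Λ)
      (κ := Λ * (κ ^ 2 * d ^ 2)) hΛ (by positivity)
      (fun z hz => (((k₁.deriv z hz).sub ((k₂.deriv z hz).const_mul 2)).add (k₃.deriv z hz)))
      (fun z hz => by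
        refine ((P.q_second z (hsub hz)).second _ (k₁.mem z hz) _ (k₂.mem z hz) _ (k₃.mem z hz)
          (ho z hz).1 (ho z hz).2.1).trans ?_
        rw [mul_add]
        exact add_le_add le_rfl (mul_le_mul_of_nonneg_left (hD2 z hz) hΛ.le)) r hr
    simp only [e₁, e₂, e₃] at this
    rw [show s + d - 2 * (s + h) + s = 0 by rw [hd]; ring, abs_zero, zero_add] at this
    have hr1 : x - r ≤ L := by linarith [hx.2, (hsub hr).1]
    have hr0 : 0 ≤ x - r := by linarith [hr.2]
    calc _ ≤ _ := this
      _ ≤ Λ * (κ ^ 2 * d ^ 2) * L * κ := by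
        rw [hκ]; gcongr
      _ = _ := by ring
  -- hence `SecondOrderLip` data have second differences of order `d²` along them
  have hS : ∀ r ∈ Icc p x, |τ₁ r - 2 * τ₂ r + τ₃ r| + (τ₁ r - τ₃ r) ^ 2 ≤ κ₂ * d ^ 2 :=
    fun r hr => (add_le_add (hR r hr) (hD2 r hr)).trans (by rw [hκ₂]; apply le_of_eq; ring)
  have hWr : ∀ r ∈ Icc p x, cornerLayer L α ε r (τ₃ r) ≤ W := fun r hr => by
    have := k₃.cornerLayer_le L hε hr hxx hr.2
    rwa [e₃] at this
  have := abs_le_of_damped (y := fun r => u r (τ₁ r) - 2 * u r (τ₂ r) + u r (τ₃ r))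
    (G := fun r => d ^ 2 * (Λ * κ₂ * layer L ε r + C₁ * (1 + ε⁻¹ * W) * r)) hpx
    (((P.continuousOn_along hx hp k₁).sub
      (continuousOn_const.mul (P.continuousOn_along hx hp k₂))).add
        (P.continuousOn_along hx hp k₃)) (by fun_prop)
    (fun r hr => by
      have hr' := Ioo_subset_Icc_self hr
      have hrL : r ∈ Icc 0 L := hsub hr'
      have m₁ := k₁.mem r hr'
      have m₂ := k₂.mem r hr'
      have m₃ := k₃.mem r hr'
      obtain ⟨o32, o21, -⟩ := ho r hr'
      refine ⟨_, _, c r (τ₂ r),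
        ((P.hasDerivAt_along hx hp k₁ hr).2.sub
          ((P.hasDerivAt_along hx hp k₂ hr).2.const_mul 2)).add (P.hasDerivAt_along hx hp k₃ hr).2,
        (((hasDerivAt_layer L ε r).const_mul (Λ * κ₂)).add
          ((hasDerivAt_id r).const_mul (C₁ * (1 + ε⁻¹ * W)))).const_mul (d ^ 2),
        P.c_nonneg r hrL _ m₂, ?_⟩
      set D := τ₁ r - τ₃ r with hDdef
      have hDn : 0 ≤ D := hD0 r hr'
      have a12 : |τ₁ r - τ₂ r| ≤ D := by rw [abs_of_nonneg] <;> linarith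
      have a32 : |τ₃ r - τ₂ r| ≤ D := by rw [abs_of_nonpos] <;> linarith
      set B := K₃ * (1 + ε⁻¹ * W) with hB
      have hB0 : 0 ≤ B := by positivity
      have w3 := hWr r hr'
      have b12 : |u r (τ₁ r) - u r (τ₂ r)| ≤ B * D := by
        have w2 : cornerLayer L α ε r (τ₂ r) ≤ cornerLayer L α ε r (τ₃ r) :=
          cornerLayer_le L hε (by have := mul_le_mul_of_nonneg_left o32 P.α_pos.le; linarith)
        have w0 := cornerLayer_pos L α ε r (τ₂ r)
        calc _ ≤ K₃ * (τ₁ r - τ₂ r) * (1 + ε⁻¹ * cornerLayer L α ε r (τ₂ r)) :=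
              H₃ P r hrL _ _ m₂.1 o21 m₁.2
          _ ≤ K₃ * D * (1 + ε⁻¹ * W) := by
              gcongr
              · linarith
              · exact w2.trans w3
          _ = B * D := by rw [hB]; ring
      have b32 : |u r (τ₃ r) - u r (τ₂ r)| ≤ B * D := by
        have w0 := cornerLayer_pos L α ε r (τ₃ r)
        rw [abs_sub_comm]
        calc _ ≤ K₃ * (τ₂ r - τ₃ r) * (1 + ε⁻¹ * cornerLayer L α ε r (τ₃ r)) :=
              H₃ P r hrL _ _ m₃.1 o32 m₂.2
          _ ≤ K₃ * D * (1 + ε⁻¹ * W) := by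
              gcongr
              linarith
          _ = B * D := by rw [hB]; ring
      have i1 := abs_second_difference_mul_le hDn hΛ.le
        (((P.c_second r hrL).lip _ m₂ _ m₁).trans (mul_le_mul_of_nonneg_left a12 hΛ.le))
        (((P.c_second r hrL).lip _ m₂ _ m₃).trans (mul_le_mul_of_nonneg_left a32 hΛ.le))
        ((P.c_second r hrL).second _ m₁ _ m₂ _ m₃ o32 o21) b12 b32
      have i2 := (P.F_second r hrL).second _ m₁ _ m₂ _ m₃ o32 o21
      have e : F r (τ₁ r) - c r (τ₁ r) * u r (τ₁ r) -
          2 * (F r (τ₂ r) - c r (τ₂ r) * u r (τ₂ r)) + (F r (τ₃ r) - c r (τ₃ r) * u r (τ₃ r)) +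
          c r (τ₂ r) * (u r (τ₁ r) - 2 * u r (τ₂ r) + u r (τ₃ r)) =
          (F r (τ₁ r) - 2 * F r (τ₂ r) + F r (τ₃ r)) -
          ((c r (τ₁ r) * u r (τ₁ r) - 2 * (c r (τ₂ r) * u r (τ₂ r)) + c r (τ₃ r) * u r (τ₃ r)) -
            c r (τ₂ r) * (u r (τ₁ r) - 2 * u r (τ₂ r) + u r (τ₃ r))) := by ring
      rw [e]
      refine (abs_sub _ _).trans ((add_le_add i2 i1).trans ?_)
      have hw : 0 < ε⁻¹ * layer L ε r := mul_pos (by positivity) (layer_pos _ _ _)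
      have j1 := hS r hr'
      have j2 := hD2 r hr'
      have j3 := P.abs_solution_le hrL m₂
      have hd2 : 0 ≤ d ^ 2 := sq_nonneg d
      have t1 : Λ * (ε⁻¹ * layer L ε r) * (|τ₁ r - 2 * τ₂ r + τ₃ r| + D ^ 2) ≤
          Λ * (ε⁻¹ * layer L ε r) * (κ₂ * d ^ 2) := by gcongr
      have t2 : Λ * (|τ₁ r - 2 * τ₂ r + τ₃ r| + D ^ 2) * |u r (τ₂ r)| ≤
          Λ * (κ₂ * d ^ 2) * (2 * Λ) := by gcongr
      have t3 : 2 * (Λ * B) * D ^ 2 ≤ 2 * (Λ * B) * (κ ^ 2 * d ^ 2) := by gcongr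
      have t4 : Λ * (κ₂ * d ^ 2) * (2 * Λ) + 2 * (Λ * B) * (κ ^ 2 * d ^ 2) ≤
          d ^ 2 * (C₁ * (1 + ε⁻¹ * W)) := by
        have : 0 ≤ d ^ 2 * (2 * Λ ^ 2 * κ₂) * (ε⁻¹ * W) := by positivity
        rw [hB, hC₁]
        linarith
      rw [mul_one, mul_add]
      linarith)
  simp only [e₁, e₂, e₃] at this
  set V := 1 + ε⁻¹ ^ 2 * W with hV
  have hVge : 1 + ε⁻¹ * W ≤ V := by
    rw [hV, sq, mul_assoc]
    have := le_mul_of_one_le_left (show 0 ≤ ε⁻¹ * W by positivity) hε1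
    linarith
  have hV1 : 1 ≤ V := le_trans (by linarith [show 0 ≤ ε⁻¹ * W by positivity]) hVge
  have hfoot : |u p (τ₁ p) - 2 * u p (τ₂ p) + u p (τ₃ p)| ≤
      d ^ 2 * (15 * Λ ^ 3 * κ ^ 2 + Λ * (Λ * L * κ ^ 3) + Λ * κ₂) * V := by
    have m₁ := k₁.mem p hpp
    have m₂ := k₂.mem p hpp
    have m₃ := k₃.mem p hpp
    obtain ⟨o32, o21, -⟩ := ho p hpp
    rcases hor with rfl | h0
    · rw [P.inflow _ m₁, P.inflow _ m₂, P.inflow _ m₃]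
      calc _ ≤ Λ * (|τ₁ 0 - 2 * τ₂ 0 + τ₃ 0| + (τ₁ 0 - τ₃ 0) ^ 2) :=
            P.ψ_second.second _ m₁ _ m₂ _ m₃ o32 o21
        _ ≤ Λ * (κ₂ * d ^ 2) := by have := hS 0 hpp; gcongr
        _ ≤ d ^ 2 * (15 * Λ ^ 3 * κ ^ 2 + Λ * (Λ * L * κ ^ 3) + Λ * κ₂) * 1 := by
          have : 0 ≤ d ^ 2 * (15 * Λ ^ 3 * κ ^ 2 + Λ * (Λ * L * κ ^ 3)) := by positivity
          linarith
        _ ≤ _ := by gcongr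
    · -- at a foot point on `t = 0` the values `φ p` cancel, and the Taylor polynomial at the initial
      -- line leaves the defect `τ₁ - 2 τ₂ + τ₃` times `g p`
      have hl : layer L ε p ≤ W := by
        have := hWr p hpp
        rwa [h0, cornerLayer_zero] at this
      have hlp := layer_pos L ε p
      have hVp : 1 + ε⁻¹ ^ 2 * layer L ε p ≤ V := by rw [hV]; gcongr
      have s1 : τ₁ p ^ 2 ≤ κ ^ 2 * d ^ 2 := by
        have := hD2 p hpp
        rwa [h0, sub_zero] at this
      have s2 : τ₂ p ^ 2 ≤ κ ^ 2 * d ^ 2 :=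
        (pow_le_pow_left₀ m₂.1 o21 2).trans s1
      have y1 := P.abs_sub_taylor_le hpm m₁
      have y2 := P.abs_sub_taylor_le hpm m₂
      have y3 : |(τ₁ p - 2 * τ₂ p) * g p| ≤ Λ * L * κ ^ 3 * d ^ 2 * (Λ * V) := by
        rw [abs_mul]
        have r1 := hR p hpp
        rw [h0, add_zero] at r1
        refine mul_le_mul r1 ((P.g_bound p hpm).trans ?_) (abs_nonneg _) (by positivity)
        refine mul_le_mul_of_nonneg_left (le_trans ?_ hVge) hΛ.le
        gcongr
      have z1 : 5 * Λ ^ 3 * τ₁ p ^ 2 * (1 + ε⁻¹ ^ 2 * layer L ε p) ≤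
          5 * Λ ^ 3 * (κ ^ 2 * d ^ 2) * V := by gcongr
      have z2 : 5 * Λ ^ 3 * τ₂ p ^ 2 * (1 + ε⁻¹ ^ 2 * layer L ε p) ≤
          5 * Λ ^ 3 * (κ ^ 2 * d ^ 2) * V := by gcongr
      have z3 : 0 ≤ d ^ 2 * (Λ * κ₂) * V := by positivity
      rw [h0, P.initial p hpm]
      rw [abs_le] at y1 y2 y3 ⊢
      constructor <;> linarith [y1.1, y1.2, y2.1, y2.2, y3.1, y3.2]
  have h3 : d ^ 2 * (Λ * κ₂ * layer L ε x + C₁ * (1 + ε⁻¹ * W) * x) -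
      d ^ 2 * (Λ * κ₂ * layer L ε p + C₁ * (1 + ε⁻¹ * W) * p) ≤
      d ^ 2 * (Λ * κ₂ + L * C₁) * V := by
    rw [← mul_sub, mul_assoc (d ^ 2)]
    refine mul_le_mul_of_nonneg_left ?_ (by positivity)
    have i1 : Λ * κ₂ * layer L ε x ≤ Λ * κ₂ * V :=
      mul_le_mul_of_nonneg_left ((layer_le_one hε hx.2).trans hV1) (by positivity)
    have i2 : 0 < Λ * κ₂ * layer L ε p := mul_pos (by positivity) (layer_pos _ _ _)
    have i3 : C₁ * (1 + ε⁻¹ * W) * (x - p) ≤ C₁ * V * L := by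
      gcongr
      linarith [hx.2]
    linarith
  calc _ ≤ _ := this
    _ ≤ d ^ 2 * (15 * Λ ^ 3 * κ ^ 2 + Λ * (Λ * L * κ ^ 3) + Λ * κ₂) * V +
      d ^ 2 * (Λ * κ₂ + L * C₁) * V := add_le_add hfoot h3
    _ = _ := by rw [hd]; ring

end TransportProblem
end

/-! ### Bounds on the derivatives -/

lemma sub_mul_layer_le {L ε x y : ℝ} (hε : 0 < ε) :
    (x - y) * (ε⁻¹ * layer L ε y) ≤ layer L ε x - layer L ε y := by
  have := sub_mul_exp_le (z := y - L) (w := x - L) hε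
  unfold layer
  rw [sub_sub_sub_cancel_right] at this
  have h2 := mul_le_mul_of_nonneg_left this (inv_pos.2 hε).le
  rw [← mul_assoc, ← mul_assoc, inv_mul_cancel₀ hε.ne', one_mul] at h2
  linarith

lemma layer_sub_le {L ε x y : ℝ} (hε : 0 < ε) :
    layer L ε x - layer L ε y ≤ (x - y) * (ε⁻¹ * layer L ε x) := by
  have := sub_mul_layer_le (L := L) (x := y) (y := x) hε
  linarith

lemma mul_cornerLayer_le {L α ε x t s : ℝ} (hε : 0 < ε) :
    α * (t - s) * (ε⁻¹ * cornerLayer L α ε x t) ≤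
      cornerLayer L α ε x s - cornerLayer L α ε x t := by
  have := sub_mul_layer_le (L := L) (x := x - α * s) (y := x - α * t) hε
  unfold layer at this
  unfold cornerLayer
  linarith

lemma cornerLayer_sub_le {L α ε x t s : ℝ} (hε : 0 < ε) :
    cornerLayer L α ε x s - cornerLayer L α ε x t ≤
      α * (t - s) * (ε⁻¹ * cornerLayer L α ε x s) := by
  have := mul_cornerLayer_le (L := L) (α := α) (x := x) (t := s) (s := t) hε
  linarith

lemma cornerLayer_le_layer (L : ℝ) {α ε x t : ℝ} (hε : 0 < ε) (hα : 0 ≤ α) (ht : 0 ≤ t) :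
    cornerLayer L α ε x t ≤ layer L ε x := by
  rw [← cornerLayer_zero L α]
  exact cornerLayer_le L hε (by nlinarith)

lemma continuous_cornerLayer (L α ε x : ℝ) : Continuous (cornerLayer L α ε x) := by
  unfold cornerLayer; fun_prop

lemma continuous_layer (L ε : ℝ) : Continuous (layer L ε) := by
  unfold layer; fun_prop

lemma hasDerivAt_cornerLayer (L α ε x t : ℝ) :
    HasDerivAt (cornerLayer L α ε x) (-(α * (ε⁻¹ * cornerLayer L α ε x t))) t := by
  have h := (((((hasDerivAt_id t).const_mul α).const_sub x).sub_const L).div_const ε).exp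
  have e : -(α * (ε⁻¹ * cornerLayer L α ε x t)) =
    Real.exp ((x - α * id t - L) / ε) * (-(α * 1) / ε) := by
    simp only [cornerLayer, id]; ring
  rw [e]
  exact h

/-- An increment bound from a bound on the derivative in the open interval. -/
lemma abs_sub_le_of_deriv_le {y G : ℝ → ℝ} {p x : ℝ} (hpx : p ≤ x)
    (hy : ContinuousOn y (Icc p x)) (hG : ContinuousOn G (Icc p x))
    (hd : ∀ r ∈ Ioo p x, ∃ y' G', HasDerivAt y y' r ∧ HasDerivAt G G' r ∧ |y'| ≤ G') :
    |y x - y p| ≤ G x - G p := by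
  have := abs_le_of_damped (y := fun r => y r - y p) hpx (hy.sub continuousOn_const) hG
    (fun r hr => by
      obtain ⟨y', G', h1, h2, h3⟩ := hd r hr
      exact ⟨y', G', 0, h1.sub_const _, h2, le_rfl, by simpa using h3⟩)
  simpa using this

lemma tendsto_left_quotient {v : ℝ → ℝ} {v' t T : ℝ} (ht : t ∈ Ioc 0 T)
    (h : HasDerivWithinAt v v' (Icc 0 T) t) :
    Tendsto (fun s => (v t - v s) / (t - s)) (𝓝[<] t) (𝓝 v') := by
  have h1 : HasDerivWithinAt v v' (Iio t) t := by
    refine h.mono_of_mem_nhdsWithin ?_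
    filter_upwards [Ioo_mem_nhdsLT ht.1] with s hs
    exact ⟨hs.1.le, hs.2.le.trans ht.2⟩
  have h2 := hasDerivWithinAt_iff_tendsto_slope.1 h1
  rw [sdiff_singleton_eq_self (by simp)] at h2
  refine h2.congr fun s => ?_
  rw [slope_def_field, ← neg_sub (v t), ← neg_sub t s, neg_div_neg_eq]

/-- A transport problem whose solution has the partial derivatives `ux`, `ut` in
`(0,L] × (0,T]` and satisfies the equation there, with data that are Lipschitz in `x`. -/
structure ClassicalProblem (L T α Λ ε : ℝ) (q c F : ℝ → ℝ → ℝ) (φ φ' g g' ψ : ℝ → ℝ)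
    (u ux ut : ℝ → ℝ → ℝ) : Prop extends TransportProblem L T α Λ ε q c F φ φ' g g' ψ u where
  ux_deriv : ∀ x ∈ Ioc 0 L, ∀ t ∈ Ioc 0 T, HasDerivWithinAt (fun r => u r t) (ux x t) (Icc 0 L) x
  ut_deriv : ∀ x ∈ Ioc 0 L, ∀ t ∈ Ioc 0 T, HasDerivWithinAt (u x) (ut x t) (Icc 0 T) t
  equation : ∀ x ∈ Ioc 0 L, ∀ t ∈ Ioc 0 T, ux x t + q x t * ut x t + c x t * u x t = F x t
  q_lip : ∀ x ∈ Icc 0 L, ∀ y ∈ Icc 0 L, ∀ t ∈ Icc 0 T, |q x t - q y t| ≤ Λ * |x - y|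
  c_lip : ∀ x ∈ Icc 0 L, ∀ y ∈ Icc 0 L, ∀ t ∈ Icc 0 T, |c x t - c y t| ≤ Λ * |x - y|
  F_lip : ∀ x ∈ Icc 0 L, ∀ y ∈ Icc 0 L, ∀ t ∈ Icc 0 T, y ≤ x →
    |F x t - F y t| ≤ Λ * (ε⁻¹ * (layer L ε x - layer L ε y))

/-- The bounds on the solution that the error analysis uses: Taylor remainders in `t` and in `x`,
a bound for `u_x`, and increments of `u`. -/
structure LayerBounds (L T α K ε : ℝ) (u ux ut : ℝ → ℝ → ℝ) : Prop where
  taylor_t : ∀ x ∈ Ioc 0 L, ∀ s t, 0 ≤ s → s < t → t ≤ T → |u x t - u x s - (t - s) * ut x t| ≤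
    (t - s) * (K * ((t - s) + ε⁻¹ * (cornerLayer L α ε x s - cornerLayer L α ε x t)))
  taylor_x : ∀ t ∈ Ioc 0 T, ∀ y x, 0 ≤ y → y < x → x ≤ L → |u x t - u y t - (x - y) * ux x t| ≤
    (x - y) * (K * ((x - y) + ε⁻¹ * (layer L ε x - layer L ε y)))
  ux_bound : ∀ x ∈ Ioc 0 L, ∀ t ∈ Ioc 0 T, |ux x t| ≤ K * (1 + ε⁻¹ * layer L ε x)
  lip_x : ∀ t ∈ Icc 0 T, ∀ y x, 0 ≤ y → y ≤ x → x ≤ L →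
    |u x t - u y t| ≤ K * ((x - y) + (layer L ε x - layer L ε y))
  lip_t : ∀ x ∈ Icc 0 L, ∀ s t, 0 ≤ s → s ≤ t → t ≤ T →
    |u x t - u x s| ≤ K * ((t - s) + (cornerLayer L α ε x s - cornerLayer L α ε x t))

namespace ClassicalProblem

lemma continuousOn_t {L T α Λ ε : ℝ} {q c F : ℝ → ℝ → ℝ} {φ φ' g g' ψ : ℝ → ℝ}
    {u ux ut : ℝ → ℝ → ℝ} (P : ClassicalProblem L T α Λ ε q c F φ φ' g g' ψ u ux ut) {x : ℝ}
    (hx : x ∈ Icc 0 L) : ContinuousOn (u x) (Icc 0 T) :=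
  P.u_cont.comp (f := fun t => (x, t)) (by fun_prop) (fun _ ht => ⟨hx, ht⟩)

lemma continuousOn_x {L T α Λ ε : ℝ} {q c F : ℝ → ℝ → ℝ} {φ φ' g g' ψ : ℝ → ℝ}
    {u ux ut : ℝ → ℝ → ℝ} (P : ClassicalProblem L T α Λ ε q c F φ φ' g g' ψ u ux ut) {t : ℝ}
    (ht : t ∈ Icc 0 T) : ContinuousOn (fun x => u x t) (Icc 0 L) :=
  P.u_cont.comp (f := fun x => (x, t)) (by fun_prop) (fun _ hx => ⟨hx, ht⟩)

lemma abs_ut_le : ∀ L T α Λ : ℝ, ∃ K, 0 ≤ K ∧ ∀ {ε : ℝ} {q c F : ℝ → ℝ → ℝ}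
    {φ φ' g g' ψ : ℝ → ℝ} {u ux ut : ℝ → ℝ → ℝ},
    ClassicalProblem L T α Λ ε q c F φ φ' g g' ψ u ux ut →
    ∀ x ∈ Ioc 0 L, ∀ t ∈ Ioc 0 T, |ut x t| ≤ K * (1 + ε⁻¹ * cornerLayer L α ε x t) := by
  intro L T α Λ
  obtain ⟨K, hK, H⟩ := TransportProblem.abs_sub_time_le L T α Λ
  refine ⟨K, hK, fun {ε q c F φ φ' g g' ψ u ux ut} P x hx t ht => ?_⟩
  have h1 := (tendsto_left_quotient ht (P.ut_deriv x hx t ht)).abs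
  have hc : Continuous fun s => K * (1 + ε⁻¹ * cornerLayer L α ε x s) := by
    have := continuous_cornerLayer L α ε x
    fun_prop
  refine le_of_tendsto_of_tendsto h1 ((hc.tendsto t).mono_left nhdsWithin_le_nhds) ?_
  filter_upwards [Ioo_mem_nhdsLT ht.1] with s hs
  have h2 : 0 < t - s := by linarith [hs.2]
  rw [abs_div, abs_of_pos h2, div_le_iff₀ h2]
  have := H P.toTransportProblem x ⟨hx.1.le, hx.2⟩ t s hs.1.le hs.2.le ht.2
  linarith

/-- Increments of `u_t` in time, from second differences. The bound is itself an increment, that of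
`r - ε⁻¹ cornerLayer r` up to constants, so that it loses nothing on long intervals. -/
lemma abs_ut_sub_le : ∀ L T α Λ : ℝ, ∃ K, 0 ≤ K ∧ ∀ {ε : ℝ} {q c F : ℝ → ℝ → ℝ}
    {φ φ' g g' ψ : ℝ → ℝ} {u ux ut : ℝ → ℝ → ℝ},
    ClassicalProblem L T α Λ ε q c F φ φ' g g' ψ u ux ut →
    ∀ x ∈ Ioc 0 L, ∀ s ∈ Ioc 0 T, ∀ t ∈ Ioc 0 T, s ≤ t → |ut x t - ut x s| ≤
      K * ((t - s) + ε⁻¹ * (cornerLayer L α ε x s - cornerLayer L α ε x t)) := by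
  intro L T α Λ
  obtain ⟨K, hK, H⟩ := TransportProblem.abs_second_difference_le L T α Λ
  refine ⟨K * (1 + |α⁻¹|), by positivity, fun {ε q c F φ φ' g g' ψ u ux ut} P x hx s hs t ht hst => ?_⟩
  have hε := P.ε_pos
  have hα := P.α_pos
  rw [abs_of_pos (inv_pos.2 hα)]
  rcases hst.eq_or_lt with rfl | hst
  · simp
  have hx' : x ∈ Icc 0 L := ⟨hx.1.le, hx.2⟩
  have hsub : Icc s t ⊆ Icc 0 T := Icc_subset_Icc hs.1.le ht.2
  have hcl := continuous_cornerLayer L α ε x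
  have := abs_deriv_sub_le_of_second_difference (v := u x)
    (Γ := fun r => K * (r - α⁻¹ * (ε⁻¹ * cornerLayer L α ε x r))) hst (by fun_prop)
    ((P.ut_deriv x hx s hs).mono hsub) ((P.ut_deriv x hx t ht).mono hsub)
    (fun h hh r hr hrt => by
      refine (H P.toTransportProblem x hx' r h (hs.1.le.trans hr) hh.le (hrt.trans ht.2)).trans ?_
      have h1 := mul_cornerLayer_le (L := L) (α := α) (x := x) (t := r) (s := r - h) hε
      rw [sub_sub_cancel] at h1
      have h2 := mul_le_mul_of_nonneg_left h1 (show 0 ≤ α⁻¹ * ε⁻¹ by positivity)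
      have e : α⁻¹ * ε⁻¹ * (α * h * (ε⁻¹ * cornerLayer L α ε x r)) =
          h * (ε⁻¹ ^ 2 * cornerLayer L α ε x r) := by
        field_simp
      rw [e] at h2
      have h3 := mul_le_mul_of_nonneg_left h2 (mul_nonneg hh.le hK)
      linarith)
  refine this.trans ?_
  have h1 : 0 ≤ cornerLayer L α ε x s - cornerLayer L α ε x t := by
    rw [sub_nonneg]; exact cornerLayer_le L hε (by nlinarith)
  have h2 : 0 ≤ K * (α⁻¹ * (t - s)) :=
    mul_nonneg hK (mul_nonneg (inv_pos.2 hα).le (by linarith))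
  have h3 : 0 ≤ K * (ε⁻¹ * (cornerLayer L α ε x s - cornerLayer L α ε x t)) := by positivity
  linarith

lemma abs_ut_sub_le_mul : ∀ L T α Λ : ℝ, ∃ K, 0 ≤ K ∧ ∀ {ε : ℝ} {q c F : ℝ → ℝ → ℝ}
    {φ φ' g g' ψ : ℝ → ℝ} {u ux ut : ℝ → ℝ → ℝ},
    ClassicalProblem L T α Λ ε q c F φ φ' g g' ψ u ux ut →
    ∀ x ∈ Ioc 0 L, ∀ s ∈ Ioc 0 T, ∀ t ∈ Ioc 0 T, s ≤ t → |ut x t - ut x s| ≤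
      K * ((t - s) * (1 + ε⁻¹ ^ 2 * layer L ε x)) := by
  intro L T α Λ
  obtain ⟨K, hK, H⟩ := abs_ut_sub_le L T α Λ
  refine ⟨K * (1 + |α|), by positivity, fun {ε q c F φ φ' g g' ψ u ux ut} P x hx s hs t ht hst => ?_⟩
  have hε := P.ε_pos
  have hα := P.α_pos
  have hl := layer_pos L ε x
  have hts : 0 ≤ t - s := by linarith
  rw [abs_of_pos hα, mul_assoc]
  refine (H P x hx s hs t ht hst).trans (mul_le_mul_of_nonneg_left ?_ hK)
  have h1 := cornerLayer_sub_le (L := L) (α := α) (x := x) (t := t) (s := s) hε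
  have h2 := cornerLayer_le_layer L (x := x) hε hα.le hs.1.le
  have h3 : α * (t - s) * (ε⁻¹ * cornerLayer L α ε x s) ≤ α * (t - s) * (ε⁻¹ * layer L ε x) := by
    gcongr
  have h4 := mul_le_mul_of_nonneg_left (h1.trans h3) (inv_pos.2 hε).le
  have h5 : 0 ≤ α * (t - s) := by positivity
  have h6 : 0 ≤ (t - s) * (ε⁻¹ ^ 2 * layer L ε x) := by positivity
  linarith

/-- The bound for `u_x` follows from that for `u_t` through the equation. -/
lemma abs_ux_le : ∀ L T α Λ : ℝ, ∃ K, 0 ≤ K ∧ ∀ {ε : ℝ} {q c F : ℝ → ℝ → ℝ}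
    {φ φ' g g' ψ : ℝ → ℝ} {u ux ut : ℝ → ℝ → ℝ},
    ClassicalProblem L T α Λ ε q c F φ φ' g g' ψ u ux ut →
    ∀ x ∈ Ioc 0 L, ∀ t ∈ Ioc 0 T, |ux x t| ≤ K * (1 + ε⁻¹ * layer L ε x) := by
  intro L T α Λ
  obtain ⟨K, hK, H⟩ := abs_ut_le L T α Λ
  refine ⟨|Λ| + 2 * Λ ^ 2 + |α⁻¹| * K, by positivity, fun {ε q c F φ φ' g g' ψ u ux ut} P x hx t ht => ?_⟩
  have hε := P.ε_pos
  have hα := P.α_pos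
  have hΛ : 0 < Λ := by linarith [P.Λ_ge]
  rw [abs_of_pos hΛ, abs_of_pos (inv_pos.2 hα)]
  have hx' : x ∈ Icc 0 L := ⟨hx.1.le, hx.2⟩
  have ht' : t ∈ Icc 0 T := ⟨ht.1.le, ht.2⟩
  have hl := layer_pos L ε x
  have e : ux x t = F x t + (-(c x t * u x t)) + (-(q x t * ut x t)) := by
    linarith [P.equation x hx t ht]
  rw [e]
  refine (abs_add_three _ _ _).trans ?_
  rw [abs_neg, abs_neg, abs_mul, abs_mul]
  have q0 : 0 ≤ q x t := (inv_pos.2 hΛ).le.trans (P.q_lower x hx' t ht')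
  rw [abs_of_nonneg q0, abs_of_nonneg (P.c_nonneg x hx' t ht')]
  have i1 := P.F_bound x hx' t ht'
  have i2 := mul_le_mul (P.c_le x hx' t ht') (P.abs_solution_le hx' ht') (abs_nonneg _) hΛ.le
  have i3 : q x t * |ut x t| ≤ α⁻¹ * (K * (1 + ε⁻¹ * layer L ε x)) := by
    refine mul_le_mul (P.q_upper x hx' t ht') ((H P x hx t ht).trans ?_) (abs_nonneg _) (by positivity)
    have := cornerLayer_le_layer L (x := x) hε hα.le ht'.1
    gcongr
  have i4 : 0 ≤ Λ * (2 * Λ) * (ε⁻¹ * layer L ε x) := by positivity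
  linarith

lemma abs_ux_sub_time_le : ∀ L T α Λ : ℝ, ∃ K, 0 ≤ K ∧ ∀ {ε : ℝ} {q c F : ℝ → ℝ → ℝ}
    {φ φ' g g' ψ : ℝ → ℝ} {u ux ut : ℝ → ℝ → ℝ},
    ClassicalProblem L T α Λ ε q c F φ φ' g g' ψ u ux ut →
    ∀ x ∈ Ioc 0 L, ∀ s ∈ Ioc 0 T, ∀ t ∈ Ioc 0 T, s ≤ t → |ux x t - ux x s| ≤
      K * ((t - s) * (1 + ε⁻¹ ^ 2 * layer L ε x)) := by
  intro L T α Λ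
  obtain ⟨K₃, hK₃, H₃⟩ := TransportProblem.abs_sub_time_le L T α Λ
  obtain ⟨K₆, hK₆, H₆⟩ := abs_ut_le L T α Λ
  obtain ⟨K₇, hK₇, H₇⟩ := abs_ut_sub_le_mul L T α Λ
  refine ⟨|Λ| + 2 * Λ ^ 2 + |Λ| * K₃ + |Λ| * K₆ + |α⁻¹| * K₇, by positivity,
    fun {ε q c F φ φ' g g' ψ u ux ut} P x hx s hs t ht hst => ?_⟩
  have hε := P.ε_pos
  have hα := P.α_pos
  have hΛ : 0 < Λ := by linarith [P.Λ_ge]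
  have hε1 : 1 ≤ ε⁻¹ := (one_le_inv₀ hε).2 P.ε_le
  rw [abs_of_pos hΛ, abs_of_pos (inv_pos.2 hα)]
  have hx' : x ∈ Icc 0 L := ⟨hx.1.le, hx.2⟩
  have ht' : t ∈ Icc 0 T := ⟨ht.1.le, ht.2⟩
  have hs' : s ∈ Icc 0 T := ⟨hs.1.le, hs.2⟩
  have hl := layer_pos L ε x
  have hts : 0 ≤ t - s := by linarith
  set V := 1 + ε⁻¹ ^ 2 * layer L ε x with hV
  have hee : ε⁻¹ * layer L ε x ≤ ε⁻¹ ^ 2 * layer L ε x := by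
    rw [sq, mul_assoc]; exact le_mul_of_one_le_left (by positivity) hε1
  have hV1 : 1 ≤ V := by rw [hV]; linarith [show 0 ≤ ε⁻¹ ^ 2 * layer L ε x by positivity]
  have hcl : 1 + ε⁻¹ * cornerLayer L α ε x s ≤ V := by
    have := cornerLayer_le_layer L (x := x) hε hα.le hs'.1
    have : ε⁻¹ * cornerLayer L α ε x s ≤ ε⁻¹ * layer L ε x := by gcongr
    linarith
  have e : ux x t - ux x s = ((F x t - F x s) + (-((c x t - c x s) * u x t)) +
      (-(c x s * (u x t - u x s)))) + (-((q x t - q x s) * ut x s)) +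
      (-(q x t * (ut x t - ut x s))) := by
    linear_combination P.equation x hx t ht - P.equation x hx s hs
  rw [e]
  refine (abs_add_three _ _ _).trans ((add_le_add (add_le_add (abs_add_three _ _ _) le_rfl)
    le_rfl).trans ?_)
  simp only [abs_neg, abs_mul]
  have q0 : 0 ≤ q x t := (inv_pos.2 hΛ).le.trans (P.q_lower x hx' t ht')
  rw [abs_of_nonneg q0, abs_of_nonneg (P.c_nonneg x hx' s hs')]
  have i1 := (P.F_second x hx').lip s hs' t ht'
  have i2 := mul_le_mul ((P.c_second x hx').lip s hs' t ht') (P.abs_solution_le hx' ht')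
    (abs_nonneg _) (by positivity)
  have i3 := mul_le_mul (P.c_le x hx' s hs')
    (H₃ P.toTransportProblem x hx' t s hs'.1 hst ht'.2) (abs_nonneg _) hΛ.le
  have i4 := mul_le_mul ((P.q_second x hx').lip s hs' t ht') (H₆ P x hx s hs)
    (abs_nonneg _) (by positivity)
  have i5 := mul_le_mul (P.q_upper x hx' t ht') (H₇ P x hx s hs t ht hst) (abs_nonneg _)
    (inv_pos.2 hα).le
  rw [abs_of_nonneg hts] at i1 i2 i4
  have j1 : Λ * (ε⁻¹ * layer L ε x) * (t - s) ≤ Λ * V * (t - s) := by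
    gcongr; linarith
  have j2 : Λ * (t - s) * (2 * Λ) ≤ Λ * (t - s) * (2 * Λ) * V :=
    le_mul_of_one_le_right (by positivity) hV1
  have j3 : Λ * (K₃ * (t - s) * (1 + ε⁻¹ * cornerLayer L α ε x s)) ≤ Λ * (K₃ * (t - s) * V) := by
    gcongr
  have j4 : Λ * (t - s) * (K₆ * (1 + ε⁻¹ * cornerLayer L α ε x s)) ≤ Λ * (t - s) * (K₆ * V) := by
    gcongr
  linarith

/-- The dependence of `u_t` on `x`, obtained by exchanging the order of differences: the increment
of `u(r,t) - u(r,s)` in `r` is controlled by the increment of `u_x` in time. -/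
lemma abs_ut_sub_space_le : ∀ L T α Λ : ℝ, ∃ K, 0 ≤ K ∧ ∀ {ε : ℝ} {q c F : ℝ → ℝ → ℝ}
    {φ φ' g g' ψ : ℝ → ℝ} {u ux ut : ℝ → ℝ → ℝ},
    ClassicalProblem L T α Λ ε q c F φ φ' g g' ψ u ux ut →
    ∀ t ∈ Ioc 0 T, ∀ y ∈ Ioc 0 L, ∀ x ∈ Ioc 0 L, y ≤ x → |ut x t - ut y t| ≤
      K * ((x - y) + ε⁻¹ * (layer L ε x - layer L ε y)) := by
  intro L T α Λ
  obtain ⟨K, hK, H⟩ := abs_ux_sub_time_le L T α Λ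
  refine ⟨K, hK, fun {ε q c F φ φ' g g' ψ u ux ut} P t ht y hy x hx hyx => ?_⟩
  have h1 := ((tendsto_left_quotient ht (P.ut_deriv x hx t ht)).sub
    (tendsto_left_quotient ht (P.ut_deriv y hy t ht))).abs
  refine le_of_tendsto h1 ?_
  filter_upwards [Ioo_mem_nhdsLT ht.1] with s hs
  have h2 : 0 < t - s := by linarith [hs.2]
  have hs' : s ∈ Ioc 0 T := ⟨hs.1, hs.2.le.trans ht.2⟩
  rw [← sub_div, abs_div, abs_of_pos h2, div_le_iff₀ h2]
  have hsub : Icc y x ⊆ Icc 0 L := Icc_subset_Icc hy.1.le hx.2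
  have hl := continuous_layer L ε
  have := abs_sub_le_of_deriv_le (y := fun r => u r t - u r s)
    (G := fun r => K * (t - s) * (r + ε⁻¹ * layer L ε r)) hyx
    (((P.continuousOn_x ⟨ht.1.le, ht.2⟩).sub (P.continuousOn_x ⟨hs'.1.le, hs'.2⟩)).mono hsub)
    (by fun_prop) (fun r hr => by
      have hrL : r ∈ Ioc 0 L := ⟨hy.1.trans hr.1, hr.2.le.trans hx.2⟩
      have hn : Icc 0 L ∈ 𝓝 r := Icc_mem_nhds hrL.1 (hr.2.trans_le hx.2)
      refine ⟨_, _, ((P.ux_deriv r hrL t ht).hasDerivAt hn).sub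
        ((P.ux_deriv r hrL s hs').hasDerivAt hn), ((hasDerivAt_id r).add
          ((hasDerivAt_layer L ε r).const_mul ε⁻¹)).const_mul _, ?_⟩
      refine (H P r hrL s hs' t ht hs.2.le).trans (le_of_eq ?_)
      ring)
  rw [show u x t - u x s - (u y t - u y s) = (u x t - u x s) - (u y t - u y s) by ring]
  linarith

lemma abs_sub_space_le : ∀ L T α Λ : ℝ, ∃ K, 0 ≤ K ∧ ∀ {ε : ℝ} {q c F : ℝ → ℝ → ℝ}
    {φ φ' g g' ψ : ℝ → ℝ} {u ux ut : ℝ → ℝ → ℝ},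
    ClassicalProblem L T α Λ ε q c F φ φ' g g' ψ u ux ut →
    ∀ t ∈ Icc 0 T, ∀ y x, 0 ≤ y → y ≤ x → x ≤ L →
      |u x t - u y t| ≤ K * ((x - y) + (layer L ε x - layer L ε y)) := by
  intro L T α Λ
  obtain ⟨K, hK, H⟩ := abs_ux_le L T α Λ
  refine ⟨K + |Λ|, by positivity, fun {ε q c F φ φ' g g' ψ u ux ut} P t ht y x hy hyx hx => ?_⟩
  have hε := P.ε_pos
  have hΛ : 0 < Λ := by linarith [P.Λ_ge]
  rw [abs_of_pos hΛ]
  have hsub : Icc y x ⊆ Icc 0 L := Icc_subset_Icc hy hx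
  have hl := continuous_layer L ε
  have h2 := abs_sub_le_of_deriv_le (y := fun r => u r t)
    (G := fun r => (K + Λ) * (r + layer L ε r)) hyx ((P.continuousOn_x ht).mono hsub)
    (by fun_prop) (fun r hr => by
      have hrL : r ∈ Ioo 0 L := ⟨hy.trans_lt hr.1, hr.2.trans_le hx⟩
      have hG := (((hasDerivAt_id r).add (hasDerivAt_layer L ε r)).const_mul (K + Λ))
      have hw : 0 < ε⁻¹ * layer L ε r := mul_pos (by positivity) (layer_pos _ _ _)
      rcases ht.1.eq_or_lt with rfl | ht0
      · have hd : HasDerivAt (fun r => u r 0) (φ' r) r :=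
          (P.φ_deriv r hrL).congr_of_eventuallyEq (by
            filter_upwards [Icc_mem_nhds hrL.1 hrL.2] with z hz using P.initial z hz)
        refine ⟨_, _, hd, hG, (P.φ'_bound r ⟨hrL.1.le, hrL.2.le⟩).trans ?_⟩
        nlinarith [mul_nonneg hK hw.le, mul_pos hΛ hw]
      · have hn : Icc 0 L ∈ 𝓝 r := Icc_mem_nhds hrL.1 hrL.2
        refine ⟨_, _, (P.ux_deriv r ⟨hrL.1, hrL.2.le⟩ t ⟨ht0, ht.2⟩).hasDerivAt hn, hG,
          (H P r ⟨hrL.1, hrL.2.le⟩ t ⟨ht0, ht.2⟩).trans ?_⟩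
        nlinarith [mul_pos hΛ hw])
  refine h2.trans (le_of_eq ?_)
  ring

lemma abs_sub_time_le : ∀ L T α Λ : ℝ, ∃ K, 0 ≤ K ∧ ∀ {ε : ℝ} {q c F : ℝ → ℝ → ℝ}
    {φ φ' g g' ψ : ℝ → ℝ} {u ux ut : ℝ → ℝ → ℝ},
    ClassicalProblem L T α Λ ε q c F φ φ' g g' ψ u ux ut →
    ∀ x ∈ Icc 0 L, ∀ s t, 0 ≤ s → s ≤ t → t ≤ T →
      |u x t - u x s| ≤ K * ((t - s) + (cornerLayer L α ε x s - cornerLayer L α ε x t)) := by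
  intro L T α Λ
  obtain ⟨K, hK, H⟩ := abs_ut_le L T α Λ
  refine ⟨K * (1 + |α⁻¹|) + |Λ|, by positivity,
    fun {ε q c F φ φ' g g' ψ u ux ut} P x hx s t hs hst ht => ?_⟩
  have hε := P.ε_pos
  have hα := P.α_pos
  have hΛ : 0 < Λ := by linarith [P.Λ_ge]
  rw [abs_of_pos hΛ, abs_of_pos (inv_pos.2 hα)]
  have hts : 0 ≤ t - s := by linarith
  have hcl : 0 ≤ cornerLayer L α ε x s - cornerLayer L α ε x t := by
    rw [sub_nonneg]; exact cornerLayer_le L hε (by nlinarith)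
  rcases hx.1.eq_or_lt with rfl | hx0
  · rw [P.inflow t ⟨hs.trans hst, ht⟩, P.inflow s ⟨hs, hst.trans ht⟩]
    have := P.ψ_second.lip s ⟨hs, hst.trans ht⟩ t ⟨hs.trans hst, ht⟩
    rw [abs_of_nonneg hts] at this
    refine this.trans ?_
    have : 0 ≤ K * (1 + α⁻¹) * ((t - s) + (cornerLayer L α ε 0 s - cornerLayer L α ε 0 t)) := by
      positivity
    nlinarith [mul_nonneg hΛ.le hcl]
  · have hxI : x ∈ Ioc 0 L := ⟨hx0, hx.2⟩
    have hsub : Icc s t ⊆ Icc 0 T := Icc_subset_Icc hs ht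
    have hcc := continuous_cornerLayer L α ε x
    have h2 := abs_sub_le_of_deriv_le (y := u x)
      (G := fun r => K * (r - α⁻¹ * cornerLayer L α ε x r)) hst ((P.continuousOn_t hx).mono hsub)
      (by fun_prop) (fun r hr => by
        have hrT : r ∈ Ioc 0 T := ⟨hs.trans_lt hr.1, hr.2.le.trans ht⟩
        have hn : Icc 0 T ∈ 𝓝 r := Icc_mem_nhds hrT.1 (hr.2.trans_le ht)
        refine ⟨_, _, (P.ut_deriv x hxI r hrT).hasDerivAt hn, ((hasDerivAt_id r).sub
          ((hasDerivAt_cornerLayer L α ε x r).const_mul α⁻¹)).const_mul K, ?_⟩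
        refine (H P x hxI r hrT).trans (le_of_eq ?_)
        field_simp
        ring)
    refine h2.trans ?_
    have h3 : 0 ≤ K * (α⁻¹ * (t - s)) := by positivity
    have h4 : 0 ≤ K * (cornerLayer L α ε x s - cornerLayer L α ε x t) := by positivity
    have h5 := mul_nonneg hΛ.le (add_nonneg hts hcl)
    linarith

/-- Increments of `u_x` in space, from those of `u_t` through the equation. -/
lemma abs_ux_sub_space_le : ∀ L T α Λ : ℝ, ∃ K, 0 ≤ K ∧ ∀ {ε : ℝ} {q c F : ℝ → ℝ → ℝ}
    {φ φ' g g' ψ : ℝ → ℝ} {u ux ut : ℝ → ℝ → ℝ},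
    ClassicalProblem L T α Λ ε q c F φ φ' g g' ψ u ux ut →
    ∀ t ∈ Ioc 0 T, ∀ y ∈ Ioc 0 L, ∀ x ∈ Ioc 0 L, y ≤ x → |ux x t - ux y t| ≤
      K * ((x - y) + ε⁻¹ * (layer L ε x - layer L ε y)) := by
  intro L T α Λ
  obtain ⟨K₆, hK₆, H₆⟩ := abs_ut_le L T α Λ
  obtain ⟨K₁, hK₁, H₁⟩ := abs_ut_sub_space_le L T α Λ
  obtain ⟨K₂, hK₂, H₂⟩ := abs_sub_space_le L T α Λ
  refine ⟨|Λ| + 2 * Λ ^ 2 + |Λ| * K₂ + |Λ| * K₆ + |α⁻¹| * K₁, by positivity,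
    fun {ε q c F φ φ' g g' ψ u ux ut} P t ht y hy x hx hyx => ?_⟩
  have hε := P.ε_pos
  have hα := P.α_pos
  have hΛ : 0 < Λ := by linarith [P.Λ_ge]
  have hε1 : 1 ≤ ε⁻¹ := (one_le_inv₀ hε).2 P.ε_le
  rw [abs_of_pos hΛ, abs_of_pos (inv_pos.2 hα)]
  have hx' : x ∈ Icc 0 L := ⟨hx.1.le, hx.2⟩
  have hy' : y ∈ Icc 0 L := ⟨hy.1.le, hy.2⟩
  have ht' : t ∈ Icc 0 T := ⟨ht.1.le, ht.2⟩
  have hxy : 0 ≤ x - y := by linarith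
  set δ := layer L ε x - layer L ε y with hδ
  have hδ0 : 0 ≤ δ := sub_nonneg.2 (layer_mono hε hyx)
  have hδε : δ ≤ ε⁻¹ * δ := le_mul_of_one_le_left hδ0 hε1
  set V := (x - y) + ε⁻¹ * δ with hV
  have e : ux x t - ux y t = ((F x t - F y t) + (-((c x t - c y t) * u x t)) +
      (-(c y t * (u x t - u y t)))) + (-((q x t - q y t) * ut y t)) +
      (-(q x t * (ut x t - ut y t))) := by
    linear_combination P.equation x hx t ht - P.equation y hy t ht
  rw [e]
  refine (abs_add_three _ _ _).trans ((add_le_add (add_le_add (abs_add_three _ _ _) le_rfl)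
    le_rfl).trans ?_)
  simp only [abs_neg, abs_mul]
  have q0 : 0 ≤ q x t := (inv_pos.2 hΛ).le.trans (P.q_lower x hx' t ht')
  rw [abs_of_nonneg q0, abs_of_nonneg (P.c_nonneg y hy' t ht')]
  have i1 := P.F_lip x hx' y hy' t ht' hyx
  have i2 := mul_le_mul (P.c_lip x hx' y hy' t ht') (P.abs_solution_le hx' ht')
    (abs_nonneg _) (by positivity)
  have i3 := mul_le_mul (P.c_le y hy' t ht') (H₂ P t ht' y x hy'.1 hyx hx'.2) (abs_nonneg _) hΛ.le
  have i4 := mul_le_mul (P.q_lip x hx' y hy' t ht') (H₆ P y hy t ht)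
    (abs_nonneg _) (by positivity)
  have i5 := mul_le_mul (P.q_upper x hx' t ht') (H₁ P t ht y hy x hx hyx) (abs_nonneg _)
    (inv_pos.2 hα).le
  rw [abs_of_nonneg hxy] at i2 i4
  have j1 : Λ * (ε⁻¹ * δ) ≤ Λ * V := by gcongr; linarith
  have j2 : Λ * (x - y) * (2 * Λ) ≤ Λ * V * (2 * Λ) := by
    gcongr; linarith [show 0 ≤ ε⁻¹ * δ by positivity]
  have j3 : Λ * (K₂ * ((x - y) + δ)) ≤ Λ * (K₂ * V) := by gcongr; linarith
  have j4 : Λ * (x - y) * (K₆ * (1 + ε⁻¹ * cornerLayer L α ε y t)) ≤ Λ * K₆ * V := by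
    have k1 := cornerLayer_le_layer L (x := y) hε hα.le ht'.1
    have k2 := sub_mul_layer_le (L := L) (x := x) (y := y) hε
    have k3 : (x - y) * (ε⁻¹ * cornerLayer L α ε y t) ≤ (x - y) * (ε⁻¹ * layer L ε y) := by gcongr
    have k4 : (x - y) * (1 + ε⁻¹ * cornerLayer L α ε y t) ≤ V := by linarith
    have := mul_le_mul_of_nonneg_left k4 (mul_nonneg hΛ.le hK₆)
    linarith
  linarith

/-- The regularity of the solution, with constants independent of `ε`. The Taylor remainders come from
integrating the increments of `u_t` and `u_x`. -/
theorem exists_layerBounds : ∀ L T α Λ : ℝ, ∃ K, 0 ≤ K ∧ ∀ {ε : ℝ} {q c F : ℝ → ℝ → ℝ}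
    {φ φ' g g' ψ : ℝ → ℝ} {u ux ut : ℝ → ℝ → ℝ},
    ClassicalProblem L T α Λ ε q c F φ φ' g g' ψ u ux ut → LayerBounds L T α K ε u ux ut := by
  intro L T α Λ
  obtain ⟨K₁, hK₁, H₁⟩ := abs_ut_sub_le L T α Λ
  obtain ⟨K₂, hK₂, H₂⟩ := abs_ux_sub_space_le L T α Λ
  obtain ⟨K₃, hK₃, H₃⟩ := abs_ux_le L T α Λ
  obtain ⟨K₄, hK₄, H₄⟩ := abs_sub_space_le L T α Λ
  obtain ⟨K₅, hK₅, H₅⟩ := abs_sub_time_le L T α Λ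
  refine ⟨K₁ + K₂ + K₃ + K₄ + K₅, by positivity, fun {ε q c F φ φ' g g' ψ u ux ut} P => ?_⟩
  set K := K₁ + K₂ + K₃ + K₄ + K₅ with hK
  have hε := P.ε_pos
  have hα := P.α_pos
  refine ⟨fun x hx s t hs hst ht => ?_, fun t ht y x hy hyx hx => ?_, fun x hx t ht => ?_,
    fun t ht y x hy hyx hx => ?_, fun x hx s t hs hst ht => ?_⟩
  · have hx' : x ∈ Icc 0 L := ⟨hx.1.le, hx.2⟩
    have htI : t ∈ Ioc 0 T := ⟨hs.trans_lt hst, ht⟩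
    set C := K * ((t - s) + ε⁻¹ * (cornerLayer L α ε x s - cornerLayer L α ε x t)) with hC
    have h2 := abs_sub_le_of_deriv_le (y := fun r => u x r - r * ut x t)
      (G := fun r => C * r) hst.le
      (((P.continuousOn_t hx').mono (Icc_subset_Icc hs ht)).sub (by fun_prop))
      (by fun_prop) (fun r hr => by
        have hrT : r ∈ Ioc 0 T := ⟨hs.trans_lt hr.1, hr.2.le.trans ht⟩
        have hn : Icc 0 T ∈ 𝓝 r := Icc_mem_nhds hrT.1 (hr.2.trans_le ht)
        refine ⟨_, _, ((P.ut_deriv x hx r hrT).hasDerivAt hn).sub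
          ((hasDerivAt_id r).mul_const (ut x t)), (hasDerivAt_id r).const_mul C, ?_⟩
        rw [one_mul, abs_sub_comm, mul_one]
        refine (H₁ P x hx r hrT t htI hr.2.le).trans ?_
        have k1 : cornerLayer L α ε x r ≤ cornerLayer L α ε x s :=
          cornerLayer_le L hε (by nlinarith [hr.1])
        have k2 : cornerLayer L α ε x t ≤ cornerLayer L α ε x r :=
          cornerLayer_le L hε (by nlinarith [hr.2])
        have k3 : 0 ≤ t - r := by linarith [hr.2]
        have k4 : 0 ≤ cornerLayer L α ε x r - cornerLayer L α ε x t := by linarith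
        rw [hC]
        gcongr
        · linarith
        · exact hr.1.le)
    rw [show u x t - u x s - (t - s) * ut x t = u x t - t * ut x t - (u x s - s * ut x t) by ring]
    linarith
  · have ht' : t ∈ Icc 0 T := ⟨ht.1.le, ht.2⟩
    have hxI : x ∈ Ioc 0 L := ⟨hy.trans_lt hyx, hx⟩
    set C := K * ((x - y) + ε⁻¹ * (layer L ε x - layer L ε y)) with hC
    have h2 := abs_sub_le_of_deriv_le (y := fun r => u r t - r * ux x t)
      (G := fun r => C * r) hyx.le
      (((P.continuousOn_x ht').mono (Icc_subset_Icc hy hx)).sub (by fun_prop))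
      (by fun_prop) (fun r hr => by
        have hrL : r ∈ Ioc 0 L := ⟨hy.trans_lt hr.1, hr.2.le.trans hx⟩
        have hn : Icc 0 L ∈ 𝓝 r := Icc_mem_nhds hrL.1 (hr.2.trans_le hx)
        refine ⟨_, _, ((P.ux_deriv r hrL t ht).hasDerivAt hn).sub
          ((hasDerivAt_id r).mul_const (ux x t)), (hasDerivAt_id r).const_mul C, ?_⟩
        rw [one_mul, abs_sub_comm, mul_one]
        refine (H₂ P t ht r hrL x hxI hr.2.le).trans ?_
        have k1 : layer L ε y ≤ layer L ε r := layer_mono hε hr.1.le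
        have k2 : layer L ε r ≤ layer L ε x := layer_mono hε hr.2.le
        have k3 : 0 ≤ x - r := by linarith [hr.2]
        have k4 : 0 ≤ layer L ε x - layer L ε r := by linarith
        rw [hC]
        gcongr
        · linarith
        · exact hr.1.le)
    rw [show u x t - u y t - (x - y) * ux x t = u x t - x * ux x t - (u y t - y * ux x t) by ring]
    linarith
  · have := layer_pos L ε x
    exact (H₃ P x hx t ht).trans (by gcongr; linarith)
  · have k := layer_mono hε (L := L) hyx
    refine (H₄ P t ht y x hy hyx hx).trans (mul_le_mul_of_nonneg_right ?_ (by linarith))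
    linarith
  · have k : cornerLayer L α ε x t ≤ cornerLayer L α ε x s := cornerLayer_le L hε (by nlinarith)
    refine (H₅ P x hx s t hs hst ht).trans (mul_le_mul_of_nonneg_right ?_ (by linarith))
    linarith

end ClassicalProblem

/-! ### Reduction to the normal form -/

lemma convex_closedDomain (L T : ℝ) : Convex ℝ (closedDomain L T) :=
  (convex_Icc 0 L).prod (convex_Icc 0 T)

lemma isCompact_closedDomain (L T : ℝ) : IsCompact (closedDomain L T) :=
  isCompact_Icc.prod isCompact_Icc

lemma uniqueDiffOn_closedDomain {L T : ℝ} (hL : 0 < L) (hT : 0 < T) :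
    UniqueDiffOn ℝ (closedDomain L T) :=
  (uniqueDiffOn_Icc hL).prod (uniqueDiffOn_Icc hT)

/-- The quantitative consequences of `p ∈ C²([0,L] × [0,T])` that are used. -/
structure SmoothBounds (L T K : ℝ) (p : ℝ → ℝ → ℝ) : Prop where
  bound : ∀ x ∈ Icc 0 L, ∀ t ∈ Icc 0 T, |p x t| ≤ K
  second : ∀ x ∈ Icc 0 L, SecondOrderLip T K (p x)
  deriv : ∀ x ∈ Icc 0 L, ∀ t ∈ Icc 0 T,
    HasDerivWithinAt (fun r => p r t) (partialX L p x t) (Icc 0 L) x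
  deriv_bound : ∀ x ∈ Icc 0 L, ∀ t ∈ Icc 0 T, |partialX L p x t| ≤ K
  lip : ∀ x ∈ Icc 0 L, ∀ y ∈ Icc 0 L, ∀ t ∈ Icc 0 T, |p x t - p y t| ≤ K * |x - y|

lemma exists_smoothBounds {L T : ℝ} (hL : 0 < L) (hT : 0 < T) {p : ℝ → ℝ → ℝ}
    (hp : ContDiffOn ℝ 2 (Function.uncurry p) (closedDomain L T)) :
    ∃ K, 0 ≤ K ∧ SmoothBounds L T K p := by
  set s := closedDomain L T with hs
  have hu := uniqueDiffOn_closedDomain hL hT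
  have hD : ContDiffOn ℝ 1 (fderivWithin ℝ (Function.uncurry p) s) s :=
    hp.fderivWithin hu (by norm_num)
  obtain ⟨K₁, hK₁⟩ := hD.exists_lipschitzOnWith (by norm_num) (convex_closedDomain L T)
    (isCompact_closedDomain L T)
  obtain ⟨K₀, hK₀⟩ := (isCompact_closedDomain L T).exists_bound_of_continuousOn hD.continuousOn
  obtain ⟨K₂, hK₂⟩ := (isCompact_closedDomain L T).exists_bound_of_continuousOn hp.continuousOn
  set D := fderivWithin ℝ (Function.uncurry p) s with hDdef
  have hfd : ∀ z ∈ s, HasFDerivWithinAt (Function.uncurry p) (D z) s z := fun z hz =>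
    (hp.differentiableOn (by norm_num) z hz).hasFDerivWithinAt
  set K := K₁ + |K₀| + |K₂| with hK
  have hK0 : 0 ≤ K := by positivity
  have hKK₀ : |K₀| ≤ K := by rw [hK]; linarith [abs_nonneg K₂, K₁.2, abs_nonneg K₀]
  have hKK₁ : (K₁ : ℝ) ≤ K := by rw [hK]; linarith [abs_nonneg K₂, abs_nonneg K₀]
  have hKK₂ : |K₂| ≤ K := by rw [hK]; linarith [abs_nonneg K₂, K₁.2, abs_nonneg K₀]
  have happ : ∀ z ∈ s, ∀ v : ℝ × ℝ, ‖v‖ ≤ 1 → |D z v| ≤ K := fun z hz v hv => by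
    have h1 := (D z).le_opNorm v
    rw [Real.norm_eq_abs] at h1
    have h2 := (hK₀ z hz).trans ((le_abs_self _).trans hKK₀)
    refine h1.trans ?_
    calc ‖D z‖ * ‖v‖ ≤ K * 1 := mul_le_mul h2 hv (norm_nonneg _) hK0
      _ = K := mul_one K
  have hx1 : ∀ x ∈ Icc 0 L, ∀ t ∈ Icc 0 T,
      HasDerivWithinAt (fun r => p r t) (D (x, t) (1, 0)) (Icc 0 L) x := fun x hx t ht =>
    (hfd (x, t) ⟨hx, ht⟩).comp_hasDerivWithinAt (f := fun r => (r, t)) x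
      ((hasDerivWithinAt_id x _).prodMk (hasDerivWithinAt_const x _ t)) (fun r hr => ⟨hr, ht⟩)
  have ht1 : ∀ x ∈ Icc 0 L, ∀ t ∈ Icc 0 T,
      HasDerivWithinAt (p x) (D (x, t) (0, 1)) (Icc 0 T) t := fun x hx t ht =>
    (hfd (x, t) ⟨hx, ht⟩).comp_hasDerivWithinAt (f := fun r => (x, r)) t
      ((hasDerivWithinAt_const t _ x).prodMk (hasDerivWithinAt_id t _)) (fun r hr => ⟨hx, hr⟩)
  have hxe : ∀ x ∈ Icc 0 L, ∀ t ∈ Icc 0 T, partialX L p x t = D (x, t) (1, 0) :=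
    fun x hx t ht => (hx1 x hx t ht).derivWithin (uniqueDiffOn_Icc hL x hx)
  have hn1 : ‖((1 : ℝ), (0 : ℝ))‖ ≤ 1 := by simp [Prod.norm_def]
  have hn2 : ‖((0 : ℝ), (1 : ℝ))‖ ≤ 1 := by simp [Prod.norm_def]
  refine ⟨K, hK0, fun x hx t ht => ?_, fun x hx => ?_, fun x hx t ht => ?_, fun x hx t ht => ?_,
    fun x hx y hy t ht => ?_⟩
  · exact (hK₂ (x, t) ⟨hx, ht⟩).trans ((le_abs_self _).trans hKK₂)
  · refine SecondOrderLip.of_deriv hK0 (ht1 x hx) (fun t ht => happ _ ⟨hx, ht⟩ _ hn2)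
      (fun r hr t ht => ?_)
    have h1 := hK₁.dist_le_mul (x, t) ⟨hx, ht⟩ (x, r) ⟨hx, hr⟩
    rw [dist_eq_norm, Prod.dist_eq, dist_self, Real.dist_eq, max_eq_right (abs_nonneg _)] at h1
    have h2 := (D (x, t) - D (x, r)).le_opNorm (0, 1)
    rw [Real.norm_eq_abs] at h2
    calc _ ≤ ‖D (x, t) - D (x, r)‖ * ‖((0 : ℝ), (1 : ℝ))‖ := h2
      _ ≤ (K₁ * |t - r|) * 1 := mul_le_mul h1 hn2 (norm_nonneg _) (by positivity)
      _ ≤ K * |t - r| := by rw [mul_one]; gcongr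
  · rw [hxe x hx t ht]; exact hx1 x hx t ht
  · rw [hxe x hx t ht]; exact happ _ ⟨hx, ht⟩ _ hn1
  · exact Convex.norm_image_sub_le_of_norm_hasDerivWithin_le (f := fun r => p r t)
      (fun r hr => hx1 r hr t ht) (fun r hr => happ _ ⟨hr, ht⟩ _ hn1) (convex_Icc 0 L) hy hx

/-- A bound on a `C²` function of one variable and its derivatives up to order two. -/
lemma exists_derivWithin_bounds {S : ℝ} (hS : 0 < S) {p : ℝ → ℝ}
    (hp : ContDiffOn ℝ 2 p (Icc 0 S)) : ∃ K, 0 ≤ K ∧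
      (∀ x ∈ Icc 0 S, |p x| ≤ K) ∧
      (∀ x ∈ Icc 0 S, HasDerivWithinAt p (derivWithin p (Icc 0 S) x) (Icc 0 S) x) ∧
      (∀ x ∈ Icc 0 S, |derivWithin p (Icc 0 S) x| ≤ K) ∧
      (∀ x ∈ Icc 0 S, HasDerivWithinAt (derivWithin p (Icc 0 S))
        (derivWithin (derivWithin p (Icc 0 S)) (Icc 0 S) x) (Icc 0 S) x) ∧
      (∀ x ∈ Icc 0 S, |derivWithin (derivWithin p (Icc 0 S)) (Icc 0 S) x| ≤ K) := by
  have hu := uniqueDiffOn_Icc hS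
  have h1 : ContDiffOn ℝ 1 (derivWithin p (Icc 0 S)) (Icc 0 S) :=
    hp.derivWithin hu (by norm_num)
  have h2 : ContDiffOn ℝ 0 (derivWithin (derivWithin p (Icc 0 S)) (Icc 0 S)) (Icc 0 S) :=
    h1.derivWithin hu (by norm_num)
  obtain ⟨K₀, hK₀⟩ := isCompact_Icc.exists_bound_of_continuousOn hp.continuousOn
  obtain ⟨K₁, hK₁⟩ := isCompact_Icc.exists_bound_of_continuousOn h1.continuousOn
  obtain ⟨K₂, hK₂⟩ := isCompact_Icc.exists_bound_of_continuousOn h2.continuousOn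
  have a0 := le_abs_self K₀
  have a1 := le_abs_self K₁
  have a2 := le_abs_self K₂
  have b0 := abs_nonneg K₀
  have b1 := abs_nonneg K₁
  have b2 := abs_nonneg K₂
  refine ⟨|K₀| + |K₁| + |K₂|, by positivity, fun x hx => (hK₀ x hx).trans (by linarith),
    fun x hx => (hp.differentiableOn (by norm_num) x hx).hasDerivWithinAt,
    fun x hx => (hK₁ x hx).trans (by linarith),
    fun x hx => (h1.differentiableOn (by norm_num) x hx).hasDerivWithinAt,
    fun x hx => (hK₂ x hx).trans (by linarith)⟩

lemma abs_derivWithin_sub_le {S K : ℝ} {p : ℝ → ℝ}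
    (h : ∀ x ∈ Icc 0 S, HasDerivWithinAt (derivWithin p (Icc 0 S))
        (derivWithin (derivWithin p (Icc 0 S)) (Icc 0 S) x) (Icc 0 S) x)
    (hb : ∀ x ∈ Icc 0 S, |derivWithin (derivWithin p (Icc 0 S)) (Icc 0 S) x| ≤ K) :
    ∀ s ∈ Icc 0 S, ∀ t ∈ Icc 0 S,
      |derivWithin p (Icc 0 S) t - derivWithin p (Icc 0 S) s| ≤ K * |t - s| := fun _ hs _ ht =>
  Convex.norm_image_sub_le_of_norm_hasDerivWithin_le h hb (convex_Icc 0 S) hs ht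

section forcing
variable {L T ε C₁ : ℝ} {f : ℝ → ℝ → ℝ}

lemma OutflowLayerForcing.abs_le (hf : OutflowLayerForcing L T ε C₁ f) {x t : ℝ}
    (hx : x ∈ Icc 0 L) (ht : t ∈ Icc 0 T) : |f x t| ≤ C₁ * (ε⁻¹ * layer L ε x) := by
  have := hf.layer_bound 0 0 (by norm_num) x hx t ht
  simp only [mixedPartial, Function.iterate_zero, id] at this
  refine this.trans (le_of_eq ?_)
  simp only [layer]; ring

lemma OutflowLayerForcing.abs_partialX_le (hf : OutflowLayerForcing L T ε C₁ f) {x t : ℝ}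
    (hx : x ∈ Icc 0 L) (ht : t ∈ Icc 0 T) :
    |partialX L f x t| ≤ C₁ * (ε⁻¹ ^ 2 * layer L ε x) := by
  have := hf.layer_bound 1 0 (by norm_num) x hx t ht
  refine this.trans (le_of_eq ?_)
  simp only [layer]; ring

lemma OutflowLayerForcing.nonneg (hL : 0 < L) (hT : 0 < T) (hε : 0 < ε)
    (hf : OutflowLayerForcing L T ε C₁ f) : 0 ≤ C₁ := by
  have h1 := (abs_nonneg _).trans (hf.abs_le (x := 0) (t := 0) ⟨le_rfl, hL.le⟩ ⟨le_rfl, hT.le⟩)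
  have h2 : 0 < ε⁻¹ * layer L ε 0 := mul_pos (inv_pos.2 hε) (layer_pos _ _ _)
  exact nonneg_of_mul_nonneg_left h1 h2

lemma OutflowLayerForcing.second (hT : 0 < T) (hε : 0 < ε) (hC : 0 ≤ C₁)
    (hfs : ContDiffOn ℝ 2 (Function.uncurry f) (closedDomain L T))
    (hf : OutflowLayerForcing L T ε C₁ f) {x : ℝ} (hx : x ∈ Icc 0 L) :
    SecondOrderLip T (C₁ * (ε⁻¹ * layer L ε x)) (f x) := by
  have hfx : ContDiffOn ℝ 2 (f x) (Icc 0 T) :=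
    hfs.comp (f := fun t => (x, t)) (by fun_prop) (fun t ht => ⟨hx, ht⟩)
  obtain ⟨-, -, -, h1, -, h2, -⟩ := exists_derivWithin_bounds hT hfx
  have hl := layer_pos L ε x
  refine SecondOrderLip.of_deriv (by positivity) h1 (fun t ht => ?_)
    (abs_derivWithin_sub_le h2 (fun t ht => ?_))
  · refine (hf.layer_bound 0 1 (by norm_num) x hx t ht).trans (le_of_eq ?_)
    simp only [layer]; ring
  · refine (hf.layer_bound 0 2 (by norm_num) x hx t ht).trans (le_of_eq ?_)
    simp only [layer]; ring

lemma OutflowLayerForcing.hasDerivWithinAt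
    (hfs : ContDiffOn ℝ 2 (Function.uncurry f) (closedDomain L T)) {x t : ℝ} (hx : x ∈ Icc 0 L)
    (ht : t ∈ Icc 0 T) : HasDerivWithinAt (fun r => f r t) (partialX L f x t) (Icc 0 L) x := by
  have hft : ContDiffOn ℝ 2 (fun r => f r t) (Icc 0 L) :=
    hfs.comp (f := fun r => (r, t)) (by fun_prop) (fun r hr => ⟨hr, ht⟩)
  exact (hft.differentiableOn (by norm_num) x hx).hasDerivWithinAt

lemma OutflowLayerForcing.abs_sub_le
    (hfs : ContDiffOn ℝ 2 (Function.uncurry f) (closedDomain L T))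
    (hf : OutflowLayerForcing L T ε C₁ f) {x y t : ℝ} (hy : 0 ≤ y) (hyx : y ≤ x) (hx : x ≤ L)
    (ht : t ∈ Icc 0 T) :
    |f x t - f y t| ≤ C₁ * (ε⁻¹ * (layer L ε x - layer L ε y)) := by
  have hsub : Icc y x ⊆ Icc 0 L := Icc_subset_Icc hy hx
  have hl := continuous_layer L ε
  have := abs_sub_le_of_deriv_le (y := fun r => f r t) (G := fun r => C₁ * (ε⁻¹ * layer L ε r)) hyx
    (fun r hr => ((hasDerivWithinAt hfs (hsub hr) ht).mono hsub).continuousWithinAt)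
    (by fun_prop) (fun r hr => by
      have hr' := hsub (Ioo_subset_Icc_self hr)
      refine ⟨_, _, (hasDerivWithinAt hfs hr' ht).hasDerivAt
        (Icc_mem_nhds (hy.trans_lt hr.1) (hr.2.trans_le hx)),
        ((hasDerivAt_layer L ε r).const_mul _).const_mul _,
        (hf.abs_partialX_le hr' ht).trans (le_of_eq (by ring))⟩)
  refine this.trans (le_of_eq (by ring))

end forcing

lemma hasDerivWithinAt_partialX {L T : ℝ} {u : ℝ → ℝ → ℝ}
    (hu : ContDiffOn ℝ 1 (Function.uncurry u) (domain L T)) {x t : ℝ} (hx : x ∈ Ioc 0 L)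
    (ht : t ∈ Ioc 0 T) : HasDerivWithinAt (fun r => u r t) (partialX L u x t) (Icc 0 L) x := by
  have h1 : ContDiffOn ℝ 1 (fun r => u r t) (Ioc 0 L) :=
    hu.comp (f := fun r => (r, t)) (by fun_prop) (fun r hr => ⟨hr, ht⟩)
  refine ((h1.differentiableOn (by norm_num) x hx).mono_of_mem_nhdsWithin ?_).hasDerivWithinAt
  filter_upwards [self_mem_nhdsWithin, mem_nhdsWithin_of_mem_nhds (Ioi_mem_nhds hx.1)] with r h h'
  exact ⟨h', h.2⟩

lemma hasDerivWithinAt_partialT {L T : ℝ} {u : ℝ → ℝ → ℝ}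
    (hu : ContDiffOn ℝ 1 (Function.uncurry u) (domain L T)) {x t : ℝ} (hx : x ∈ Ioc 0 L)
    (ht : t ∈ Ioc 0 T) : HasDerivWithinAt (u x) (partialT T u x t) (Icc 0 T) t := by
  have h1 : ContDiffOn ℝ 1 (u x) (Ioc 0 T) :=
    hu.comp (f := fun r => (x, r)) (by fun_prop) (fun r hr => ⟨hx, hr⟩)
  refine ((h1.differentiableOn (by norm_num) t ht).mono_of_mem_nhdsWithin ?_).hasDerivWithinAt
  filter_upwards [self_mem_nhdsWithin, mem_nhdsWithin_of_mem_nhds (Ioi_mem_nhds ht.1)] with r h h'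
  exact ⟨h', h.2⟩

lemma exists_hasFDerivAt_of_contDiffOn {L T : ℝ} {u : ℝ → ℝ → ℝ}
    (hu : ContDiffOn ℝ 1 (Function.uncurry u) (domain L T)) {x t : ℝ} (hx : x ∈ Ioo 0 L)
    (ht : t ∈ Ioo 0 T) (q : ℝ) : ∃ D : ℝ × ℝ →L[ℝ] ℝ, HasFDerivAt (Function.uncurry u) D (x, t) ∧
      D (1, q) = partialX L u x t + q * partialT T u x t := by
  have hxI : x ∈ Ioc 0 L := ⟨hx.1, hx.2.le⟩
  have htI : t ∈ Ioc 0 T := ⟨ht.1, ht.2.le⟩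
  have hn : domain L T ∈ 𝓝 (x, t) :=
    prod_mem_nhds (Ioc_mem_nhds hx.1 hx.2) (Ioc_mem_nhds ht.1 ht.2)
  have hD := ((hu.differentiableOn (by norm_num) (x, t) ⟨hxI, htI⟩).differentiableAt hn).hasFDerivAt
  refine ⟨_, hD, ?_⟩
  set D := fderiv ℝ (Function.uncurry u) (x, t)
  have h1 : HasDerivAt (fun r => u r t) (D (1, 0)) x :=
    hD.comp_hasDerivAt (f := fun r => (r, t)) x ((hasDerivAt_id x).prodMk (hasDerivAt_const x t))
  have h2 : HasDerivAt (u x) (D (0, 1)) t :=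
    hD.comp_hasDerivAt (f := fun r => (x, r)) t ((hasDerivAt_const t x).prodMk (hasDerivAt_id t))
  have e1 := h1.unique ((hasDerivWithinAt_partialX hu hxI htI).hasDerivAt (Icc_mem_nhds hx.1 hx.2))
  have e2 := h2.unique ((hasDerivWithinAt_partialT hu hxI htI).hasDerivAt (Icc_mem_nhds ht.1 ht.2))
  rw [← e1, ← e2, ← smul_eq_mul, ← map_smul, ← map_add]
  simp

/-- Division by `a` brings the problem into normal form, with bounds on the data that do not depend
on `ε`. The function `g x = f(x,0) - a(x,0) φ'(x) - b(x,0) φ(x)` is the value of `u_t` that the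
equation prescribes on the initial line, and the compatibility condition of order one says that
`g 0` is the derivative of `ψ` at `0`. -/
theorem exists_classicalProblem (L T α C₁ : ℝ) (a b : ℝ → ℝ → ℝ) (φ ψ : ℝ → ℝ)
    (hL : 0 < L) (hT : 0 < T) (hα : 0 < α)
    (ha : ContDiffOn ℝ 2 (Function.uncurry a) (closedDomain L T))
    (hb : ContDiffOn ℝ 2 (Function.uncurry b) (closedDomain L T))
    (hφ : ContDiffOn ℝ 2 φ (Icc 0 L)) (hψ : ContDiffOn ℝ 2 ψ (Icc 0 T))
    (ha_lower : ∀ x ∈ Icc 0 L, ∀ t ∈ Icc 0 T, α ≤ a x t)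
    (hb_nonneg : ∀ x ∈ Icc 0 L, ∀ t ∈ Icc 0 T, 0 ≤ b x t) :
    ∃ Λ : ℝ, ∀ ε : ℝ, 0 < ε → ε ≤ 1 →
      ∀ f : ℝ → ℝ → ℝ, ContDiffOn ℝ 2 (Function.uncurry f) (closedDomain L T) →
        Compatible L T a b f φ ψ → OutflowLayerForcing L T ε C₁ f →
      ∀ u : ℝ → ℝ → ℝ, IsSolution L T a b f φ ψ u →
      ∃ q c F φ' g g', ClassicalProblem L T α Λ ε q c F φ φ' g g' ψ u (partialX L u)
        (partialT T u) := by
  have hane : ∀ x ∈ Icc 0 L, ∀ t ∈ Icc 0 T, a x t ≠ 0 := fun x hx t ht =>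
    (hα.trans_le (ha_lower x hx t ht)).ne'
  have hq : ContDiffOn ℝ 2 (Function.uncurry fun x t => (a x t)⁻¹) (closedDomain L T) :=
    ContDiffOn.inv (f := Function.uncurry a) ha (fun z hz => hane z.1 hz.1 z.2 hz.2)
  have hc : ContDiffOn ℝ 2 (Function.uncurry fun x t => (a x t)⁻¹ * b x t) (closedDomain L T) :=
    hq.mul hb
  obtain ⟨Ka, hKa, Ba⟩ := exists_smoothBounds hL hT ha
  obtain ⟨Kb, hKb, Bb⟩ := exists_smoothBounds hL hT hb
  obtain ⟨Kq, hKq, Bq⟩ := exists_smoothBounds hL hT hq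
  obtain ⟨Kc, hKc, Bc⟩ := exists_smoothBounds hL hT hc
  obtain ⟨Kφ, hKφ, φ0, φd, φ1, φdd, φ2⟩ := exists_derivWithin_bounds hL hφ
  obtain ⟨Kψ, hKψ, ψ0, ψd, ψ1, ψdd, ψ2⟩ := exists_derivWithin_bounds hT hψ
  set Λ := 1 + Ka + Kq + Kc + Kφ + Kψ + (α⁻¹ + 3 * Kq) * |C₁| + |C₁| + 2 * (Ka * Kφ) +
    2 * (Kb * Kφ) with hΛ
  have pC : 0 ≤ |C₁| := abs_nonneg _
  have pα : 0 < α⁻¹ := inv_pos.2 hα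
  have p1 : 0 ≤ α⁻¹ * |C₁| := by positivity
  have p2 : 0 ≤ Kq * |C₁| := by positivity
  have p3 : 0 ≤ Ka * Kφ := by positivity
  have p4 : 0 ≤ Kb * Kφ := by positivity
  have hKaΛ : Ka ≤ Λ := by linarith
  have hΛ1 : 1 ≤ Λ := by linarith
  have hΛ0 : 0 < Λ := by linarith
  refine ⟨Λ, fun ε hε hε1 f hfs hcomp hf u hu => ?_⟩
  have hC := hf.nonneg hL hT hε
  rw [abs_of_nonneg hC] at *
  have hεi : 1 ≤ ε⁻¹ := (one_le_inv₀ hε).2 hε1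
  have h0L : (0 : ℝ) ∈ Icc 0 L := ⟨le_rfl, hL.le⟩
  have h0T : (0 : ℝ) ∈ Icc 0 T := ⟨le_rfl, hT.le⟩
  have hq0 : ∀ x ∈ Icc 0 L, ∀ t ∈ Icc 0 T, 0 < (a x t)⁻¹ := fun x hx t ht =>
    inv_pos.2 (hα.trans_le (ha_lower x hx t ht))
  have hqα : ∀ x ∈ Icc 0 L, ∀ t ∈ Icc 0 T, (a x t)⁻¹ ≤ α⁻¹ := fun x hx t ht =>
    inv_anti₀ hα (ha_lower x hx t ht)
  have hqabs : ∀ x ∈ Icc 0 L, ∀ t ∈ Icc 0 T, |(a x t)⁻¹| ≤ α⁻¹ := fun x hx t ht => by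
    rw [abs_of_pos (hq0 x hx t ht)]; exact hqα x hx t ht
  set φ' := derivWithin φ (Icc 0 L) with hφ'
  have hlp := layer_pos L ε
  have hw : ∀ x, 0 < ε⁻¹ * layer L ε x := fun x => mul_pos (by positivity) (hlp x)
  have hw2 : ∀ x, 0 < ε⁻¹ ^ 2 * layer L ε x := fun x => mul_pos (by positivity) (hlp x)
  have hgc : ∀ x ∈ Icc 0 L, HasDerivWithinAt
      (fun x => f x 0 - a x 0 * φ' x - b x 0 * φ x)
      (partialX L f x 0 - (partialX L a x 0 * φ' x + a x 0 * derivWithin φ' (Icc 0 L) x) -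
        (partialX L b x 0 * φ x + b x 0 * φ' x)) (Icc 0 L) x := fun x hx =>
    ((OutflowLayerForcing.hasDerivWithinAt hfs hx h0T).sub
      ((Ba.deriv x hx 0 h0T).mul (φdd x hx))).sub ((Bb.deriv x hx 0 h0T).mul (φd x hx))
  refine ⟨fun x t => (a x t)⁻¹, fun x t => (a x t)⁻¹ * b x t, fun x t => (a x t)⁻¹ * f x t,
    φ', fun x => f x 0 - a x 0 * φ' x - b x 0 * φ x,
    fun x => partialX L f x 0 - (partialX L a x 0 * φ' x + a x 0 * derivWithin φ' (Icc 0 L) x) -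
        (partialX L b x 0 * φ x + b x 0 * φ' x), ?_⟩
  exact {
    L_pos := hL
    T_pos := hT
    α_pos := hα
    Λ_ge := hΛ1
    ε_pos := hε
    ε_le := hε1
    q_lower := fun x hx t ht => inv_anti₀ (hα.trans_le (ha_lower x hx t ht))
      ((le_abs_self _).trans ((Ba.bound x hx t ht).trans hKaΛ))
    q_upper := hqα
    q_cont := hq.continuousOn
    q_second := fun x hx => (Bq.second x hx).mono (by linarith)
    c_nonneg := fun x hx t ht => mul_nonneg (hq0 x hx t ht).le (hb_nonneg x hx t ht)
    c_second := fun x hx => (Bc.second x hx).mono (by linarith)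
    c_le := fun x hx t ht => (le_abs_self _).trans ((Bc.bound x hx t ht).trans (by linarith))
    F_bound := fun x hx t ht => by
      rw [abs_mul]
      have h1 := mul_le_mul (hqabs x hx t ht) (hf.abs_le hx ht) (abs_nonneg _) pα.le
      have h2 : α⁻¹ * C₁ * (ε⁻¹ * layer L ε x) ≤ Λ * (ε⁻¹ * layer L ε x) :=
        mul_le_mul_of_nonneg_right (by linarith) (hw x).le
      linarith
    F_second := fun x hx => by
      refine (SecondOrderLip.mul (Bq.second x hx) (hf.second hT hε hC hfs hx) hKq
        (mul_nonneg hC (hw x).le) (hqabs x hx) (fun t ht => hf.abs_le hx ht)).mono ?_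
      have h2 : (α⁻¹ + 3 * Kq) * C₁ * (ε⁻¹ * layer L ε x) ≤ Λ * (ε⁻¹ * layer L ε x) :=
        mul_le_mul_of_nonneg_right (by linarith) (hw x).le
      linarith
    φ_cont := hφ.continuousOn
    φ_deriv := fun x hx => (φd x ⟨hx.1.le, hx.2.le⟩).hasDerivAt (Icc_mem_nhds hx.1 hx.2)
    φ_bound := fun x hx => (φ0 x hx).trans (by linarith)
    φ'_bound := fun x hx => (φ1 x hx).trans (by linarith)
    g_cont := fun x hx => (hgc x hx).continuousWithinAt
    g_deriv := fun x hx => (hgc x ⟨hx.1.le, hx.2.le⟩).hasDerivAt (Icc_mem_nhds hx.1 hx.2)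
    g_bound := fun x hx => by
      refine (abs_sub _ _).trans ((add_le_add (abs_sub _ _) le_rfl).trans ?_)
      rw [abs_mul, abs_mul]
      have i1 := hf.abs_le hx h0T
      have i2 := mul_le_mul (Ba.bound x hx 0 h0T) (φ1 x hx) (abs_nonneg _) hKa
      have i3 := mul_le_mul (Bb.bound x hx 0 h0T) (φ0 x hx) (abs_nonneg _) hKb
      have h2 : C₁ * (ε⁻¹ * layer L ε x) ≤ Λ * (ε⁻¹ * layer L ε x) :=
        mul_le_mul_of_nonneg_right (by linarith) (hw x).le
      linarith
    g'_bound := fun x hx => by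
      refine (abs_sub _ _).trans ((add_le_add (abs_sub _ _) le_rfl).trans ?_)
      have j1 := abs_add_le (partialX L a x 0 * φ' x) (a x 0 * derivWithin φ' (Icc 0 L) x)
      have j2 := abs_add_le (partialX L b x 0 * φ x) (b x 0 * φ' x)
      simp only [abs_mul] at j1 j2
      have i1 := hf.abs_partialX_le hx h0T
      have i2 := mul_le_mul (Ba.bound x hx 0 h0T) (φ2 x hx) (abs_nonneg _) hKa
      have i3 := mul_le_mul (Bb.bound x hx 0 h0T) (φ1 x hx) (abs_nonneg _) hKb
      have i4 := mul_le_mul (Ba.deriv_bound x hx 0 h0T) (φ1 x hx) (abs_nonneg _) hKa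
      have i5 := mul_le_mul (Bb.deriv_bound x hx 0 h0T) (φ0 x hx) (abs_nonneg _) hKb
      have h2 : C₁ * (ε⁻¹ ^ 2 * layer L ε x) ≤ Λ * (ε⁻¹ ^ 2 * layer L ε x) :=
        mul_le_mul_of_nonneg_right (by linarith) (hw2 x).le
      linarith
    g_eq := fun x hx => by
      have := hane x ⟨hx.1.le, hx.2.le⟩ 0 h0T
      field_simp
    ψ_bound := fun t ht => (ψ0 t ht).trans (by linarith)
    ψ_second := (SecondOrderLip.of_deriv hKψ ψd ψ1 (abs_derivWithin_sub_le ψdd ψ2)).mono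
      (by linarith)
    corner := fun t ht => by
      have h1 := abs_sub_sub_le_of_lipschitz_deriv ψd (abs_derivWithin_sub_le ψdd ψ2) h0T ht hKψ
      have h2 := hcomp.order_one
      have e : ψ t - φ 0 - t * (f 0 0 - a 0 0 * φ' 0 - b 0 0 * φ 0) =
          ψ t - ψ 0 - derivWithin ψ (Icc 0 T) 0 * (t - 0) := by
        rw [hcomp.order_zero]
        linear_combination t * h2
      rw [e]
      rw [sub_zero] at h1 ⊢
      exact h1.trans (mul_le_mul_of_nonneg_right (by linarith) (sq_nonneg _))
    u_cont := hu.continuousOn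
    u_eq := fun x hx t ht => by
      obtain ⟨D, hD, e⟩ := exists_hasFDerivAt_of_contDiffOn hu.contDiffOn hx ht (a x t)⁻¹
      refine ⟨D, hD, ?_⟩
      rw [e]
      have h1 := hu.equation x ⟨hx.1, hx.2.le⟩ t ⟨ht.1, ht.2.le⟩
      have h2 := hane x ⟨hx.1.le, hx.2.le⟩ t ⟨ht.1.le, ht.2.le⟩
      field_simp
      linarith
    inflow := hu.inflow
    initial := hu.initial
    ux_deriv := fun x hx t ht => hasDerivWithinAt_partialX hu.contDiffOn hx ht
    ut_deriv := fun x hx t ht => hasDerivWithinAt_partialT hu.contDiffOn hx ht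
    equation := fun x hx t ht => by
      have h1 := hu.equation x hx t ht
      have h2 := hane x ⟨hx.1.le, hx.2⟩ t ⟨ht.1.le, ht.2⟩
      field_simp
      linarith
    q_lip := fun x hx y hy t ht => (Bq.lip x hx y hy t ht).trans
      (mul_le_mul_of_nonneg_right (by linarith) (abs_nonneg _))
    c_lip := fun x hx y hy t ht => (Bc.lip x hx y hy t ht).trans
      (mul_le_mul_of_nonneg_right (by linarith) (abs_nonneg _))
    F_lip := fun x hx y hy t ht hyx => by
      have e : (a x t)⁻¹ * f x t - (a y t)⁻¹ * f y t =
        (a x t)⁻¹ * (f x t - f y t) + ((a x t)⁻¹ - (a y t)⁻¹) * f y t := by ring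
      rw [e]
      refine (abs_add_le _ _).trans ?_
      rw [abs_mul, abs_mul]
      have i1 := mul_le_mul (hqabs x hx t ht) (hf.abs_sub_le hfs hy.1 hyx hx.2 ht) (abs_nonneg _)
        pα.le
      have i2 := mul_le_mul (Bq.lip x hx y hy t ht) (hf.abs_le hy ht) (abs_nonneg _)
        (by positivity)
      rw [abs_of_nonneg (show 0 ≤ x - y by linarith)] at i2
      set δ := layer L ε x - layer L ε y with hδ
      have hδ0 : 0 ≤ δ := sub_nonneg.2 (layer_mono hε hyx)
      have hδε : δ ≤ ε⁻¹ * δ := le_mul_of_one_le_left hδ0 hεi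
      have i3 := sub_mul_layer_le (L := L) (x := x) (y := y) hε
      have i4 : Kq * C₁ * ((x - y) * (ε⁻¹ * layer L ε y)) ≤ Kq * C₁ * (ε⁻¹ * δ) :=
        mul_le_mul_of_nonneg_left (i3.trans hδε) (mul_nonneg hKq hC)
      have i5 : (α⁻¹ + 3 * Kq) * C₁ * (ε⁻¹ * δ) ≤ Λ * (ε⁻¹ * δ) :=
        mul_le_mul_of_nonneg_right (by linarith) (by positivity)
      have i6 : 0 ≤ Kq * C₁ * (ε⁻¹ * δ) := by positivity
      linarith }

/-! ### Discrete comparison principle and interpolation -/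

/-- The upwind matrix is an M-matrix: a mesh function that depends on `x` only and whose upwind
derivative dominates the residual is a barrier. -/
lemma abs_le_of_residual_le {N M : ℕ} {x t B : ℕ → ℝ} {A b E : ℕ → ℕ → ℝ}
    (hx : ∀ i < N, x i < x (i + 1)) (ht : ∀ j < M, t j < t (j + 1))
    (hA : ∀ i < N, ∀ j < M, 0 ≤ A i j) (hb : ∀ i < N, ∀ j < M, 0 ≤ b i j)
    (hB : ∀ i ≤ N, 0 ≤ B i) (h0 : ∀ j ≤ M, E 0 j = 0) (h0' : ∀ i ≤ N, E i 0 = 0)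
    (hres : ∀ i < N, ∀ j < M, |(E (i + 1) (j + 1) - E (i + 1) j) / (t (j + 1) - t j) +
      A i j * ((E (i + 1) (j + 1) - E i (j + 1)) / (x (i + 1) - x i)) +
      b i j * E (i + 1) (j + 1)| ≤ A i j * ((B (i + 1) - B i) / (x (i + 1) - x i))) :
    ∀ j ≤ M, ∀ i ≤ N, |E i j| ≤ B i := by
  intro j
  induction j with
  | zero => intro _ i hi; rw [h0' i hi, abs_zero]; exact hB i hi
  | succ j ihj =>
    intro hj i
    induction i with
    | zero => intro hi; rw [h0 _ hj, abs_zero]; exact hB 0 hi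
    | succ i ihi =>
      intro hi
      have e1 := ihj (by omega) (i + 1) hi
      have e2 := ihi (by omega)
      have hr := hres i (by omega) j (by omega)
      have hk : 0 < t (j + 1) - t j := sub_pos.2 (ht j (by omega))
      have hh : 0 < x (i + 1) - x i := sub_pos.2 (hx i (by omega))
      have hA' := hA i (by omega) j (by omega)
      have hb' := hb i (by omega) j (by omega)
      set κ := (t (j + 1) - t j)⁻¹ with hκ
      set η := A i j * (x (i + 1) - x i)⁻¹ with hη
      have hκ0 : 0 < κ := inv_pos.2 hk
      have hη0 : 0 ≤ η := mul_nonneg hA' (inv_pos.2 hh).le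
      have hr' : |κ * (E (i + 1) (j + 1) - E (i + 1) j) + η * (E (i + 1) (j + 1) - E i (j + 1)) +
          b i j * E (i + 1) (j + 1)| ≤ η * (B (i + 1) - B i) := by
        rw [show η * (B (i + 1) - B i) = A i j * ((B (i + 1) - B i) / (x (i + 1) - x i)) by
            rw [hη]; ring,
          show κ * (E (i + 1) (j + 1) - E (i + 1) j) =
            (E (i + 1) (j + 1) - E (i + 1) j) / (t (j + 1) - t j) by rw [hκ]; ring,
          show η * (E (i + 1) (j + 1) - E i (j + 1)) =
            A i j * ((E (i + 1) (j + 1) - E i (j + 1)) / (x (i + 1) - x i)) by rw [hη]; ring]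
        exact hr
      rw [abs_le] at e1 e2 hr' ⊢
      have i1 := mul_le_mul_of_nonneg_left e1.1 hκ0.le
      have i2 := mul_le_mul_of_nonneg_left e1.2 hκ0.le
      have i3 := mul_le_mul_of_nonneg_left e2.1 hη0
      have i4 := mul_le_mul_of_nonneg_left e2.2 hη0
      have i5 := mul_nonneg hb' (hB (i + 1) hi)
      have hS : 0 < κ + η + b i j := by positivity
      constructor
      · refine le_of_mul_le_mul_left ?_ hS
        linarith [hr'.1]
      · refine le_of_mul_le_mul_left ?_ hS
        linarith [hr'.2]

lemma exists_mem_cell {z : ℕ → ℝ} {s : ℝ} : ∀ {n : ℕ}, 0 < n → z 0 ≤ s → s ≤ z n →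
    ∃ m < n, z m ≤ s ∧ s ≤ z (m + 1)
  | 0, h, _, _ => absurd h (lt_irrefl 0)
  | n + 1, _, h0, h1 => by
    rcases le_total (z n) s with h | h
    · exact ⟨n, by omega, h, h1⟩
    · rcases Nat.eq_zero_or_pos n with rfl | hn
      · exact ⟨0, by omega, h0, h1⟩
      · obtain ⟨m, hm, h2⟩ := exists_mem_cell hn h0 h
        exact ⟨m, by omega, h2⟩

/-- The values of the hat functions on the cell `[z m, z (m+1)]`. -/
lemma hat_eq {z : ℕ → ℝ} (hz : StrictMono z) {n m i : ℕ} {s : ℝ} (hm : m < n) (h1 : z m ≤ s)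
    (h2 : s ≤ z (m + 1)) : hat z n i s =
      if i = m then (z (m + 1) - s) / (z (m + 1) - z m)
      else if i = m + 1 then (s - z m) / (z (m + 1) - z m) else 0 := by
  have hpos : ∀ j, z (j + 1) - z j ≠ 0 := fun j => (sub_pos.2 (hz (Nat.lt_succ_self j))).ne'
  unfold hat
  by_cases him : i = m
  · subst him
    rw [if_pos rfl]
    split_ifs with c1 c2
    · obtain ⟨j, rfl⟩ : ∃ j, i = j + 1 := ⟨i - 1, by omega⟩
      have hs : s = z (j + 1) := le_antisymm c1.2.2 h1
      simp only [Nat.add_sub_cancel]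
      rw [hs, div_self (hpos j), div_self (hpos (j + 1))]
    · rfl
    · exact absurd ⟨hm, h1, h2⟩ c2
  · rw [if_neg him]
    by_cases him' : i = m + 1
    · subst him'
      rw [if_pos rfl, if_pos ⟨by omega, by simpa using h1, h2⟩]
      simp
    · rw [if_neg him']
      rcases lt_or_gt_of_ne him with h | h
      · -- the cell lies to the right of the node `i`
        have hlt : z i < z m := hz h
        rw [if_neg (fun c => by linarith [c.2.2])]
        split_ifs with c2
        · have : z (i + 1) ≤ z m := hz.monotone h
          rw [show z (i + 1) - s = 0 by linarith [c2.2.2], zero_div]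
        · rfl
      · -- the cell lies to the left of the node `i`
        have hgt : z (m + 1) < z i := hz (by omega)
        obtain ⟨j, rfl⟩ : ∃ j, i = j + 1 := ⟨i - 1, by omega⟩
        simp only [Nat.add_sub_cancel]
        split_ifs with c1 c2
        · have : z (m + 1) ≤ z j := hz.monotone (by omega)
          rw [show s - z j = 0 by linarith [c1.2.1], zero_div]
        · linarith [c2.2.1]
        · rfl

lemma exists_sum_hat_eq {z : ℕ → ℝ} (hz : StrictMono z) {n m : ℕ} {s : ℝ} (hm : m < n)
    (h1 : z m ≤ s) (h2 : s ≤ z (m + 1)) : ∃ l : ℝ, 0 ≤ l ∧ l ≤ 1 ∧ ∀ v : ℕ → ℝ,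
      ∑ i ∈ Finset.range (n + 1), v i * hat z n i s = l * v m + (1 - l) * v (m + 1) := by
  have hp : 0 < z (m + 1) - z m := sub_pos.2 (hz (Nat.lt_succ_self m))
  refine ⟨(z (m + 1) - s) / (z (m + 1) - z m), div_nonneg (by linarith) hp.le,
    (div_le_one hp).2 (by linarith), fun v => ?_⟩
  rw [Finset.sum_eq_add (a := m) (b := m + 1) (by omega)]
  · rw [hat_eq hz hm h1 h2, hat_eq hz hm h1 h2, if_pos rfl, if_neg (by omega), if_pos rfl]
    field_simp
    ring
  · intro i _ hi
    rw [hat_eq hz hm h1 h2, if_neg hi.1, if_neg hi.2, mul_zero]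
  · intro h; exact absurd (Finset.mem_range.2 (by omega)) h
  · intro h; exact absurd (Finset.mem_range.2 (by omega)) h

lemma abs_convex_comb_sub_le {l A B w c : ℝ} (h0 : 0 ≤ l) (h1 : l ≤ 1) (hA : |A - w| ≤ c)
    (hB : |B - w| ≤ c) : |l * A + (1 - l) * B - w| ≤ c := by
  rw [abs_le] at *
  constructor <;> nlinarith

/-- The bilinear interpolant is a convex combination of the values at the corners of a cell. -/
lemma abs_interpolant_sub_le {L T C₂ ε w c : ℝ} {N M i j : ℕ} {U : ℕ → ℕ → ℝ} {x t : ℝ}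
    (hx : StrictMono (meshX L ε N)) (ht : StrictMono (meshT T C₂ ε M)) (hi : i < N) (hj : j < M)
    (hx1 : meshX L ε N i ≤ x) (hx2 : x ≤ meshX L ε N (i + 1))
    (ht1 : meshT T C₂ ε M j ≤ t) (ht2 : t ≤ meshT T C₂ ε M (j + 1))
    (h : ∀ k, k = i ∨ k = i + 1 → ∀ l, l = j ∨ l = j + 1 → |U k l - w| ≤ c) :
    |interpolant L T C₂ ε N M U x t - w| ≤ c := by
  obtain ⟨l, l0, l1, hl⟩ := exists_sum_hat_eq hx hi hx1 hx2
  obtain ⟨m, m0, m1, hm⟩ := exists_sum_hat_eq ht hj ht1 ht2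
  have e : interpolant L T C₂ ε N M U x t =
      l * (m * U i j + (1 - m) * U i (j + 1)) +
        (1 - l) * (m * U (i + 1) j + (1 - m) * U (i + 1) (j + 1)) := by
    rw [interpolant, ← hm, ← hm, ← hl (fun k => ∑ j ∈ Finset.range (M + 1),
      U k j * hat (meshT T C₂ ε M) M j t)]
    refine Finset.sum_congr rfl fun k _ => ?_
    rw [Finset.sum_mul]
    refine Finset.sum_congr rfl fun j _ => ?_
    ring
  rw [e]
  exact abs_convex_comb_sub_le l0 l1
    (abs_convex_comb_sub_le m0 m1 (h _ (Or.inl rfl) _ (Or.inl rfl)) (h _ (Or.inl rfl) _ (Or.inr rfl)))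
    (abs_convex_comb_sub_le m0 m1 (h _ (Or.inr rfl) _ (Or.inl rfl)) (h _ (Or.inr rfl) _ (Or.inr rfl)))

/-! ### The two meshes -/

/-- The properties of the space mesh used in the error analysis; `N = 2 n`, and `ν` is `N⁻¹ ln N`.
Either the mesh is uniform, or the layer function `e^{(x-L)/ε}` has the value `N⁻¹` at the transition
point. -/
structure SpaceMesh (L ε σ H h ν : ℝ) (n : ℕ) (x : ℕ → ℝ) : Prop where
  n_pos : 0 < n
  zero : x 0 = 0
  coarse : ∀ i < n, x (i + 1) - x i = H
  fine : ∀ i, n ≤ i → x (i + 1) - x i = h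
  transition : x n = L - σ
  last : x (2 * n) = L
  h_pos : 0 < h
  h_le_H : h ≤ H
  H_le : H ≤ 4 * L * ν
  h_le : h ≤ 2 * ε * ν
  le_H : L ≤ H * (2 * n : ℕ)
  inv_le : ((2 * n : ℕ) : ℝ)⁻¹ ≤ 2 * ν
  ν_le : ν ≤ 1
  alternative : H = h ∨ Real.exp (-σ / ε) = ((2 * n : ℕ) : ℝ)⁻¹

/-- The properties of the time mesh used in the error analysis; `M = 2 m`, and `μ` is `M⁻¹ ln M`.
Either the mesh is uniform, or `e^{-αt/ε}` has decayed to `O(μ)` at the transition point. -/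
structure TimeMesh (T α C₂ ε τ K k μ : ℝ) (m : ℕ) (t : ℕ → ℝ) : Prop where
  zero : t 0 = 0
  fine : ∀ j < m, t (j + 1) - t j = k
  coarse : ∀ j, m ≤ j → t (j + 1) - t j = K
  transition : t m = τ
  last : t (2 * m) = T
  k_pos : 0 < k
  k_le_K : k ≤ K
  K_le : K ≤ 4 * T * μ
  k_le : k ≤ 2 * C₂ * ε * μ
  μ_nonneg : 0 ≤ μ
  alternative : K = k ∨ Real.exp (-(α * τ) / ε) ≤ 2 * μ

/-- `1/2` is a convenient lower bound for `ln 2`. -/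
lemma half_le_log {n : ℕ} (hn : 0 < n) : 1 / 2 ≤ Real.log ((2 * n : ℕ) : ℝ) := by
  have h1 : (2 : ℝ) ≤ ((2 * n : ℕ) : ℝ) := by
    have : 2 ≤ 2 * n := by omega
    exact_mod_cast this
  have h2 := Real.log_le_log (by norm_num) h1
  linarith [Real.log_two_gt_d9]

lemma inv_le_two_mul_log {n : ℕ} (hn : 0 < n) :
    ((2 * n : ℕ) : ℝ)⁻¹ ≤ 2 * (((2 * n : ℕ) : ℝ)⁻¹ * Real.log ((2 * n : ℕ) : ℝ)) := by
  have h1 := half_le_log hn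
  have h2 : 0 ≤ ((2 * n : ℕ) : ℝ)⁻¹ := by positivity
  nlinarith

lemma spaceMesh {L ε : ℝ} (hL : 0 < L) (hε : 0 < ε) {n : ℕ} (hn : 0 < n) :
    SpaceMesh L ε (sigma L ε (2 * n)) (coarseX L ε (2 * n)) (fineX L ε (2 * n))
      (((2 * n : ℕ) : ℝ)⁻¹ * Real.log ((2 * n : ℕ) : ℝ)) n (meshX L ε (2 * n)) := by
  have hlog := half_le_log hn
  have hinv := inv_le_two_mul_log hn
  have hN0 : (0 : ℝ) < ((2 * n : ℕ) : ℝ) := by positivity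
  have hn0 : (0 : ℝ) < n := by positivity
  set N : ℝ := ((2 * n : ℕ) : ℝ) with hN
  have hN2 : N = 2 * n := by rw [hN]; push_cast; ring
  set σ := sigma L ε (2 * n) with hσ
  have hσ1 : σ ≤ L / 2 := min_le_left _ _
  have hσ2 : σ ≤ ε * Real.log N := min_le_right _ _
  have hσ0 : 0 < σ := lt_min (by linarith) (mul_pos hε (by linarith))
  have hH : coarseX L ε (2 * n) = 2 * (L - σ) / N := rfl
  have hh : fineX L ε (2 * n) = 2 * σ / N := rfl
  have hnH : n * coarseX L ε (2 * n) = L - σ := by rw [hH, hN2]; field_simp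
  have hnh : n * fineX L ε (2 * n) = σ := by rw [hh, hN2]; field_simp
  have hhalf : 2 * n / 2 = n := by omega
  have hle : ∀ i ≤ n, meshX L ε (2 * n) i = i * coarseX L ε (2 * n) := fun i hi => by
    rw [meshX, hhalf, if_pos hi]
  have hge : ∀ i, n ≤ i →
      meshX L ε (2 * n) i = L - σ + ((i : ℝ) - n) * fineX L ε (2 * n) := fun i hi => by
    rcases hi.eq_or_lt with rfl | hi
    · rw [hle _ le_rfl, hnH]; ring
    · rw [meshX, hhalf, if_neg (by omega), ← hN, hN2, ← hσ]
      congr 3; ring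
  refine ⟨hn, ?_, fun i hi => ?_, fun i hi => ?_, ?_, ?_, ?_, ?_, ?_, ?_, ?_, hinv, ?_, ?_⟩
  · rw [hle 0 (by omega)]; simp
  · rw [hle _ hi, hle _ (by omega)]; push_cast; ring
  · rw [hge _ (by omega), hge _ hi]; push_cast; ring
  · rw [hle _ le_rfl, hnH]
  · rw [hge _ (by omega)]; push_cast; linarith
  · rw [hh]; positivity
  · rw [hH, hh]; gcongr; linarith
  · rw [hH, div_eq_mul_inv]
    have : 2 * (L - σ) * N⁻¹ ≤ 2 * L * N⁻¹ := by gcongr; linarith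
    have := mul_le_mul_of_nonneg_left hinv (show 0 ≤ 2 * L by linarith)
    linarith
  · rw [hh, div_eq_mul_inv]
    calc 2 * σ * N⁻¹ ≤ 2 * (ε * Real.log N) * N⁻¹ := by gcongr
      _ = _ := by ring
  · rw [hH, div_mul_cancel₀ _ hN0.ne']; linarith
  · have := Real.log_le_sub_one_of_pos hN0
    rw [inv_mul_le_iff₀ hN0]; linarith
  · rcases min_choice (L / 2) (ε * Real.log N) with h | h
    · left
      have : σ = L / 2 := h
      rw [hH, hh, this]; ring
    · right
      have : σ = ε * Real.log N := h
      rw [this, neg_div, mul_div_cancel_left₀ _ hε.ne', Real.exp_neg, Real.exp_log hN0]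

lemma timeMesh {T α C₂ ε : ℝ} (hT : 0 < T) (hα : 0 < α) (hC₂ : α⁻¹ < C₂) (hε : 0 < ε) {m : ℕ}
    (hm : 0 < m) :
    TimeMesh T α C₂ ε (tau T C₂ ε (2 * m)) (coarseT T C₂ ε (2 * m)) (fineT T C₂ ε (2 * m))
      (((2 * m : ℕ) : ℝ)⁻¹ * Real.log ((2 * m : ℕ) : ℝ)) m (meshT T C₂ ε (2 * m)) := by
  have hlog := half_le_log hm
  have hinv := inv_le_two_mul_log hm
  have hC0 : 0 < C₂ := (inv_pos.2 hα).trans hC₂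
  have hM0 : (0 : ℝ) < ((2 * m : ℕ) : ℝ) := by positivity
  have hm0 : (0 : ℝ) < m := by positivity
  set M : ℝ := ((2 * m : ℕ) : ℝ) with hM
  have hM2 : M = 2 * m := by rw [hM]; push_cast; ring
  set τ := tau T C₂ ε (2 * m) with hτ
  have hτ1 : τ ≤ T / 2 := min_le_left _ _
  have hτ2 : τ ≤ C₂ * ε * Real.log M := min_le_right _ _
  have hτ0 : 0 < τ := lt_min (by linarith) (mul_pos (by positivity) (by linarith))
  have hK : coarseT T C₂ ε (2 * m) = 2 * (T - τ) / M := rfl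
  have hk : fineT T C₂ ε (2 * m) = 2 * τ / M := rfl
  have hmK : m * coarseT T C₂ ε (2 * m) = T - τ := by rw [hK, hM2]; field_simp
  have hmk : m * fineT T C₂ ε (2 * m) = τ := by rw [hk, hM2]; field_simp
  have hhalf : 2 * m / 2 = m := by omega
  have hle : ∀ i ≤ m, meshT T C₂ ε (2 * m) i = i * fineT T C₂ ε (2 * m) := fun i hi => by
    rw [meshT, hhalf, if_pos hi]
  have hge : ∀ i, m ≤ i →
      meshT T C₂ ε (2 * m) i = τ + ((i : ℝ) - m) * coarseT T C₂ ε (2 * m) := fun i hi => by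
    rcases hi.eq_or_lt with rfl | hi
    · rw [hle _ le_rfl, hmk]; ring
    · rw [meshT, hhalf, if_neg (by omega), ← hM, hM2, ← hτ]
      congr 3; ring
  refine ⟨?_, fun i hi => ?_, fun i hi => ?_, ?_, ?_, ?_, ?_, ?_, ?_, ?_, ?_⟩
  · rw [hle 0 (by omega)]; simp
  · rw [hle _ hi, hle _ (by omega)]; push_cast; ring
  · rw [hge _ (by omega), hge _ hi]; push_cast; ring
  · rw [hle _ le_rfl, hmk]
  · rw [hge _ (by omega)]; push_cast; linarith
  · rw [hk]; positivity
  · rw [hK, hk]; gcongr; linarith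
  · rw [hK, div_eq_mul_inv]
    have : 2 * (T - τ) * M⁻¹ ≤ 2 * T * M⁻¹ := by gcongr; linarith
    have := mul_le_mul_of_nonneg_left hinv (show 0 ≤ 2 * T by linarith)
    linarith
  · rw [hk, div_eq_mul_inv]
    calc 2 * τ * M⁻¹ ≤ 2 * (C₂ * ε * Real.log M) * M⁻¹ := by gcongr
      _ = _ := by ring
  · exact mul_nonneg (by positivity) (by linarith)
  · rcases min_choice (T / 2) (C₂ * ε * Real.log M) with h | h
    · left
      have : τ = T / 2 := h
      rw [hK, hk, this]; ring
    · right
      have h1 : τ = C₂ * ε * Real.log M := h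
      refine le_trans ?_ hinv
      rw [h1, ← Real.exp_log (inv_pos.2 hM0), Real.log_inv]
      apply Real.exp_le_exp.2
      -- the layer has decayed to `M⁻¹` at `τ` because `α C₂ ≥ 1`
      have h2 : 1 ≤ α * C₂ := by
        have := mul_lt_mul_of_pos_left hC₂ hα
        rw [mul_inv_cancel₀ hα.ne'] at this
        exact this.le
      have h3 : -(α * (C₂ * ε * Real.log M)) / ε = -(α * C₂ * Real.log M) := by
        field_simp
      rw [h3]
      nlinarith

namespace SpaceMesh
variable {L ε σ H h ν : ℝ} {n : ℕ} {x : ℕ → ℝ}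

lemma H_pos (S : SpaceMesh L ε σ H h ν n x) : 0 < H := S.h_pos.trans_le S.h_le_H

lemma step (S : SpaceMesh L ε σ H h ν n x) (i : ℕ) :
    (i < n ∧ x (i + 1) - x i = H) ∨ (n ≤ i ∧ x (i + 1) - x i = h) := by
  rcases lt_or_ge i n with hi | hi
  · exact Or.inl ⟨hi, S.coarse i hi⟩
  · exact Or.inr ⟨hi, S.fine i hi⟩

lemma step_pos (S : SpaceMesh L ε σ H h ν n x) (i : ℕ) : 0 < x (i + 1) - x i := by
  rcases S.step i with ⟨-, e⟩ | ⟨-, e⟩ <;> rw [e]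
  exacts [S.H_pos, S.h_pos]

lemma strictMono (S : SpaceMesh L ε σ H h ν n x) : StrictMono x :=
  strictMono_nat_of_lt_succ fun i => sub_pos.1 (S.step_pos i)

lemma mem (S : SpaceMesh L ε σ H h ν n x) {i : ℕ} (hi : i ≤ 2 * n) : x i ∈ Icc 0 L :=
  ⟨by rw [← S.zero]; exact S.strictMono.monotone (Nat.zero_le i),
    by rw [← S.last]; exact S.strictMono.monotone hi⟩

lemma ν_nonneg (S : SpaceMesh L ε σ H h ν n x) : 0 ≤ ν := by
  have h1 : (0 : ℝ) ≤ ((2 * n : ℕ) : ℝ)⁻¹ := by positivity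
  linarith [S.inv_le]

lemma step_le (S : SpaceMesh L ε σ H h ν n x) (i : ℕ) : x (i + 1) - x i ≤ 4 * L * ν := by
  rcases S.step i with ⟨-, e⟩ | ⟨-, e⟩ <;> rw [e]
  exacts [S.H_le, S.h_le_H.trans S.H_le]

/-- On the coarse mesh the layer function is at most `N⁻¹`. -/
lemma layer_coarse_le (S : SpaceMesh L ε σ H h ν n x) (hε : 0 < ε)
    (hσ : Real.exp (-σ / ε) = ((2 * n : ℕ) : ℝ)⁻¹) {i : ℕ} (hi : i ≤ n) :
    layer L ε (x i) ≤ ((2 * n : ℕ) : ℝ)⁻¹ := by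
  have h1 : x i ≤ L - σ := by rw [← S.transition]; exact S.strictMono.monotone hi
  rw [← hσ]
  have := layer_mono hε (L := L) h1
  rwa [show layer L ε (L - σ) = Real.exp (-σ / ε) by unfold layer; congr 2; ring] at this

lemma layer_step_le_of_le (hε : 0 < ε) {i : ℕ}
    (h1 : x (i + 1) - x i ≤ 2 * ε * ν) :
    layer L ε (x (i + 1)) - layer L ε (x i) ≤ 2 * ν * layer L ε (x (i + 1)) := by
  refine (layer_sub_le hε).trans ?_
  rw [← mul_assoc]
  refine mul_le_mul_of_nonneg_right ?_ (layer_pos _ _ _).le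
  rw [← div_eq_mul_inv, div_le_iff₀ hε]
  linarith

lemma layer_step_le (S : SpaceMesh L ε σ H h ν n x) (hε : 0 < ε) {i : ℕ} (hi : i < 2 * n) :
    layer L ε (x (i + 1)) - layer L ε (x i) ≤ 2 * ν := by
  have hν := S.ν_nonneg
  have hl1 := layer_le_one hε (S.mem (i := i + 1) (by omega)).2
  have key : x (i + 1) - x i ≤ 2 * ε * ν →
      layer L ε (x (i + 1)) - layer L ε (x i) ≤ 2 * ν := fun h1 =>
    (layer_step_le_of_le hε h1).trans (by nlinarith)
  rcases S.step i with ⟨hi, e⟩ | ⟨-, e⟩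
  · rcases S.alternative with hA | hB
    · exact key (by rw [e, hA]; exact S.h_le)
    · have h1 := S.layer_coarse_le hε hB (i := i + 1) hi
      linarith [layer_pos L ε (x i), S.inv_le]
  · exact key (by rw [e]; exact S.h_le)

end SpaceMesh

namespace TimeMesh
variable {T α C₂ ε τ K k μ : ℝ} {m : ℕ} {t : ℕ → ℝ}

lemma step (S : TimeMesh T α C₂ ε τ K k μ m t) (j : ℕ) :
    (j < m ∧ t (j + 1) - t j = k) ∨ (m ≤ j ∧ t (j + 1) - t j = K) := by
  rcases lt_or_ge j m with hj | hj
  · exact Or.inl ⟨hj, S.fine j hj⟩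
  · exact Or.inr ⟨hj, S.coarse j hj⟩

lemma step_pos (S : TimeMesh T α C₂ ε τ K k μ m t) (j : ℕ) : 0 < t (j + 1) - t j := by
  rcases S.step j with ⟨-, e⟩ | ⟨-, e⟩ <;> rw [e]
  exacts [S.k_pos, S.k_pos.trans_le S.k_le_K]

lemma strictMono (S : TimeMesh T α C₂ ε τ K k μ m t) : StrictMono t :=
  strictMono_nat_of_lt_succ fun j => sub_pos.1 (S.step_pos j)

lemma mem (S : TimeMesh T α C₂ ε τ K k μ m t) {j : ℕ} (hj : j ≤ 2 * m) : t j ∈ Icc 0 T :=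
  ⟨by rw [← S.zero]; exact S.strictMono.monotone (Nat.zero_le j),
    by rw [← S.last]; exact S.strictMono.monotone hj⟩

lemma step_le (S : TimeMesh T α C₂ ε τ K k μ m t) (j : ℕ) : t (j + 1) - t j ≤ 4 * T * μ := by
  rcases S.step j with ⟨-, e⟩ | ⟨-, e⟩ <;> rw [e]
  exacts [S.k_le_K.trans S.K_le, S.K_le]

/-- The increment of the initial layer over one time step: on the fine mesh because the step is
`O(ε μ)`, on the coarse mesh because the layer itself has decayed to `O(μ)`. -/
lemma cornerLayer_step_le (S : TimeMesh T α C₂ ε τ K k μ m t) (hε : 0 < ε) (hα : 0 < α)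
    (hC₂ : 0 < C₂) {L x : ℝ} {j : ℕ} (hj : j < 2 * m) :
    cornerLayer L α ε x (t j) - cornerLayer L α ε x (t (j + 1)) ≤
      (2 * α * C₂ + 2) * μ * layer L ε x := by
  have hμ := S.μ_nonneg
  have hl := layer_pos L ε x
  have ht0 := (S.mem (j := j) (by omega)).1
  have key : t (j + 1) - t j ≤ 2 * C₂ * ε * μ →
      cornerLayer L α ε x (t j) - cornerLayer L α ε x (t (j + 1)) ≤
      (2 * α * C₂ + 2) * μ * layer L ε x := fun h1 => by
    have h2 := cornerLayer_le_layer L (x := x) hε hα.le ht0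
    have h3 : 0 < cornerLayer L α ε x (t j) := cornerLayer_pos _ _ _ _ _
    have h0 := S.step_pos j
    calc _ ≤ α * (t (j + 1) - t j) * (ε⁻¹ * cornerLayer L α ε x (t j)) := cornerLayer_sub_le hε
      _ ≤ α * (2 * C₂ * ε * μ) * (ε⁻¹ * layer L ε x) := by gcongr
      _ = 2 * α * C₂ * μ * layer L ε x := by field_simp
      _ ≤ _ := by
        have : 0 ≤ 2 * μ * layer L ε x := by positivity
        linarith
  rcases S.step j with ⟨-, e⟩ | ⟨hj', e⟩
  · exact key (by rw [e]; exact S.k_le)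
  · rcases S.alternative with hA | hB
    · exact key (by rw [e, hA]; exact S.k_le)
    · have h1 : τ ≤ t j := by rw [← S.transition]; exact S.strictMono.monotone hj'
      have h2 : cornerLayer L α ε x (t j) ≤ cornerLayer L α ε x τ :=
        cornerLayer_le L hε (by nlinarith)
      rw [cornerLayer_eq L α ε x τ] at h2
      have h3 := mul_le_mul_of_nonneg_left hB hl.le
      have h4 := cornerLayer_pos L α ε x (t (j + 1))
      have h5 : 0 ≤ 2 * α * C₂ * μ * layer L ε x := by positivity
      linarith

end TimeMesh

/-! ### Consistency and barriers -/

/-- The factor that multiplies `D_x^-` in the fitted scheme with `2 n` space intervals, `ρ = H / ε`;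
the transition point has the index `n`. -/
noncomputable def fittingFactor (n : ℕ) (ρ : ℝ) (i : ℕ) : ℝ :=
  if i = n then ρ / (1 - Real.exp (-ρ)) else 1

lemma one_sub_exp_neg_pos {ρ : ℝ} (hρ : 0 < ρ) : 0 < 1 - Real.exp (-ρ) := by
  rw [sub_pos, Real.exp_lt_one_iff]; linarith

lemma mul_exp_neg_le (y : ℝ) : y * Real.exp (-y) ≤ 1 - Real.exp (-y) := by
  have h1 := Real.add_one_le_exp y
  have h2 : Real.exp y * Real.exp (-y) = 1 := by rw [← Real.exp_add]; simp
  nlinarith [Real.exp_pos (-y)]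

lemma one_le_fittingFactor {n : ℕ} {ρ : ℝ} (hρ : 0 < ρ) (i : ℕ) : 1 ≤ fittingFactor n ρ i := by
  unfold fittingFactor
  split_ifs
  · rw [one_le_div (one_sub_exp_neg_pos hρ)]
    linarith [Real.add_one_le_exp (-ρ)]
  · exact le_rfl

lemma fittingFactor_le {n : ℕ} {ρ : ℝ} (hρ : 0 < ρ) (i : ℕ) : fittingFactor n ρ i ≤ 1 + ρ := by
  unfold fittingFactor
  split_ifs
  · rw [div_le_iff₀ (one_sub_exp_neg_pos hρ)]
    linarith [mul_exp_neg_le ρ]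
  · linarith

/-- The layer function on the doubled length scale, which is the main part of the barrier. On the
coarse mesh `e^{(x-Z)/ε}` itself is not dominated by its upwind derivative, while
`e^{(x-Z)/(2ε)}` is, thanks to `y e^{-y} ≤ 1 - e^{-y}`. -/
noncomputable def wideLayer (Z ε x : ℝ) : ℝ := Real.exp ((x - Z) / (2 * ε))

lemma wideLayer_pos (Z ε x : ℝ) : 0 < wideLayer Z ε x := Real.exp_pos _

lemma wideLayer_le_one {Z ε x : ℝ} (hε : 0 < ε) (hx : x ≤ Z) : wideLayer Z ε x ≤ 1 :=
  Real.exp_le_one_iff.2 (div_nonpos_of_nonpos_of_nonneg (by linarith) (by linarith))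

lemma layer_eq_wideLayer_mul (Z ε x : ℝ) : layer Z ε x = wideLayer Z ε x * wideLayer Z ε x := by
  rw [layer, wideLayer, ← Real.exp_add]; congr 1; ring

lemma wideLayer_sub (Z ε x s : ℝ) :
    wideLayer Z ε x - wideLayer Z ε (x - s) = wideLayer Z ε x * (1 - Real.exp (-(s / (2 * ε)))) := by
  have : wideLayer Z ε (x - s) = wideLayer Z ε x * Real.exp (-(s / (2 * ε))) := by
    rw [wideLayer, wideLayer, ← Real.exp_add]; congr 1; ring
  rw [this]; ring

/-- Coarse cells that lie at least one cell away from `Z`. -/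
lemma half_layer_le_of_gap {Z ε x H : ℝ} (hε : 0 < ε) (hH : 0 < H) (hx : x + H ≤ Z) :
    1 / 2 * (ε⁻¹ * layer Z ε x) ≤ (wideLayer Z ε x - wideLayer Z ε (x - H)) / H := by
  rw [wideLayer_sub, layer_eq_wideLayer_mul, le_div_iff₀ hH]
  have hW := wideLayer_pos Z ε x
  have h1 : wideLayer Z ε x ≤ Real.exp (-(H / (2 * ε))) := by
    apply Real.exp_le_exp.2
    rw [← neg_div]
    gcongr
    linarith
  have h2 := mul_exp_neg_le (H / (2 * ε))
  have h3 : 0 ≤ H / (2 * ε) := by positivity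
  have h4 : H / (2 * ε) * wideLayer Z ε x ≤ 1 - Real.exp (-(H / (2 * ε))) :=
    (mul_le_mul_of_nonneg_left h1 h3).trans h2
  have h5 := mul_le_mul_of_nonneg_left h4 hW.le
  refine le_trans (le_of_eq ?_) h5
  field_simp

/-- The cell at the transition point, where there is no such gap. With `y = H / (2ε)` the factor
`1 - e^{-y}` of the difference quotient, which may be much smaller than `y`, cancels against the
denominator `1 - e^{-2y}` of the fitting factor. -/
lemma half_layer_le_fitted {Z ε x H : ℝ} (hε : 0 < ε) (hH : 0 < H) (hx : x ≤ Z) :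
    1 / 2 * (ε⁻¹ * layer Z ε x) ≤ (H / ε) / (1 - Real.exp (-(H / ε))) *
      ((wideLayer Z ε x - wideLayer Z ε (x - H)) / H) := by
  rw [wideLayer_sub, layer_eq_wideLayer_mul]
  have hW := wideLayer_pos Z ε x
  have hW1 := wideLayer_le_one hε hx
  have e : Real.exp (-(H / ε)) = Real.exp (-(H / (2 * ε))) * Real.exp (-(H / (2 * ε))) := by
    rw [← Real.exp_add]; congr 1; field_simp; ring
  have h1 := one_sub_exp_neg_pos (show 0 < H / (2 * ε) by positivity)
  rw [e]
  set q := Real.exp (-(H / (2 * ε))) with hq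
  have hq0 : 0 < q := Real.exp_pos _
  have e2 : H / ε / (1 - q * q) * (wideLayer Z ε x * (1 - q) / H) =
      ε⁻¹ * wideLayer Z ε x / (1 + q) := by
    rw [show 1 - q * q = (1 - q) * (1 + q) by ring]
    field_simp
  rw [e2, le_div_iff₀ (by linarith)]
  have hεi : 0 < ε⁻¹ := inv_pos.2 hε
  have i1 : ε⁻¹ * (wideLayer Z ε x * wideLayer Z ε x) ≤ ε⁻¹ * (wideLayer Z ε x * 1) := by gcongr
  have i2 : 0 < ε⁻¹ * (wideLayer Z ε x * wideLayer Z ε x) := by positivity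
  nlinarith

/-- Fine cells. -/
lemma eighth_layer_le_fine {Z ε x h : ℝ} (hε : 0 < ε) (hh : 0 < h) (hx : x ≤ Z)
    (hle : h ≤ 2 * ε) :
    1 / 8 * (ε⁻¹ * layer Z ε x) ≤ (wideLayer Z ε x - wideLayer Z ε (x - h)) / h := by
  rw [wideLayer_sub, layer_eq_wideLayer_mul, le_div_iff₀ hh]
  have hW := wideLayer_pos Z ε x
  have hW1 := wideLayer_le_one hε hx
  have hy : h / (2 * ε) ≤ 1 := (div_le_one (by positivity)).2 hle
  have h3 : 0 ≤ h / (2 * ε) := by positivity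
  have h1 : 1 / 4 ≤ Real.exp (-(h / (2 * ε))) := by
    have h4 : Real.exp (-1) ≤ Real.exp (-(h / (2 * ε))) := Real.exp_le_exp.2 (by linarith)
    have h5 : (1 : ℝ) / 4 ≤ Real.exp (-1) := by
      rw [Real.exp_neg, one_div]
      exact inv_anti₀ (Real.exp_pos 1) (by linarith [Real.exp_one_lt_d9])
    linarith
  have h2 := mul_exp_neg_le (h / (2 * ε))
  have h4 : h / (2 * ε) * (1 / 4) ≤ 1 - Real.exp (-(h / (2 * ε))) :=
    (mul_le_mul_of_nonneg_left h1 h3).trans h2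
  have h5 := mul_le_mul_of_nonneg_left h4 hW.le
  refine le_trans ?_ h5
  have h6 : wideLayer Z ε x * wideLayer Z ε x ≤ wideLayer Z ε x :=
    mul_le_of_le_one_left hW.le hW1
  have h7 : 1 / 8 * (ε⁻¹ * (wideLayer Z ε x * wideLayer Z ε x)) * h =
      1 / 4 * (h / (2 * ε)) * (wideLayer Z ε x * wideLayer Z ε x) := by
    field_simp; ring
  rw [h7]
  nlinarith [mul_nonneg h3 (sub_nonneg.2 h6)]

/-- The part of the barrier for residuals of size `1 + ε⁻¹ e^{(x-L)/ε}`. -/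
noncomputable def layerBarrier (L ε : ℝ) (x : ℕ → ℝ) (i : ℕ) : ℝ := x i + wideLayer L ε (x i)

/-- The part of the barrier that handles the unresolved layer on the coarse mesh: a layer of height
`N⁻¹` at the transition point, and a jump of height `H` there, which absorbs the
inconsistency of the fitted operator. -/
noncomputable def transitionBarrier (L ε σ H : ℝ) (n : ℕ) (x : ℕ → ℝ) (i : ℕ) : ℝ :=
  ((2 * n : ℕ) : ℝ)⁻¹ * wideLayer (L - σ) ε (min (x i) (L - σ)) + if n ≤ i then H else 0

namespace SpaceMesh
variable {L ε σ H h ν : ℝ} {n : ℕ} {x : ℕ → ℝ}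

/-- The cases are the transition cell, the other coarse cells, and the fine cells. -/
lemma layerBarrier_residual (S : SpaceMesh L ε σ H h ν n x) (hε : 0 < ε) {i : ℕ}
    (hi : i < 2 * n) :
    1 / 8 * (1 + ε⁻¹ * layer L ε (x (i + 1))) ≤ fittingFactor n (H / ε) (i + 1) *
      ((layerBarrier L ε x (i + 1) - layerBarrier L ε x i) / (x (i + 1) - x i)) := by
  have hH := S.H_pos
  have hs := S.step_pos i
  have hρ : 0 < H / ε := by positivity
  have hθ := one_le_fittingFactor (n := n) hρ (i + 1)
  have hxL := (S.mem (i := i + 1) (by omega)).2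
  have key : 1 / 8 * (ε⁻¹ * layer L ε (x (i + 1))) ≤ fittingFactor n (H / ε) (i + 1) *
      ((wideLayer L ε (x (i + 1)) - wideLayer L ε (x i)) / (x (i + 1) - x i)) := by
    have hlp : 0 < ε⁻¹ * layer L ε (x (i + 1)) := mul_pos (inv_pos.2 hε) (layer_pos _ _ _)
    have exi : x i = x (i + 1) - (x (i + 1) - x i) := by ring
    rcases S.step i with ⟨hin, e⟩ | ⟨hin, e⟩
    · rw [e] at exi ⊢
      rw [exi]
      rcases (Nat.succ_le_of_lt hin).eq_or_lt with he | hlt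
      · rw [fittingFactor, if_pos he]
        have := half_layer_le_fitted (Z := L) hε hH hxL
        linarith
      · rw [fittingFactor, if_neg (by omega), one_mul]
        have h1 := S.coarse (i + 1) hlt
        have h2 := (S.mem (i := i + 2) (by omega)).2
        have := half_layer_le_of_gap (Z := L) (x := x (i + 1)) hε hH (by linarith)
        linarith
    · rw [e] at exi ⊢
      rw [exi, fittingFactor, if_neg (by omega), one_mul]
      refine eighth_layer_le_fine hε S.h_pos hxL (S.h_le.trans ?_)
      nlinarith [S.ν_le]
  have e : (layerBarrier L ε x (i + 1) - layerBarrier L ε x i) / (x (i + 1) - x i) =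
      1 + (wideLayer L ε (x (i + 1)) - wideLayer L ε (x i)) / (x (i + 1) - x i) := by
    unfold layerBarrier
    field_simp
    ring
  rw [e, mul_add, mul_one]
  linarith

lemma transitionBarrier_mono (S : SpaceMesh L ε σ H h ν n x) (hε : 0 < ε) (i : ℕ) :
    transitionBarrier L ε σ H n x i ≤ transitionBarrier L ε σ H n x (i + 1) := by
  have hH := S.H_pos
  have h1 : x i ≤ x (i + 1) := S.strictMono.monotone (Nat.le_succ i)
  unfold transitionBarrier wideLayer
  gcongr
  split_ifs
  · exact le_rfl
  · omega
  · exact hH.le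
  · exact le_rfl

/-- On the coarse mesh the layer function is `N⁻¹` times that of the point `L - σ`, so that the estimates
for one cell apply with `Z = L - σ`. The jump contributes exactly the fitting factor. -/
lemma transitionBarrier_residual (S : SpaceMesh L ε σ H h ν n x) (hε : 0 < ε)
    (hσ : Real.exp (-σ / ε) = ((2 * n : ℕ) : ℝ)⁻¹) {i : ℕ} (hi : i < n) :
    1 / 2 * (ε⁻¹ * layer L ε (x (i + 1))) +
      (if i + 1 = n then fittingFactor n (H / ε) (i + 1) else 0) ≤
      fittingFactor n (H / ε) (i + 1) *
        ((transitionBarrier L ε σ H n x (i + 1) - transitionBarrier L ε σ H n x i) /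
          (x (i + 1) - x i)) := by
  have hH := S.H_pos
  have hle : ∀ k ≤ n, min (x k) (L - σ) = x k := fun k hk =>
    min_eq_left (by rw [← S.transition]; exact S.strictMono.monotone hk)
  have e := S.coarse i hi
  have exi : x i = x (i + 1) - H := by linarith
  have hN : 0 ≤ ((2 * n : ℕ) : ℝ)⁻¹ := by positivity
  have hlay : layer L ε (x (i + 1)) = ((2 * n : ℕ) : ℝ)⁻¹ * layer (L - σ) ε (x (i + 1)) := by
    rw [← hσ, layer, layer, ← Real.exp_add]; congr 1; ring
  have hx1 : x (i + 1) ≤ L - σ := by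
    rw [← S.transition]; exact S.strictMono.monotone hi
  unfold transitionBarrier
  rw [hle _ hi, hle _ hi.le, e, hlay, exi, if_neg (show ¬ n ≤ i by omega)]
  rcases (Nat.succ_le_of_lt hi).eq_or_lt with he | hlt
  · have h1 := mul_le_mul_of_nonneg_left (half_layer_le_fitted (x := x (i + 1)) hε hH hx1) hN
    rw [if_pos he, if_pos (show n ≤ i + 1 by omega)]
    simp only [fittingFactor, if_pos he]
    set θ := H / ε / (1 - Real.exp (-(H / ε)))
    have e2 : θ * ((((2 * n : ℕ) : ℝ)⁻¹ * wideLayer (L - σ) ε (x (i + 1)) + H -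
        (((2 * n : ℕ) : ℝ)⁻¹ * wideLayer (L - σ) ε (x (i + 1) - H) + 0)) / H) =
        ((2 * n : ℕ) : ℝ)⁻¹ * (θ * ((wideLayer (L - σ) ε (x (i + 1)) -
          wideLayer (L - σ) ε (x (i + 1) - H)) / H)) + θ := by
      field_simp
      ring
    rw [e2]
    linarith
  · have h2 := S.coarse (i + 1) hlt
    have h3 : x (i + 2) ≤ L - σ := by
      rw [← S.transition]; exact S.strictMono.monotone hlt
    have h1 := mul_le_mul_of_nonneg_left
      (half_layer_le_of_gap (Z := L - σ) (x := x (i + 1)) hε hH (by linarith)) hN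
    have hne : i + 1 ≠ n := by omega
    rw [if_neg hne, if_neg (show ¬ n ≤ i + 1 by omega)]
    simp only [fittingFactor, if_neg hne, one_mul, add_zero]
    rw [← mul_sub, mul_div_assoc]
    linarith

lemma layerBarrier_bounds (S : SpaceMesh L ε σ H h ν n x) (hε : 0 < ε) {i : ℕ} (hi : i ≤ 2 * n) :
    0 ≤ layerBarrier L ε x i ∧ layerBarrier L ε x i ≤ L + 1 := by
  have h1 := S.mem hi
  have h2 := wideLayer_pos L ε (x i)
  have h3 := wideLayer_le_one hε h1.2
  unfold layerBarrier
  constructor <;> linarith [h1.1, h1.2]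

lemma transitionBarrier_bounds (S : SpaceMesh L ε σ H h ν n x) (hε : 0 < ε) (i : ℕ) :
    0 ≤ transitionBarrier L ε σ H n x i ∧ transitionBarrier L ε σ H n x i ≤ (4 * L + 2) * ν := by
  have hH := S.H_pos
  have hN : 0 ≤ ((2 * n : ℕ) : ℝ)⁻¹ := by positivity
  have h2 := wideLayer_pos (L - σ) ε (min (x i) (L - σ))
  have h3 := wideLayer_le_one hε (min_le_right (x i) (L - σ))
  have h4 := mul_le_mul_of_nonneg_left h3 hN
  have h5 := S.inv_le
  have h6 := S.H_le
  unfold transitionBarrier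
  have h7 : 0 ≤ (if n ≤ i then H else 0) ∧ (if n ≤ i then H else 0) ≤ H := by
    split_ifs <;> constructor <;> linarith
  constructor
  · have := h7.1; positivity
  · linarith [h7.2]

end SpaceMesh

section residual
variable {L T α C₂ K₀ ε σ H h ν τ K k μ : ℝ} {n m : ℕ} {x t : ℕ → ℝ} {u ux ut : ℝ → ℝ → ℝ}

/-- The consistency error in time. -/
lemma LayerBounds.time_residual (B : LayerBounds L T α K₀ ε u ux ut) (hK₀ : 0 ≤ K₀) (hε : 0 < ε)
    (hα : 0 < α) (hC₂ : 0 < C₂) (hT : 0 < T) (S : TimeMesh T α C₂ ε τ K k μ m t) {y : ℝ}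
    (hy : y ∈ Ioc 0 L) {j : ℕ} (hj : j < 2 * m) :
    |(u y (t (j + 1)) - u y (t j)) / (t (j + 1) - t j) - ut y (t (j + 1))| ≤
      K₀ * (4 * T + 2 * α * C₂ + 2) * μ * (1 + ε⁻¹ * layer L ε y) := by
  have hs := S.step_pos j
  have hμ := S.μ_nonneg
  have hl := layer_pos L ε y
  have h1 := B.taylor_t y hy (t j) (t (j + 1)) (S.mem (by omega)).1 (by linarith)
    (S.mem (by omega)).2
  have e : (u y (t (j + 1)) - u y (t j)) / (t (j + 1) - t j) - ut y (t (j + 1)) =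
      (u y (t (j + 1)) - u y (t j) - (t (j + 1) - t j) * ut y (t (j + 1))) /
        (t (j + 1) - t j) := by
    field_simp
  rw [e, abs_div, abs_of_pos hs, div_le_iff₀ hs]
  have h2 := S.cornerLayer_step_le hε hα hC₂ (L := L) (x := y) hj
  have h3 := S.step_le j
  have h4 := mul_le_mul_of_nonneg_left h2 (inv_pos.2 hε).le
  have h5 : (t (j + 1) - t j) + ε⁻¹ * (cornerLayer L α ε y (t j) - cornerLayer L α ε y (t (j + 1))) ≤
      (4 * T + 2 * α * C₂ + 2) * μ * (1 + ε⁻¹ * layer L ε y) := by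
    have p1 : 0 ≤ 4 * T * μ * (ε⁻¹ * layer L ε y) := by positivity
    have p2 : 0 ≤ (2 * α * C₂ + 2) * μ := by positivity
    linarith
  have h6 := mul_le_mul_of_nonneg_left h5 (mul_nonneg hs.le hK₀)
  linarith

lemma LayerBounds.space_quotient (B : LayerBounds L T α K₀ ε u ux ut)
    (S : SpaceMesh L ε σ H h ν n x) {s : ℝ} (hs : s ∈ Ioc 0 T) {i : ℕ} (hi : i < 2 * n) :
    |(u (x (i + 1)) s - u (x i) s) / (x (i + 1) - x i) - ux (x (i + 1)) s| ≤
      K₀ * ((x (i + 1) - x i) + ε⁻¹ * (layer L ε (x (i + 1)) - layer L ε (x i))) ∧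
    |(u (x (i + 1)) s - u (x i) s) / (x (i + 1) - x i)| ≤
      K₀ * (1 + (layer L ε (x (i + 1)) - layer L ε (x i)) / (x (i + 1) - x i)) := by
  have hp := S.step_pos i
  have h1 := B.taylor_x s hs (x i) (x (i + 1)) (S.mem (by omega)).1 (by linarith)
    (S.mem (by omega)).2
  have h2 := B.lip_x s ⟨hs.1.le, hs.2⟩ (x i) (x (i + 1)) (S.mem (by omega)).1 (by linarith)
    (S.mem (by omega)).2
  constructor
  · have e : (u (x (i + 1)) s - u (x i) s) / (x (i + 1) - x i) - ux (x (i + 1)) s =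
      (u (x (i + 1)) s - u (x i) s - (x (i + 1) - x i) * ux (x (i + 1)) s) /
        (x (i + 1) - x i) := by
      field_simp
    rw [e, abs_div, abs_of_pos hp, div_le_iff₀ hp]
    linarith
  · rw [abs_div, abs_of_pos hp, div_le_iff₀ hp]
    refine h2.trans (le_of_eq ?_)
    field_simp

/-- The consistency error in space. On cells of width `O(ε ν)` it is of size `ν (1 + ε⁻¹ e^{(x-L)/ε})`.
On a coarse cell the layer part is not small, but there the layer function is at most `N⁻¹`, and
`transitionBarrier` dominates it. -/
lemma LayerBounds.space_residual (B : LayerBounds L T α K₀ ε u ux ut) (hK₀ : 0 ≤ K₀) (hε : 0 < ε)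
    (hL : 0 < L) (S : SpaceMesh L ε σ H h ν n x) {s : ℝ} (hs : s ∈ Ioc 0 T) {i : ℕ}
    (hi : i < 2 * n) :
    |fittingFactor n (H / ε) (i + 1) * ((u (x (i + 1)) s - u (x i) s) / (x (i + 1) - x i)) -
      ux (x (i + 1)) s| ≤
    K₀ * (4 * L + 4) * ν * (1 + ε⁻¹ * layer L ε (x (i + 1))) +
    K₀ * (4 + L⁻¹) * (fittingFactor n (H / ε) (i + 1) *
        ((transitionBarrier L ε σ H n x (i + 1) - transitionBarrier L ε σ H n x i) /
          (x (i + 1) - x i))) := by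
  have hH := S.H_pos
  have hp := S.step_pos i
  have hν := S.ν_nonneg
  have hρ : 0 < H / ε := by positivity
  have hθ := one_le_fittingFactor (n := n) hρ (i + 1)
  have hεi := inv_pos.2 hε
  have hl := layer_pos L ε (x (i + 1))
  have hl0 := layer_pos L ε (x i)
  obtain ⟨q1, q2⟩ := B.space_quotient S hs hi
  have hr : 0 ≤ K₀ * (4 + L⁻¹) * (fittingFactor n (H / ε) (i + 1) *
        ((transitionBarrier L ε σ H n x (i + 1) - transitionBarrier L ε σ H n x i) /
          (x (i + 1) - x i))) := by
    have := sub_nonneg.2 (S.transitionBarrier_mono hε i)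
    positivity
  -- cells whose width is `O(ε ν)`
  have small : x (i + 1) - x i ≤ 2 * ε * ν → (i + 1 = n → H ≤ 2 * ε * ν) →
      |fittingFactor n (H / ε) (i + 1) * ((u (x (i + 1)) s - u (x i) s) / (x (i + 1) - x i)) -
      ux (x (i + 1)) s| ≤ K₀ * (4 * L + 4) * ν * (1 + ε⁻¹ * layer L ε (x (i + 1))) := by
    intro hsm hfit
    have d1 := SpaceMesh.layer_step_le_of_le (L := L) hε hsm
    have d2 : (layer L ε (x (i + 1)) - layer L ε (x i)) / (x (i + 1) - x i) ≤
        ε⁻¹ * layer L ε (x (i + 1)) := by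
      rw [div_le_iff₀ hp]
      linarith [layer_sub_le (L := L) (x := x (i + 1)) (y := x i) hε]
    have hf : fittingFactor n (H / ε) (i + 1) - 1 ≤ 2 * ν := by
      by_cases he : i + 1 = n
      · have h1 := fittingFactor_le (n := n) hρ (i + 1)
        have h2 : H / ε ≤ 2 * ν := by rw [div_le_iff₀ hε]; linarith [hfit he]
        linarith
      · rw [fittingFactor, if_neg he]; linarith
    set D := (u (x (i + 1)) s - u (x i) s) / (x (i + 1) - x i)
    set θ := fittingFactor n (H / ε) (i + 1)
    have e : θ * D - ux (x (i + 1)) s = (θ - 1) * D + (D - ux (x (i + 1)) s) := by ring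
    rw [e]
    refine (abs_add_le _ _).trans ?_
    rw [abs_mul, abs_of_nonneg (show 0 ≤ θ - 1 by linarith)]
    have i1 : (θ - 1) * |D| ≤ 2 * ν * (K₀ * (1 + ε⁻¹ * layer L ε (x (i + 1)))) := by
      refine mul_le_mul hf (q2.trans ?_) (abs_nonneg _) (by positivity)
      gcongr
    have i2 : K₀ * ((x (i + 1) - x i) + ε⁻¹ * (layer L ε (x (i + 1)) - layer L ε (x i))) ≤
        K₀ * (4 * L * ν + ε⁻¹ * (2 * ν * layer L ε (x (i + 1)))) := by
      have := S.step_le i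
      gcongr
    have i3 : 0 ≤ K₀ * (4 * L) * ν * (ε⁻¹ * layer L ε (x (i + 1))) := by positivity
    have i4 : 0 ≤ K₀ * ν := by positivity
    linarith
  have absorbed : x (i + 1) - x i ≤ 2 * ε * ν → (i + 1 = n → H ≤ 2 * ε * ν) → _ := fun h1 h2 =>
    (small h1 h2).trans (le_add_of_nonneg_right hr)
  rcases S.step i with ⟨hin, e⟩ | ⟨hin, e⟩
  · rcases S.alternative with hA | hB
    · exact absorbed (by rw [e, hA]; exact S.h_le) (fun _ => by rw [hA]; exact S.h_le)
    · have hb := S.transitionBarrier_residual hε hB hin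
      have hb' := mul_le_mul_of_nonneg_left hb (show 0 ≤ K₀ * (4 + L⁻¹) by positivity)
      have hEN := S.layer_coarse_le hε hB (i := i + 1) hin
      have pL : 0 < L⁻¹ := inv_pos.2 hL
      have p0 : 0 ≤ K₀ * (ε⁻¹ * layer L ε (x (i + 1))) := by positivity
      have p1 : 0 ≤ K₀ * L⁻¹ * (ε⁻¹ * layer L ε (x (i + 1))) := by positivity
      have p2 : 0 ≤ K₀ * (4 * L + 4) * ν * (ε⁻¹ * layer L ε (x (i + 1))) := by positivity
      have p3 : 0 ≤ K₀ * ν := by positivity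
      by_cases he : i + 1 = n
      · -- at the transition point `θ D_x u` and `u_x` are bounded separately: the first by `O(θ)`, which
        -- the jump of the barrier absorbs, and the second by the derivative bound
        rw [if_pos he] at hb'
        set D := (u (x (i + 1)) s - u (x i) s) / (x (i + 1) - x i)
        set θ := fittingFactor n (H / ε) (i + 1)
        have i1 := B.ux_bound (x (i + 1))
          ⟨(S.mem (i := i) (by omega)).1.trans_lt (by linarith), (S.mem (by omega)).2⟩ s hs
        have hδ : (layer L ε (x (i + 1)) - layer L ε (x i)) / (x (i + 1) - x i) ≤ L⁻¹ := by
          rw [e, div_le_iff₀ hH]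
          have h1 : ((2 * n : ℕ) : ℝ)⁻¹ ≤ L⁻¹ * H := by
            have hn0 : (0 : ℝ) < ((2 * n : ℕ) : ℝ) := by have := S.n_pos; positivity
            rw [inv_le_iff_one_le_mul₀ hn0, inv_mul_eq_div, div_mul_eq_mul_div,
              le_div_iff₀ hL, one_mul]
            exact S.le_H
          linarith
        have i2 : |θ * D| ≤ θ * (K₀ * (1 + L⁻¹)) := by
          rw [abs_mul, abs_of_nonneg (by linarith)]
          refine mul_le_mul_of_nonneg_left (q2.trans ?_) (by linarith)
          gcongr
        have i3 : K₀ ≤ K₀ * θ := le_mul_of_one_le_right hK₀ hθ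
        refine (abs_sub _ _).trans ?_
        have i4 : 0 ≤ K₀ * (4 * L + 4) * ν := by positivity
        linarith
      · rw [if_neg he] at hb'
        have eθ : fittingFactor n (H / ε) (i + 1) = 1 := by rw [fittingFactor, if_neg he]
        rw [eθ, one_mul] at hb' ⊢
        rw [one_mul]
        have i1 : K₀ * ((x (i + 1) - x i) + ε⁻¹ * (layer L ε (x (i + 1)) - layer L ε (x i))) ≤
            K₀ * (4 * L * ν + ε⁻¹ * layer L ε (x (i + 1))) := by
          have := S.step_le i
          gcongr
          linarith
        linarith
  · exact absorbed (by rw [e]; exact S.h_le) (fun h => by omega)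

end residual

/-! ### The error estimate -/

lemma fittedUpwind_eq (L T C₂ ε : ℝ) (n m : ℕ) (a b : ℝ → ℝ → ℝ) (U : ℕ → ℕ → ℝ) (i j : ℕ) :
    fittedUpwind L T C₂ ε (2 * n) (2 * m) a b U i j =
      backT (meshT T C₂ ε (2 * m)) U i j +
      a (meshX L ε (2 * n) i) (meshT T C₂ ε (2 * m) j) *
        fittingFactor n (coarseX L ε (2 * n) / ε) i * backX (meshX L ε (2 * n)) U i j +
      b (meshX L ε (2 * n) i) (meshT T C₂ ε (2 * m) j) * U i j := by
  have hn : 2 * n / 2 = n := by omega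
  simp only [fittedUpwind, fittingFactor, upwind, hn]
  split_ifs <;> ring

/-- The residual of the error is the consistency error; dividing by the coefficient `a θ ≥ α`
turns the time part into a term that the space barrier can absorb. -/
lemma abs_residual_le {α a θ Dt ut Dx ux Rt Rx D P₀ : ℝ} (hα : 0 < α) (ha : α ≤ a)
    (ht : |Dt - ut| ≤ Rt) (hx : |θ * Dx - ux| ≤ Rx) (hD : α⁻¹ * Rt + Rx ≤ D)
    (hr : P₀ = -(Dt - ut) - a * (θ * Dx - ux)) : |P₀| ≤ a * D := by
  have ha0 : 0 < a := hα.trans_le ha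
  have hRt : 0 ≤ Rt := (abs_nonneg _).trans ht
  have h1 : Rt ≤ a * (α⁻¹ * Rt) := by
    have : 1 ≤ a * α⁻¹ := by rw [← div_eq_mul_inv, one_le_div hα]; exact ha
    nlinarith
  have h2 : |P₀| ≤ |Dt - ut| + a * |θ * Dx - ux| := by
    rw [hr]
    refine (abs_sub _ _).trans ?_
    rw [abs_neg, abs_mul, abs_of_pos ha0]
  have h3 := mul_le_mul_of_nonneg_left hx ha0.le
  have h4 := mul_le_mul_of_nonneg_left hD ha0.le
  linarith

section
variable {L T α C₂ ε K₀ : ℝ} {a b f u : ℝ → ℝ → ℝ} {φ ψ : ℝ → ℝ}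

/-- The error at the mesh points. The barrier is a combination of `layerBarrier` and
`transitionBarrier`, whose coefficients are those of the consistency errors; the factor `8` is the
reciprocal of the constant in `SpaceMesh.layerBarrier_residual`. -/
lemma abs_sub_solution_le_of_mem_mesh (hL : 0 < L) (hT : 0 < T) (hα : 0 < α) (hC₂ : α⁻¹ < C₂)
    (hε : 0 < ε) (hK₀ : 0 ≤ K₀) (ha : ∀ x ∈ Icc 0 L, ∀ t ∈ Icc 0 T, α ≤ a x t)
    (hb : ∀ x ∈ Icc 0 L, ∀ t ∈ Icc 0 T, 0 ≤ b x t)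
    (B : LayerBounds L T α K₀ ε u (partialX L u) (partialT T u))
    (hu : IsSolution L T a b f φ ψ u) {n m : ℕ} (hn : 0 < n) (hm : 0 < m) {U : ℕ → ℕ → ℝ}
    (hU : IsDiscreteSolution L T C₂ ε (2 * n) (2 * m) a b f φ ψ U) {ν μ : ℝ}
    (hν : ν = ((2 * n : ℕ) : ℝ)⁻¹ * Real.log ((2 * n : ℕ) : ℝ))
    (hμ : μ = ((2 * m : ℕ) : ℝ)⁻¹ * Real.log ((2 * m : ℕ) : ℝ)) :
    ∀ j ≤ 2 * m, ∀ i ≤ 2 * n,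
      |U i j - u (meshX L ε (2 * n) i) (meshT T C₂ ε (2 * m) j)| ≤
        8 * (α⁻¹ * (K₀ * (4 * T + 2 * α * C₂ + 2) * μ) + K₀ * (4 * L + 4) * ν) * (L + 1) +
          K₀ * (4 + L⁻¹) * ((4 * L + 2) * ν) := by
  have S := spaceMesh hL hε hn
  have R := timeMesh hT hα hC₂ hε hm
  have hC₂' : 0 < C₂ := (inv_pos.2 hα).trans hC₂
  rw [← hν] at S
  rw [← hμ] at R
  have hν0 := S.ν_nonneg
  have hμ0 := R.μ_nonneg
  have hH := S.H_pos
  set x := meshX L ε (2 * n) with hxdef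
  set t := meshT T C₂ ε (2 * m) with htdef
  set H := coarseX L ε (2 * n) with hHdef
  set P := 8 * (α⁻¹ * (K₀ * (4 * T + 2 * α * C₂ + 2) * μ) + K₀ * (4 * L + 4) * ν) with hP
  set Q := K₀ * (4 + L⁻¹) with hQ
  have hP0 : 0 ≤ P := by positivity
  have hQ0 : 0 ≤ Q := by positivity
  set Y : ℕ → ℝ := fun i => P * layerBarrier L ε x i +
    Q * transitionBarrier L ε (sigma L ε (2 * n)) H n x i with hY
  have hY0 : ∀ i ≤ 2 * n, 0 ≤ Y i := fun i hi =>
    add_nonneg (mul_nonneg hP0 (S.layerBarrier_bounds hε hi).1)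
      (mul_nonneg hQ0 (S.transitionBarrier_bounds hε i).1)
  have hYle : ∀ i ≤ 2 * n, Y i ≤ P * (L + 1) + Q * ((4 * L + 2) * ν) := fun i hi =>
    add_le_add (mul_le_mul_of_nonneg_left (S.layerBarrier_bounds hε hi).2 hP0)
      (mul_le_mul_of_nonneg_left (S.transitionBarrier_bounds hε i).2 hQ0)
  have key := abs_le_of_residual_le (N := 2 * n) (M := 2 * m) (x := x) (t := t) (B := Y)
    (A := fun i j => a (x (i + 1)) (t (j + 1)) * fittingFactor n (H / ε) (i + 1))
    (b := fun i j => b (x (i + 1)) (t (j + 1))) (E := fun i j => U i j - u (x i) (t j))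
    (fun i _ => sub_pos.1 (S.step_pos i)) (fun j _ => sub_pos.1 (R.step_pos j))
    (fun i hi j hj => mul_nonneg
      (hα.le.trans (ha _ (S.mem (by omega)) _ (R.mem (by omega))))
      (zero_le_one.trans (one_le_fittingFactor (by positivity) _)))
    (fun i hi j hj => hb _ (S.mem (by omega)) _ (R.mem (by omega))) hY0
    (fun j hj => by
      have h1 := hU.inflow j hj
      have h2 := hu.inflow (t j) (R.mem hj)
      simp only [S.zero]
      linarith)
    (fun i hi => by
      have h1 := hU.initial i hi
      have h2 := hu.initial (x i) (S.mem hi)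
      simp only [R.zero]
      linarith)
    (fun i hi j hj => by
      have hx1 := S.step_pos i
      have ht1 := R.step_pos j
      have mx : x (i + 1) ∈ Ioc 0 L :=
        ⟨by linarith [(S.mem (i := i) (by omega)).1], (S.mem (by omega)).2⟩
      have mt : t (j + 1) ∈ Ioc 0 T :=
        ⟨by linarith [(R.mem (j := j) (by omega)).1], (R.mem (by omega)).2⟩
      have e1 := hU.equation (i + 1) (j + 1) (by omega) (by omega) (by omega) (by omega)
      rw [fittedUpwind_eq] at e1
      have e2 := hu.equation _ mx _ mt
      simp only [backT, backX, Nat.add_sub_cancel] at e1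
      simp only [← hxdef, ← htdef, ← hHdef] at e1
      have c1 := B.time_residual hK₀ hε hα hC₂' hT R mx hj
      have c2 := B.space_residual hK₀ hε hL S mt hi
      have c3 := S.layerBarrier_residual hε hi
      have hlp := layer_pos L ε (x (i + 1))
      refine (abs_residual_le hα (ha _ (Ioc_subset_Icc_self mx) _ (Ioc_subset_Icc_self mt)) c1 c2
        (D := fittingFactor n (H / ε) (i + 1) * ((Y (i + 1) - Y i) / (x (i + 1) - x i)))
        ?_ ?_).trans_eq (mul_assoc _ _ _).symm
      · have c4 := mul_le_mul_of_nonneg_left c3 hP0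
        have e3 : fittingFactor n (H / ε) (i + 1) * ((Y (i + 1) - Y i) / (x (i + 1) - x i)) =
            P * (fittingFactor n (H / ε) (i + 1) * ((layerBarrier L ε x (i + 1) -
              layerBarrier L ε x i) / (x (i + 1) - x i))) +
            Q * (fittingFactor n (H / ε) (i + 1) *
              ((transitionBarrier L ε (sigma L ε (2 * n)) H n x (i + 1) -
                transitionBarrier L ε (sigma L ε (2 * n)) H n x i) / (x (i + 1) - x i))) := by
          simp only [hY]; ring
        rw [e3]
        refine le_trans (le_of_eq ?_) (add_le_add_left c4 _)
        rw [hP]; ring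
      · rw [← e2] at e1
        have e4 : (U (i + 1) (j + 1) - u (x (i + 1)) (t (j + 1)) -
              (U (i + 1) j - u (x (i + 1)) (t j))) / (t (j + 1) - t j) =
            (U (i + 1) (j + 1) - U (i + 1) j) / (t (j + 1) - t j) -
            (u (x (i + 1)) (t (j + 1)) - u (x (i + 1)) (t j)) / (t (j + 1) - t j) := by ring
        have e5 : (U (i + 1) (j + 1) - u (x (i + 1)) (t (j + 1)) -
              (U i (j + 1) - u (x i) (t (j + 1)))) / (x (i + 1) - x i) =
            (U (i + 1) (j + 1) - U i (j + 1)) / (x (i + 1) - x i) -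
            (u (x (i + 1)) (t (j + 1)) - u (x i) (t (j + 1))) / (x (i + 1) - x i) := by ring
        rw [e4, e5]
        linear_combination e1)
  exact fun j hj i hi => (key j hj i hi).trans (hYle i hi)

/-- The variation of the solution over one mesh cell. -/
lemma LayerBounds.abs_sub_le_of_mem_cell {ux ut : ℝ → ℝ → ℝ} {σ H h ν τ K k μ : ℝ} {n m : ℕ}
    {x t : ℕ → ℝ} (B : LayerBounds L T α K₀ ε u ux ut) (hK₀ : 0 ≤ K₀) (hε : 0 < ε) (hα : 0 < α)
    (hC₂ : 0 < C₂) (S : SpaceMesh L ε σ H h ν n x) (R : TimeMesh T α C₂ ε τ K k μ m t) {i j : ℕ}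
    (hi : i < 2 * n) (hj : j < 2 * m) {y₁ y₂ s₁ s₂ : ℝ} (hy₁ : y₁ ∈ Icc (x i) (x (i + 1)))
    (hy₂ : y₂ ∈ Icc (x i) (x (i + 1))) (hs₁ : s₁ ∈ Icc (t j) (t (j + 1)))
    (hs₂ : s₂ ∈ Icc (t j) (t (j + 1))) :
    |u y₁ s₁ - u y₂ s₂| ≤ K₀ * (4 * L + 2) * ν + K₀ * (4 * T + 2 * α * C₂ + 2) * μ := by
  have m0 := (S.mem (i := i) (by omega)).1
  have m1 := (S.mem (i := i + 1) (by omega)).2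
  have r0 := (R.mem (j := j) (by omega)).1
  have r1 := (R.mem (j := j + 1) (by omega)).2
  have hμ := R.μ_nonneg
  have hx : ∀ y y', x i ≤ y → y ≤ y' → y' ≤ x (i + 1) →
      |u y' s₁ - u y s₁| ≤ K₀ * (4 * L + 2) * ν := fun y y' h1 h2 h3 => by
    refine (B.lip_x s₁ ⟨r0.trans hs₁.1, hs₁.2.trans r1⟩ y y' (m0.trans h1) h2
      (h3.trans m1)).trans ?_
    rw [mul_assoc]
    refine mul_le_mul_of_nonneg_left ?_ hK₀
    have := S.step_le i
    have := S.layer_step_le hε hi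
    have := layer_mono hε (L := L) h1
    have := layer_mono hε (L := L) h3
    linarith
  have ht : ∀ s s', t j ≤ s → s ≤ s' → s' ≤ t (j + 1) →
      |u y₂ s' - u y₂ s| ≤ K₀ * (4 * T + 2 * α * C₂ + 2) * μ := fun s s' h1 h2 h3 => by
    refine (B.lip_t y₂ ⟨m0.trans hy₂.1, hy₂.2.trans m1⟩ s s' (r0.trans h1) h2
      (h3.trans r1)).trans ?_
    rw [mul_assoc]
    refine mul_le_mul_of_nonneg_left ?_ hK₀
    have := R.step_le j
    have c1 := R.cornerLayer_step_le (L := L) (x := y₂) hε hα hC₂ hj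
    have c2 := mul_le_mul_of_nonneg_left (layer_le_one hε (hy₂.2.trans m1))
      (show 0 ≤ (2 * α * C₂ + 2) * μ by positivity)
    have := cornerLayer_le L (α := α) (x := y₂) (y := y₂) (t := s) (s := t j) hε
      (by linarith [mul_le_mul_of_nonneg_left h1 hα.le])
    have := cornerLayer_le L (α := α) (x := y₂) (y := y₂) (t := t (j + 1)) (s := s') hε
      (by linarith [mul_le_mul_of_nonneg_left h3 hα.le])
    linarith
  have hX : |u y₁ s₁ - u y₂ s₁| ≤ K₀ * (4 * L + 2) * ν := by
    rcases le_total y₂ y₁ with h | h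
    · exact hx _ _ hy₂.1 h hy₁.2
    · rw [abs_sub_comm]; exact hx _ _ hy₁.1 h hy₂.2
  have hT : |u y₂ s₁ - u y₂ s₂| ≤ K₀ * (4 * T + 2 * α * C₂ + 2) * μ := by
    rcases le_total s₂ s₁ with h | h
    · exact ht _ _ hs₂.1 h hs₁.2
    · rw [abs_sub_comm]; exact ht _ _ hs₁.1 h hs₂.2
  exact (abs_sub_le _ (u y₂ s₁) _).trans (add_le_add hX hT)

end

end TransportLayer


theorem mainTheorem1 (L T α C₁ C₂ : ℝ) (a b : ℝ → ℝ → ℝ) (φ ψ : ℝ → ℝ)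
    (hL : 0 < L) (hT : 0 < T) (hα : 0 < α) (hC₂ : α⁻¹ < C₂)
    (ha : ContDiffOn ℝ 2 (Function.uncurry a) (TransportLayer.closedDomain L T))
    (hb : ContDiffOn ℝ 2 (Function.uncurry b) (TransportLayer.closedDomain L T))
    (hφ : ContDiffOn ℝ 2 φ (Set.Icc 0 L))
    (hψ : ContDiffOn ℝ 2 ψ (Set.Icc 0 T))
    (ha_lower : ∀ x ∈ Set.Icc 0 L, ∀ t ∈ Set.Icc 0 T, α ≤ a x t)
    (hb_nonneg : ∀ x ∈ Set.Icc 0 L, ∀ t ∈ Set.Icc 0 T, 0 ≤ b x t) :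
    ∃ C : ℝ, ∀ ε : ℝ, 0 < ε → ε ≤ 1 →
      ∀ f : ℝ → ℝ → ℝ,
        ContDiffOn ℝ 2 (Function.uncurry f) (TransportLayer.closedDomain L T) →
        TransportLayer.Compatible L T a b f φ ψ →
        TransportLayer.OutflowLayerForcing L T ε C₁ f →
      ∀ u : ℝ → ℝ → ℝ, TransportLayer.IsSolution L T a b f φ ψ u →
      ∀ N M : ℕ, 0 < N → Even N → 0 < M → Even M →
      ∀ U : ℕ → ℕ → ℝ, TransportLayer.IsDiscreteSolution L T C₂ ε N M a b f φ ψ U →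
      ∀ x ∈ Set.Icc 0 L, ∀ t ∈ Set.Icc 0 T,
        |TransportLayer.interpolant L T C₂ ε N M U x t - u x t| ≤
          C * ((N : ℝ)⁻¹ * Real.log N + (M : ℝ)⁻¹ * Real.log M) := by
  obtain ⟨Λ, hΛ⟩ := TransportLayer.exists_classicalProblem L T α C₁ a b φ ψ hL hT hα ha hb hφ hψ ha_lower
    hb_nonneg
  obtain ⟨K₀, hK₀, hK⟩ := TransportLayer.ClassicalProblem.exists_layerBounds L T α Λ
  have hC₂' : 0 < C₂ := (inv_pos.2 hα).trans hC₂
  set κ := K₀ * (4 * T + 2 * α * C₂ + 2) with hκ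
  have hκ0 : 0 ≤ κ := by positivity
  refine ⟨(8 * (α⁻¹ * κ) * (L + 1) + κ) +
    (8 * (K₀ * (4 * L + 4)) * (L + 1) + K₀ * (4 + L⁻¹) * (4 * L + 2) + K₀ * (4 * L + 2)),
    fun ε hε hε1 f hf hcomp hlayer u hu N M hN hNe hM hMe U hU x hx t ht => ?_⟩
  obtain ⟨n, rfl⟩ := hNe.two_dvd
  obtain ⟨m, rfl⟩ := hMe.two_dvd
  have hn : 0 < n := by omega
  have hm : 0 < m := by omega
  obtain ⟨q, c, F, φ', g, g', P⟩ := hΛ ε hε hε1 f hf hcomp hlayer u hu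
  have B := hK P
  have S := TransportLayer.spaceMesh hL hε hn
  have R := TransportLayer.timeMesh hT hα hC₂ hε hm
  have E := TransportLayer.abs_sub_solution_le_of_mem_mesh hL hT hα hC₂ hε hK₀ ha_lower hb_nonneg B hu hn hm hU
    rfl rfl
  set ν := ((2 * n : ℕ) : ℝ)⁻¹ * Real.log ((2 * n : ℕ) : ℝ) with hν
  set μ := ((2 * m : ℕ) : ℝ)⁻¹ * Real.log ((2 * m : ℕ) : ℝ) with hμ
  have hν0 := S.ν_nonneg
  have hμ0 := R.μ_nonneg
  obtain ⟨i, hi, hi1, hi2⟩ := TransportLayer.exists_mem_cell hN (S.zero.trans_le hx.1)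
    (hx.2.trans_eq S.last.symm)
  obtain ⟨j, hj, hj1, hj2⟩ := TransportLayer.exists_mem_cell hM (R.zero.trans_le ht.1)
    (ht.2.trans_eq R.last.symm)
  refine TransportLayer.abs_interpolant_sub_le S.strictMono R.strictMono hi hj hi1 hi2 hj1 hj2
    fun k hk l hl => ?_
  have h1 := E l (by omega) k (by omega)
  have h2 := B.abs_sub_le_of_mem_cell hK₀ hε hα hC₂' S R hi hj
    (y₁ := TransportLayer.meshX L ε (2 * n) k) (s₁ := TransportLayer.meshT T C₂ ε (2 * m) l)
    ⟨S.strictMono.monotone (by omega), S.strictMono.monotone (by omega)⟩ ⟨hi1, hi2⟩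
    ⟨R.strictMono.monotone (by omega), R.strictMono.monotone (by omega)⟩ ⟨hj1, hj2⟩
  refine ((abs_sub_le _ _ _).trans (add_le_add h1 h2)).trans ?_
  have z1 : 0 ≤ (8 * (α⁻¹ * κ) * (L + 1) + κ) * ν := by positivity
  have z2 : 0 ≤ (8 * (K₀ * (4 * L + 4)) * (L + 1) + K₀ * (4 + L⁻¹) * (4 * L + 2) +
    K₀ * (4 * L + 2)) * μ := by positivity
  rw [← hκ]
  linarith
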